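/- **Setting.** Let $S\subset\mathbb C^2$ be an algebraic curve of degree $m\ge 1$ whose projective closure meets the line at infinity in $m$ distinct points, none of which is the centre $[0:1:0]$ of the projection $\Pi(x,y)=x$; thus $\Pi|_S$ has degree $m$. Let $N=\{x\in\mathbb C : \#(S\cap\Pi^{-1}(x))<m\}$, let $D\subset\mathbb C$ be a closed disc whose interior contains $N$, and let $u\in\partial D$. For $x\notin N$ let $K_x=\{y : (x,y)\in S\}$, an $m$-point subset of $\mathbb C$. Let $B_m[\mathbb C_u,K_u]$ be the braid group of $\mathbb C$ based at $K_u$, that is, the fundamental group, based at $K_u$, of the space of $m$-point subsets of $\mathbb C$. The *braid monodromy* of $S$ is the homomorphism $\varphi:\pi_1(\mathbb C-N,u)\to B_m[\mathbb C_u,K_u]$ induced by $x\mapsto K_x$. Let $\Delta^2\in B_m[\mathbb C_u,K_u]$ be the full twist, the class of $t\mapsto e^{2\pi i t}K_u$, $t\in[0,1]$. The *frame elements* of $B_m[\mathbb C_u,K_u]$ are the braids obtained from the standard half twists $X_1,\dots,X_{m-1}$ (where $X_i$ exchanges two neighbouring points of $\{0,1,\dots,m-1\}$ by a positive half turn about their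 midpoint) by transport along a path of configurations from $K_u$ to $\{0,\dots,m-1\}$. A braid is *positive* if it is a product of one or more conjugates of frame elements. A *positive factorization* of $\Delta^2$ is a tuple $(a_1,\dots,a_n)$ of positive braids with $a_1\cdots a_n=\Delta^2$. A *geometric base* of $\pi_1(\mathbb C-N,u)$ is a tuple $(\delta_1,\dots,\delta_n)$, $n=\#N$, for which there are simple paths $T_1,\dots,T_n$ in $D$ from $u$ to the points of $N$, one for each point of $N$, each meeting $N$ only in its end point and any two meeting only in $u$, such that $\delta_i$ is the class of the loop which follows $T_i$ to a point near its end point, turns once counterclockwise around the end point, and returns along $T_i$, and such that $\delta_1\cdots\delta_n$ is the class of the positively oriented circle $\partial D$. The *braid monodromy factorization* of $S$ given by such a base is $(\varphi(\delta_1),\dots,\varphi(\delta_n))$. A *Hurwitz move* replaces two neighbouring entries $(b_k,b_{k+1})$ of a tuple in a group by $(b_kb_{k+1}b_k^{-1},\,b_k)$; *Hurwitz equivalence* is the equivalence relation generated by Hurwitz moves. **Statement.** The set of the braid monodromy factorizations of $S$ obtained from all geometric bases of $\pi_1(\mathbb C-N,u)$ is exactly one full Hurwitz-equivalence class of positive factorizations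 of $\Delta^2$. That is: this set is not empty, each of its members is a positive factorization of $\Delta^2$, any two of its members are Hurwitz equivalent, and every positive factorization of $\Delta^2$ that is Hurwitz equivalent to a member of the set belongs to the set. -/

import Mathlib

namespace BraidMonodromy

open Set Metric

noncomputable section

/-! ### Configurations of points in the complex line and braids -/

/-- The space of `m`-point subsets of `ℂ`. -/
def Conf (m : ℕ) : Type := {s : Finset ℂ // s.card = m}

/-- An `m`-point set `s` has as coordinates the elementary symmetric functions of its points (up to
sign, the coefficients of `∏ a ∈ s, (X - a)`); this identifies `Conf m` with the complement of the
discriminant hypersurface in `ℂ ^ m`. -/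
instance (m : ℕ) : TopologicalSpace (Conf m) :=
  TopologicalSpace.induced (fun s (k : ℕ) => s.1.val.esymm k) inferInstance

/-- The group of braids `B_m[ℂ, K]` of the complex line based at the `m`-point set `K`. -/
abbrev Braid {m : ℕ} (K : Conf m) : Type := FundamentalGroup (Conf m) K

/-- The configuration of the points `F j`, `j ∈ s`. -/
def Conf.ofPoints {ι : Type} {m : ℕ} (s : Finset ι) (hs : s.card = m) (F : ι → ℂ)
    (hF : InjOn F s) : Conf m :=
  ⟨s.image F, by rw [Finset.card_image_of_injOn hF, hs]⟩

lemma Conf.continuous_iff {m : ℕ} {T : Type} [TopologicalSpace T] {g : T → Conf m} :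
    Continuous g ↔ ∀ k, Continuous fun t => (g t).1.val.esymm k := by
  rw [continuous_induced_rng, continuous_pi_iff]
  rfl

lemma Conf.continuous_ofPoints {ι T : Type} [TopologicalSpace T] {m : ℕ} (s : Finset ι)
    (hs : s.card = m) (F : T → ι → ℂ) (hF : ∀ t, InjOn (F t) s)
    (hc : ∀ j, Continuous fun t => F t j) :
    Continuous fun t => Conf.ofPoints s hs (F t) (hF t) := by
  rw [Conf.continuous_iff]
  intro k
  have h : ∀ t, (Conf.ofPoints s hs (F t) (hF t)).1.val.esymm k
      = (s.powersetCard k).sum fun r => r.prod (F t) := by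
    intro t
    rw [← Finset.esymm_map_val]
    congr 1
    exact Finset.image_val_of_injOn (hF t)
  simp only [h]
  fun_prop

lemma Conf.ofPoints_ext {ι : Type} {m : ℕ} {s : Finset ι} {hs : s.card = m} {F : ι → ℂ}
    {hF : InjOn F s} {K : Conf m} (h : s.image F = K.1) : Conf.ofPoints s hs F hF = K :=
  Subtype.ext h

/-- `exp (2 π i t)`. -/
def turn (t : ℝ) : ℂ := Complex.exp (2 * Real.pi * t * Complex.I)

@[fun_prop]
lemma continuous_turn : Continuous turn := by
  unfold turn
  fun_prop

lemma norm_turn (t : ℝ) : ‖turn t‖ = 1 := by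
  have h : turn t = Complex.exp ((2 * Real.pi * t : ℝ) * Complex.I) := by
    simp [turn]
  rw [h, Complex.norm_exp_ofReal_mul_I]

lemma turn_ne_zero (t : ℝ) : turn t ≠ 0 := Complex.exp_ne_zero _

lemma turn_zero : turn 0 = 1 := by simp [turn]

lemma turn_one : turn 1 = 1 := by simp [turn, Complex.exp_two_pi_mul_I]

lemma turn_half : turn (1 / 2) = -1 := by
  rw [turn, ← Complex.exp_pi_mul_I]
  congr 1
  push_cast
  ring

/-- The full positive rotation of the configuration `K`, as a loop of configurations. -/
def rotation {m : ℕ} (K : Conf m) : Path K K where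
  toFun t := Conf.ofPoints K.1 K.2 (fun z => turn t * z)
    fun _ _ _ _ h => mul_left_cancel₀ (turn_ne_zero _) h
  continuous_toFun := Conf.continuous_ofPoints _ _ _ _ fun j => by fun_prop
  source' := Conf.ofPoints_ext (by simp [turn_zero])
  target' := Conf.ofPoints_ext (by simp [turn_one])

/-- The full twist `Δ²`. -/
def deltaSq {m : ℕ} (K : Conf m) : Braid K :=
  FundamentalGroup.fromPath (Path.Homotopic.Quotient.mk (rotation K))

/-- The configuration `{0, 1, …, m - 1}`. -/
def stdConf (m : ℕ) : Conf m :=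
  Conf.ofPoints (Finset.range m) (Finset.card_range m) (fun j => (j : ℂ))
    fun _ _ _ _ h => Nat.cast_injective h

/-- The motion of the points `0, 1, …, m - 1` at time `t` in which `i` and `i + 1` are exchanged by
a positive half turn about their midpoint and the other points rest. -/
def swapMotion (i : ℕ) (t : ℝ) (j : ℕ) : ℂ :=
  if j = i then (i + 1 / 2 : ℂ) - turn (t / 2) / 2
  else if j = i + 1 then (i + 1 / 2 : ℂ) + turn (t / 2) / 2
  else j

lemma swapMotion_injective (i : ℕ) (t : ℝ) : Function.Injective (swapMotion i t) := by
  have hn : ‖turn (t / 2) / 2‖ = 1 / 2 := by rw [norm_div, norm_turn]; norm_num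
  have h0 : turn (t / 2) ≠ 0 := turn_ne_zero _
  have far : ∀ j : ℕ, j ≠ i → j ≠ i + 1 → ‖(j : ℂ) - (i + 1 / 2 : ℂ)‖ ≠ 1 / 2 := by
    intro j h1 h2 h
    have e : (j : ℂ) - (i + 1 / 2 : ℂ) = (((j : ℝ) - (i + 1 / 2) : ℝ) : ℂ) := by push_cast; ring
    rw [e, Complex.norm_real, Real.norm_eq_abs] at h
    rcases abs_eq (by norm_num : (0 : ℝ) ≤ 1 / 2) |>.1 h with h | h
    · apply h2
      have : (j : ℝ) = (i : ℝ) + 1 := by linarith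
      exact_mod_cast this
    · apply h1
      have : (j : ℝ) = (i : ℝ) := by linarith
      exact_mod_cast this
  have near1 : ∀ j : ℕ, j ≠ i → j ≠ i + 1 → (j : ℂ) ≠ (i + 1 / 2 : ℂ) - turn (t / 2) / 2 := by
    intro j h1 h2 h
    apply far j h1 h2
    rw [h, sub_sub_cancel_left, norm_neg, hn]
  have near2 : ∀ j : ℕ, j ≠ i → j ≠ i + 1 → (j : ℂ) ≠ (i + 1 / 2 : ℂ) + turn (t / 2) / 2 := by
    intro j h1 h2 h
    apply far j h1 h2
    rw [h, add_sub_cancel_left, hn]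
  have opp : (i + 1 / 2 : ℂ) - turn (t / 2) / 2 ≠ (i + 1 / 2 : ℂ) + turn (t / 2) / 2 := by
    intro h
    apply h0
    linear_combination -h
  intro j k h
  unfold swapMotion at h
  split_ifs at h with a b c d e f g
  · omega
  · exact absurd h opp
  · exact absurd h.symm (near1 k ‹_› ‹_›)
  · exact absurd h.symm opp
  · omega
  · exact absurd h.symm (near2 k ‹_› ‹_›)
  · exact absurd h (near1 j ‹_› ‹_›)
  · exact absurd h (near2 j ‹_› ‹_›)
  · exact_mod_cast h

lemma image_swapMotion_zero (m i : ℕ) :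
    (Finset.range m).image (swapMotion i 0) = (stdConf m).1 := by
  have h : swapMotion i 0 = fun j : ℕ => (j : ℂ) := by
    funext j
    unfold swapMotion
    split_ifs with h1 h2
    · subst h1; simp [turn_zero]
    · subst h2; simp [turn_zero]; ring
    · rfl
  rw [h]
  rfl

lemma image_swapMotion_one (m i : ℕ) (hi : i + 1 < m) :
    (Finset.range m).image (swapMotion i 1) = (stdConf m).1 := by
  have h : swapMotion i 1 = (fun j : ℕ => (j : ℂ)) ∘ Equiv.swap i (i + 1) := by
    funext j
    simp only [swapMotion, Function.comp, turn_half]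
    split_ifs with h1 h2
    · subst h1; simp; ring
    · subst h2; simp; ring
    · rw [Equiv.swap_apply_of_ne_of_ne h1 h2]
  have hs : (Finset.range m).image (Equiv.swap i (i + 1)) = Finset.range m := by
    apply Finset.eq_of_subset_of_card_le
    · intro j hj
      simp only [Finset.mem_image, Finset.mem_range] at hj ⊢
      obtain ⟨k, hk, rfl⟩ := hj
      rw [Equiv.swap_apply_def]
      split_ifs <;> omega
    · rw [Finset.card_image_of_injective _ (Equiv.injective _)]
  rw [h, ← Finset.image_image, hs]
  rfl

/-- The standard half twist exchanging the points `i` and `i + 1` of `{0, 1, …, m - 1}`. -/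
def halfTwist (m i : ℕ) (hi : i + 1 < m) : Path (stdConf m) (stdConf m) where
  toFun t := Conf.ofPoints (Finset.range m) (Finset.card_range m) (swapMotion i t)
    (swapMotion_injective i t).injOn
  continuous_toFun := Conf.continuous_ofPoints _ _ (fun t : unitInterval => swapMotion i t) _
    fun j => by
      simp only [swapMotion]
      split_ifs <;> fun_prop
  source' := Conf.ofPoints_ext (image_swapMotion_zero m i)
  target' := Conf.ofPoints_ext (image_swapMotion_one m i hi)

/-- Frame elements. A frame of `B_m[ℂ, K]` is obtained by carrying the standard half twists
`X_1, …, X_{m-1}` at `{0, 1, …, m - 1}` to `K` along a path of configurations. -/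
def IsFrameElement {m : ℕ} (K : Conf m) (b : Braid K) : Prop :=
  ∃ (γ : Path K (stdConf m)) (i : ℕ) (hi : i + 1 < m),
    b = FundamentalGroup.fromPath
      (Path.Homotopic.Quotient.mk ((γ.trans (halfTwist m i hi)).trans γ.symm))

/-- Positive braids: the products of one or more conjugates of frame elements. -/
def IsPositive {m : ℕ} (K : Conf m) (b : Braid K) : Prop :=
  b ∈ Subsemigroup.closure {x : Braid K | ∃ g h, IsFrameElement K h ∧ x = g * h * g⁻¹}

/-! ### Hurwitz equivalence of positive factorizations -/

/-- The tuple `a` is obtained from the tuple `b` by a Hurwitz move. -/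
def HurwitzMove {G : Type*} [Group G] (a b : List G) : Prop :=
  ∃ (l r : List G) (x y : G), b = l ++ x :: y :: r ∧ a = l ++ (x * y * x⁻¹) :: x :: r

/-- The equivalence relation generated by Hurwitz moves: finite sequences of Hurwitz moves and
their inverses. -/
def hurwitzSetoid (G : Type*) [Group G] : Setoid (List G) :=
  Relation.EqvGen.setoid HurwitzMove

/-- Positive factorizations of `Δ²`. -/
def PositiveFactorization {m : ℕ} (K : Conf m) : Type :=
  {a : List (Braid K) // a.prod = deltaSq K ∧ ∀ b ∈ a, IsPositive K b}

/-- Hurwitz equivalence of positive factorizations. -/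
def PositiveFactorization.setoid {m : ℕ} (K : Conf m) : Setoid (PositiveFactorization K) :=
  (hurwitzSetoid (Braid K)).comap Subtype.val

/-! ### Geometric bases of the fundamental group of a punctured plane -/

/-- The complement of `N` in the complex line. -/
abbrev Punctured (N : Set ℂ) : Type := {x : ℂ // x ∉ N}

/-- `ω` runs once counterclockwise along the circle with centre `c` through its base point. -/
def IsCircle {N : Set ℂ} (c : ℂ) {v : Punctured N} (ω : Path v v) : Prop :=
  ∀ t : unitInterval, (ω t : ℂ) = c + turn t * ((v : ℂ) - c)

/-- `δ` is the class of the loop that follows the path `T` from `u` up to a point `T s` close to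
its end point `a`, turns once counterclockwise around `a`, and returns along `T`. Here `close`
means that from time `s` on, `T` stays in a disc around `a` which contains no other point of `N`. -/
def IsLoopAlong {N : Set ℂ} {u : Punctured N} {a : ℂ} (T : Path (u : ℂ) a)
    (δ : FundamentalGroup (Punctured N) u) : Prop :=
  ∃ (s : unitInterval) (ε : ℝ), ball a ε ∩ N ⊆ {a} ∧ (∀ t, s ≤ t → T t ∈ ball a ε) ∧
    ∃ (v : Punctured N) (q : Path u v) (ω : Path v v),
      (∀ t, (q t : ℂ) = T (s * t)) ∧ IsCircle a ω ∧
      δ = FundamentalGroup.fromPath (Path.Homotopic.Quotient.mk ((q.trans ω).trans q.symm))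

/-- A bush: simple paths in the closed disc with centre `c` and radius `R`, which join `u` to the
points of `N`, one path for each point, and which meet one another only in `u`. -/
structure IsBush {N : Set ℂ} (c : ℂ) (R : ℝ) (u : Punctured N) {n : ℕ} (a : Fin n → ℂ)
    (T : ∀ i, Path (u : ℂ) (a i)) : Prop where
  endpoint_injective : Function.Injective a
  range_endpoint : range a = N
  simple : ∀ i, Function.Injective (T i)
  mem_disc : ∀ i t, T i t ∈ closedBall c R
  eq_endpoint : ∀ i t, T i t ∈ N → T i t = a i
  disjoint : ∀ i j, i ≠ j → ∀ s t, T i s = T j t → T i s = (u : ℂ)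

/-- A geometric base of `π₁(ℂ - N, u)`, where `u` lies on the boundary of a disc with centre `c`
and radius `R` whose interior contains `N`: the loops along the paths of a bush, in the order in
which their product is the class of the positively oriented boundary circle. -/
def IsGeometricBase {N : Set ℂ} (c : ℂ) (R : ℝ) (u : Punctured N)
    (δ : List (FundamentalGroup (Punctured N) u)) : Prop :=
  (∃ (a : Fin δ.length → ℂ) (T : ∀ i, Path (u : ℂ) (a i)),
    IsBush c R u a T ∧ ∀ i, IsLoopAlong (T i) (δ.get i)) ∧
  ∃ ω : Path u u, IsCircle c ω ∧
    δ.prod = FundamentalGroup.fromPath (Path.Homotopic.Quotient.mk ω)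

/-! ### Plane curves and their braid monodromy -/

/-- `S ⊆ ℂ²` is an algebraic curve of degree `m` whose projective closure meets the line at infinity
in `m` distinct points (hence transversally), all of them different from the centre `[0 : 1 : 0]` of
the projection `(x, y) ↦ x`. The points at infinity `[1 : l : 0]` are given by the zeros `l` of the
leading form of the equation. Such an equation is automatically reduced. -/
def IsGenericCurve (m : ℕ) (S : Set (ℂ × ℂ)) : Prop :=
  0 < m ∧ ∃ f : MvPolynomial (Fin 2) ℂ, f.totalDegree = m ∧
    S = {p | MvPolynomial.eval ![p.1, p.2] f = 0} ∧
    {l : ℂ | MvPolynomial.eval ![1, l] (MvPolynomial.homogeneousComponent m f) = 0}.encard = m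

/-- The points of `S` over `x`. -/
def fiber (S : Set (ℂ × ℂ)) (x : ℂ) : Set ℂ := {y | (x, y) ∈ S}

/-- The set `N` of the points `x` over which `S` has fewer than `m` points. -/
def branchSet (m : ℕ) (S : Set (ℂ × ℂ)) : Set ℂ := {x | (fiber S x).encard < m}

/-- The polynomial `f (x, ·)`. -/
def slice (f : MvPolynomial (Fin 2) ℂ) (x : ℂ) : Polynomial ℂ :=
  MvPolynomial.aeval ![Polynomial.C x, Polynomial.X] f

lemma eval_slice (f : MvPolynomial (Fin 2) ℂ) (x y : ℂ) :
    (slice f x).eval y = MvPolynomial.eval ![x, y] f := by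
  rw [slice, MvPolynomial.aeval_def, MvPolynomial.eval₂_eq', MvPolynomial.eval_eq',
    Polynomial.eval_finsetSum]
  simp [Fin.prod_univ_two]

lemma coeff_slice (f : MvPolynomial (Fin 2) ℂ) (x : ℂ) (k : ℕ) :
    (slice f x).coeff k = ∑ d ∈ f.support, f.coeff d * x ^ d 0 * if k = d 1 then 1 else 0 := by
  rw [slice, MvPolynomial.aeval_def, MvPolynomial.eval₂_eq', Polynomial.finsetSum_coeff]
  refine Finset.sum_congr rfl fun d _ => ?_
  simp only [Fin.prod_univ_two, Matrix.cons_val_zero, Matrix.cons_val_one,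
    ← Polynomial.C_pow, Polynomial.algebraMap_eq, Polynomial.coeff_C_mul, Polynomial.coeff_X_pow,
    mul_assoc]

lemma degree_fin_two (d : Fin 2 →₀ ℕ) : (d.sum fun _ e => e) = d 0 + d 1 := by
  rw [Finsupp.sum_fintype _ _ fun _ => rfl, Fin.sum_univ_two]

lemma natDegree_slice_le {f : MvPolynomial (Fin 2) ℂ} {m : ℕ} (hf : f.totalDegree ≤ m) (x : ℂ) :
    (slice f x).natDegree ≤ m := by
  rw [Polynomial.natDegree_le_iff_coeff_eq_zero]
  intro k hk
  rw [coeff_slice]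
  refine Finset.sum_eq_zero fun d hd => ?_
  have h := MvPolynomial.le_totalDegree hd
  rw [degree_fin_two] at h
  rw [if_neg (by omega), mul_zero]

lemma coeff_slice_top {f : MvPolynomial (Fin 2) ℂ} {m : ℕ} (hf : f.totalDegree ≤ m) (x : ℂ) :
    (slice f x).coeff m = f.coeff (Finsupp.single 1 m) := by
  rw [coeff_slice, Finset.sum_eq_single (Finsupp.single (1 : Fin 2) m)]
  · simp
  · intro d hd hne
    have h := MvPolynomial.le_totalDegree hd
    rw [degree_fin_two] at h
    rw [if_neg, mul_zero]
    intro hk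
    apply hne
    ext i
    fin_cases i
    · simp; omega
    · simp [hk]
  · intro h
    rw [MvPolynomial.notMem_support_iff.1 h]
    simp

lemma top_ne_zero {f : MvPolynomial (Fin 2) ℂ} {m : ℕ}
    (hl : {l : ℂ | MvPolynomial.eval ![1, l]
      (MvPolynomial.homogeneousComponent m f) = 0}.encard = m) :
    f.coeff (Finsupp.single 1 m) ≠ 0 := by
  set g := MvPolynomial.homogeneousComponent m f with hg
  have hgd : g.totalDegree ≤ m := (MvPolynomial.homogeneousComponent_isHomogeneous m f).totalDegree_le
  have e : g.coeff (Finsupp.single 1 m) = f.coeff (Finsupp.single 1 m) := by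
    rw [hg, MvPolynomial.coeff_homogeneousComponent, if_pos]
    simp
  rw [← e, ← coeff_slice_top hgd 1]
  have hs : {l : ℂ | MvPolynomial.eval ![1, l] g = 0} = {l | (slice g 1).IsRoot l} := by
    ext l
    simp [Polynomial.IsRoot, eval_slice]
  rw [hs] at hl
  have h0 : slice g 1 ≠ 0 := by
    intro h
    have : {l : ℂ | (slice g 1).IsRoot l} = univ := by
      ext l; simp [h]
    rw [this, encard_eq_top infinite_univ] at hl
    exact absurd hl (by simp)
  have hr : {l : ℂ | (slice g 1).IsRoot l} = ((slice g 1).roots.toFinset : Set ℂ) := by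
    ext l; simp [h0]
  rw [hr, encard_coe_eq_coe_finsetCard, Nat.cast_inj] at hl
  have h1 : m ≤ (slice g 1).natDegree :=
    hl ▸ (Multiset.toFinset_card_le _).trans (Polynomial.card_roots' _)
  have h2 : (slice g 1).natDegree = m := le_antisymm (natDegree_slice_le hgd 1) h1
  rw [← h2]
  exact Polynomial.leadingCoeff_ne_zero.2 h0

lemma fiber_eq_roots {m : ℕ} {S : Set (ℂ × ℂ)} {f : MvPolynomial (Fin 2) ℂ}
    (hS : S = {p | MvPolynomial.eval ![p.1, p.2] f = 0}) (x : ℂ) (h0 : (slice f x).coeff m ≠ 0) :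
    fiber S x = ((slice f x).roots.toFinset : Set ℂ) := by
  have h : slice f x ≠ 0 := by
    intro h
    simp [h] at h0
  ext y
  simp [fiber, hS, h, ← eval_slice, Polynomial.IsRoot]

lemma encard_fiber_le {m : ℕ} {S : Set (ℂ × ℂ)} (hS : IsGenericCurve m S) (x : ℂ) :
    (fiber S x).encard ≤ m := by
  obtain ⟨-, f, hd, hf, hl⟩ := hS
  have hc := top_ne_zero hl
  rw [← coeff_slice_top hd.le x] at hc
  rw [fiber_eq_roots hf x hc, encard_coe_eq_coe_finsetCard, Nat.cast_le]
  exact (Multiset.toFinset_card_le _).trans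
    ((Polynomial.card_roots' _).trans (natDegree_slice_le hd.le x))

lemma encard_fiber {m : ℕ} {S : Set (ℂ × ℂ)} (hS : IsGenericCurve m S)
    (x : Punctured (branchSet m S)) : (fiber S x).encard = m :=
  le_antisymm (encard_fiber_le hS x) (not_lt.1 x.2)

lemma finite_fiber {m : ℕ} {S : Set (ℂ × ℂ)} (hS : IsGenericCurve m S)
    (x : Punctured (branchSet m S)) : (fiber S x).Finite :=
  finite_of_encard_eq_coe (encard_fiber hS x)

/-- The fibre of `S` over a point outside `N`, as an `m`-point subset of the complex line. -/
def fiberConf {m : ℕ} {S : Set (ℂ × ℂ)} (hS : IsGenericCurve m S)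
    (x : Punctured (branchSet m S)) : Conf m :=
  ⟨(finite_fiber hS x).toFinset, by
    have h := encard_fiber hS x
    rw [(finite_fiber hS x).encard_eq_coe_toFinset_card, Nat.cast_inj] at h
    exact h⟩

lemma continuous_fiberConf {m : ℕ} {S : Set (ℂ × ℂ)} (hS : IsGenericCurve m S) :
    Continuous (fiberConf hS) := by
  rw [Conf.continuous_iff]
  intro k
  obtain ⟨-, f, hd, hf, hl⟩ := id hS
  have hc := top_ne_zero hl
  by_cases hk : k ≤ m
  · have key : ∀ x : Punctured (branchSet m S), (fiberConf hS x).1.val.esymm k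
        = (slice f x).coeff (m - k) / (f.coeff (Finsupp.single 1 m) * (-1) ^ k) := by
      intro x
      have ht := coeff_slice_top hd.le (x : ℂ)
      have hc' : (slice f x).coeff m ≠ 0 := by rwa [ht]
      have hr : (fiberConf hS x).1 = (slice f x).roots.toFinset := by
        apply Finset.coe_injective
        rw [← fiber_eq_roots hf x hc']
        exact (finite_fiber hS x).coe_toFinset
      have hn : (slice f x).natDegree = m :=
        le_antisymm (natDegree_slice_le hd.le x) (Polynomial.le_natDegree_of_ne_zero hc')
      have hcard : (slice f x).roots.toFinset.card = m := by
        rw [← hr]; exact (fiberConf hS x).2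
      have hle : (slice f x).roots.card ≤ m := (Polynomial.card_roots' _).trans hn.le
      have hroots : (slice f x).roots.card = (slice f x).natDegree := by
        rw [hn]
        exact le_antisymm hle (hcard.symm.le.trans (Multiset.toFinset_card_le _))
      have hnd : (slice f x).roots.Nodup := by
        rw [← Multiset.toFinset_card_eq_card_iff_nodup, hcard, hroots, hn]
      have hv : (fiberConf hS x).1.val = (slice f x).roots := by
        rw [hr, Multiset.toFinset_val, hnd.dedup]
      have hV := Polynomial.coeff_eq_esymm_roots_of_card hroots (k := m - k) (by omega)
      rw [hv, eq_div_iff (mul_ne_zero hc (by simp)), hV, Polynomial.leadingCoeff, hn, ht,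
        Nat.sub_sub_self hk]
      ring
    simp only [key, coeff_slice]
    fun_prop
  · have key : ∀ x, (fiberConf hS x).1.val.esymm k = 0 := by
      intro x
      rw [Multiset.esymm, Multiset.powersetCard_eq_empty]
      · simp
      · have := (fiberConf hS x).2
        rw [Finset.card_val, this]
        omega
    simp only [key]
    exact continuous_const

/-- The braid monodromy `π₁(ℂ - N, u) → B_m[ℂ_u, ℂ_u ∩ S]`: a loop in `ℂ - N` is sent to the motion
of the fibre of `S` over it. -/
def braidMonodromy {m : ℕ} {S : Set (ℂ × ℂ)} (hS : IsGenericCurve m S)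
    (u : Punctured (branchSet m S)) :
    FundamentalGroup (Punctured (branchSet m S)) u →* Braid (fiberConf hS u) :=
  FundamentalGroup.map ⟨fiberConf hS, continuous_fiberConf hS⟩ u

/-- The tuples of braids obtained from all geometric bases by the braid monodromy of `S`. -/
def braidMonodromyFactorizations {m : ℕ} {S : Set (ℂ × ℂ)} (hS : IsGenericCurve m S)
    (c : ℂ) (R : ℝ) (u : Punctured (branchSet m S)) : Set (List (Braid (fiberConf hS u))) :=
  {a | ∃ δ, IsGeometricBase c R u δ ∧ a = δ.map (braidMonodromy hS u)}

end

end BraidMonodromy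

open BraidMonodromy

/-! The braid monodromy `φ` is a homomorphism, so the theorem splits into a statement about `π₁(ℂ -
N, u)` alone, namely that the geometric bases form exactly one Hurwitz class, and two facts about
`φ`: the boundary circle goes to `Δ²`, and loops around branch points go to positive braids. Hurwitz
moves commute with homomorphisms and lift along them (`HurwitzEquiv.lift`), so the image of a full
class is again a full class.

Geometric bases. Homeomorphisms of the plane which are similarities near the punctures (`DiscHomeo`)
carry geometric bases to geometric bases, and any finite set in a disc can be moved to equally
spaced points of the real line with base point `-i` (`nonempty_discHomeo`). There the fundamental
group is free on the loops `ptLoop` (generation by covering the complement with two simply connected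
charts, freeness by the monodromy of an explicit covering), and the ordered product of these loops
is the boundary circle. A loop along a path depends, up to conjugation, only on the end point of the
path. Hence the entries of any geometric base are conjugates of the free generators with the same
product as the standard base, and Artin's theorem `hurwitzEquiv_of_prod_eq` makes the two Hurwitz
equivalent: as long as the product is not visibly reduced, a Hurwitz move shortens the conjugators.
Conversely, the half twist exchanging two neighbouring points induces on the standard base the
inverse of a Hurwitz move. So every tuple equivalent to the standard base is its image under a
homeomorphism (`exists_push_of_hurwitzEquiv`), hence a geometric base.

The boundary circle. Scaling the curve by `s → 0` deforms the fibres over large circles into the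
fibres of the cone of `m` distinct lines given by the leading form, and these rotate rigidly
(`braidMonodromy_circle`).

Positivity. The singularities of the curve and its tangencies to the fibres are arbitrary, so a
branch point may be a multiple zero of the discriminant. Write the curve as a monic polynomial in
`y` and add a small multiple of a polynomial such that the discriminant of the sum has simple zeros
only (`exists_perturbation`). A small perturbation does not change the braid over a fixed circle
around the branch point, up to free homotopy, and the perturbed discriminant still has a zero
inside. That circle is the product of a geometric base for these zeros. Near a simple zero the fibre
is `c ± √Δ` together with fixed simple points, where `Δ` has a simple zero, so the points `c ± √Δ`
make one positive half turn (`exists_isPositive_of_simple`), which is conjugate to a standard half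
twist. -/

namespace BraidMonodromy
open Set Metric
noncomputable section

/-! ### Hurwitz equivalence in groups -/

/-- Hurwitz equivalence of tuples in a group. -/
abbrev HurwitzEquiv {G : Type*} [Group G] (a b : List G) : Prop :=
  Relation.EqvGen HurwitzMove a b

section Hurwitz

variable {G H : Type*} [Group G] [Group H]

lemma HurwitzMove.map (f : G →* H) {a b : List G} (h : HurwitzMove a b) :
    HurwitzMove (a.map f) (b.map f) := by
  obtain ⟨l, r, x, y, rfl, rfl⟩ := h
  exact ⟨l.map f, r.map f, f x, f y, by simp, by simp⟩

lemma HurwitzEquiv.map (f : G →* H) {a b : List G} (h : HurwitzEquiv a b) :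
    HurwitzEquiv (a.map f) (b.map f) := by
  induction h with
  | rel x y h => exact .rel _ _ (h.map f)
  | refl x => exact .refl _
  | symm x y _ ih => exact ih.symm
  | trans x y z _ _ ih1 ih2 => exact ih1.trans _ _ _ ih2

lemma HurwitzMove.prod_eq {a b : List G} (h : HurwitzMove a b) : a.prod = b.prod := by
  obtain ⟨l, r, x, y, rfl, rfl⟩ := h
  simp [mul_assoc]

/-- A Hurwitz move conjugates by an entry of the tuple, so a lift of the tuple also supplies a lift
of the conjugating element. Both directions are carried through the induction because the `symm`
case exchanges them. -/
lemma HurwitzEquiv.exists_map_eq (f : G →* H) {b b' : List H}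
    (h : HurwitzEquiv b b') :
    (∀ a, b = a.map f → ∃ a', b' = a'.map f ∧ HurwitzEquiv a a') ∧
      ∀ a, b' = a.map f → ∃ a', b = a'.map f ∧ HurwitzEquiv a a' := by
  induction h with
  | rel x y h =>
    obtain ⟨l, r, x, y, rfl, rfl⟩ := h
    constructor
    · intro a ha
      obtain ⟨l₁, a₁, rfl, h1, h2⟩ := List.map_eq_append_iff.1 ha.symm
      obtain ⟨p, a₂, rfl, h3, h4⟩ := List.map_eq_cons_iff.1 h2
      obtain ⟨q, a₃, rfl, h5, h6⟩ := List.map_eq_cons_iff.1 h4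
      refine ⟨l₁ ++ q :: (q⁻¹ * p * q) :: a₃, ?_, ?_⟩
      · simp [h1, h3, h5, h6, mul_assoc]
      · exact .rel _ _ ⟨l₁, a₃, q, q⁻¹ * p * q, rfl, by simp [mul_assoc]⟩
    · intro a ha
      obtain ⟨l₁, a₁, rfl, h1, h2⟩ := List.map_eq_append_iff.1 ha.symm
      obtain ⟨p, a₂, rfl, h3, h4⟩ := List.map_eq_cons_iff.1 h2
      obtain ⟨q, a₃, rfl, h5, h6⟩ := List.map_eq_cons_iff.1 h4
      refine ⟨l₁ ++ (p * q * p⁻¹) :: p :: a₃, ?_, ?_⟩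
      · simp [h1, h3, h5, h6]
      · exact .symm _ _ (.rel _ _ ⟨l₁, a₃, p, q, rfl, rfl⟩)
  | refl x => exact ⟨fun a ha => ⟨a, ha, .refl _⟩, fun a ha => ⟨a, ha, .refl _⟩⟩
  | symm x y _ ih => exact ⟨ih.2, ih.1⟩
  | trans x y z _ _ ih1 ih2 =>
    constructor
    · intro a ha
      obtain ⟨a', h1, h2⟩ := ih1.1 a ha
      obtain ⟨a'', h3, h4⟩ := ih2.1 a' h1
      exact ⟨a'', h3, h2.trans _ _ _ h4⟩
    · intro a ha
      obtain ⟨a', h1, h2⟩ := ih2.2 a ha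
      obtain ⟨a'', h3, h4⟩ := ih1.2 a' h1
      exact ⟨a'', h3, h2.trans _ _ _ h4⟩

lemma HurwitzEquiv.lift (f : G →* H) {a : List G} {b : List H}
    (h : HurwitzEquiv (a.map f) b) : ∃ a', b = a'.map f ∧ HurwitzEquiv a a' :=
  (h.exists_map_eq f).1 a rfl

end Hurwitz

/-! ### Factorizations of a positive word into conjugates of generators -/

section Artin

open FreeGroup

variable {α : Type*} [DecidableEq α]

lemma exists_cancellation {A B : List (α × Bool)} (hA : IsReduced A) (hB : IsReduced B) :
    ∃ P S Q, A = P ++ invRev S ∧ B = S ++ Q ∧ IsReduced (P ++ Q) := by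
  induction A using List.reverseRecOn generalizing B with
  | nil => exact ⟨[], [], B, by simp, by simp, by simpa using hB⟩
  | append_singleton A c ih =>
    rcases B with _ | ⟨d, B⟩
    · exact ⟨A ++ [c], [], [], by simp, by simp, by simpa using hA⟩
    by_cases h : c.1 = d.1 → c.2 = d.2
    · refine ⟨A ++ [c], [], d :: B, by simp, by simp, ?_⟩
      rw [FreeGroup.IsReduced, List.isChain_append]
      refine ⟨hA, hB, ?_⟩
      simpa using h
    · push Not at h
      obtain ⟨P, S, Q, rfl, rfl, h3⟩ := ih (List.isChain_append.1 hA).1 (List.IsChain.tail hB)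
      refine ⟨P, d :: S, Q, ?_, by simp, h3⟩
      have : c = (d.1, !d.2) := by
        ext
        · exact h.1
        · have := h.2
          revert this
          cases c.2 <;> cases d.2 <;> simp
      simp [invRev, this]

/-- Locates how far the reduced words cancel in a product; `S` is the part that is lost. -/
lemma exists_toWord_mul (x y : FreeGroup α) :
    ∃ P S Q, toWord x = P ++ invRev S ∧ toWord y = S ++ Q ∧ toWord (x * y) = P ++ Q := by
  obtain ⟨P, S, Q, h1, h2, h3⟩ := exists_cancellation (isReduced_toWord (x := x))
    (isReduced_toWord (x := y))
  refine ⟨P, S, Q, h1, h2, ?_⟩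
  have : x * y = mk (P ++ Q) := by
    rw [← mk_toWord (x := x), ← mk_toWord (x := y), h1, h2, ← mul_mk, ← mul_mk, ← mul_mk,
      ← inv_mk]
    group
  rw [this, toWord_mk, h3.reduce_eq]

/-- The conjugate `w a w⁻¹` of a generator. -/
def conjOf (p : FreeGroup α × α) : FreeGroup α := p.1 * of p.2 * p.1⁻¹

lemma norm_lt_of_toWord_snoc {w : FreeGroup α} {P : List (α × Bool)} {a : α} {b : Bool}
    (h : toWord w = P ++ [(a, b)]) : norm (w * mk [(a, !b)]) < norm w := by
  have : w * mk [(a, !b)] = mk P := by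
    rw [← mk_toWord (x := w), h, ← mul_mk, mul_assoc]
    have : mk [(a, b)] * mk [(a, !b)] = 1 := by
      rw [mul_mk, one_eq_mk]
      exact Quot.sound (by simp)
    rw [this, mul_one]
  rw [this]
  calc norm (mk P) ≤ P.length := norm_mk_le
    _ < norm w := by rw [FreeGroup.norm, h]; simp

/-- The last letter of `w` may be cancelled without changing `w a w⁻¹`. -/
def Shortenable (p : FreeGroup α × α) : Prop := ∃ b P, toWord p.1 = P ++ [(p.2, b)]

lemma Shortenable.exists_shorter {p : FreeGroup α × α} (h : Shortenable p) :
    ∃ q : FreeGroup α × α, conjOf q = conjOf p ∧ norm q.1 < norm p.1 := by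
  obtain ⟨b, P, h⟩ := h
  refine ⟨(p.1 * mk [(p.2, !b)], p.2), ?_, norm_lt_of_toWord_snoc h⟩
  have : Commute (mk [(p.2, !b)]) (of p.2) := by
    rcases b
    · exact Commute.refl _
    · have : mk [(p.2, false)] = (of p.2)⁻¹ := by simp [of, invRev]
      simp only [Bool.not_true, this]
      exact (Commute.refl _).inv_left
  simp only [conjOf, mul_inv_rev]
  rw [mul_assoc p.1, this.eq]
  group

/-- The middle letter of `conjOf p` meets its inverse. If a letter of `p.1⁻¹` survived in front of
that inverse, `p` would be shortenable; so `q.1` starts with the whole word `p.1` followed by the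
inverse letter, and multiplication by `conjOf p` removes that letter. -/
lemma shorten_left {p q : FreeGroup α × α} (hp : ¬ Shortenable p)
    (h : ∃ r, toWord (p.1⁻¹ * q.1) = (p.2, false) :: r) :
    norm (conjOf p * q.1) < norm q.1 := by
  obtain ⟨P, S, Q, h1, h2, h3⟩ := exists_toWord_mul p.1⁻¹ q.1
  obtain ⟨r, hr⟩ := h
  rw [h3] at hr
  have h1' : toWord p.1 = S ++ invRev P := by
    rw [← inv_inv p.1, toWord_inv, h1]
    simp [invRev_append]
  rcases P with _ | ⟨x, P⟩
  · simp only [List.nil_append] at hr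
    subst hr
    have e1 : p.1 = mk S := by rw [← mk_toWord (x := p.1), h1']; simp
    have e2 : q.1 = mk S * (mk [(p.2, false)] * mk r) := by
      rw [← mk_toWord (x := q.1), h2, mul_mk, mul_mk]; rfl
    have e3 : mk [(p.2, false)] = (of p.2)⁻¹ := by simp [of, invRev]
    have : conjOf p * q.1 = mk (S ++ r) := by
      rw [conjOf, e2, e1, e3, ← mul_mk]
      group
    rw [this]
    calc norm (mk (S ++ r)) ≤ (S ++ r).length := norm_mk_le
      _ < norm q.1 := by rw [FreeGroup.norm, h2]; simp
  · exfalso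
    simp only [List.cons_append, List.cons.injEq] at hr
    apply hp
    refine ⟨true, S ++ invRev P, ?_⟩
    rw [h1', hr.1]
    simp [invRev]

/-- Mirror image of `shorten_left`, for the inverse Hurwitz move. -/
lemma shorten_right {p q : FreeGroup α × α} (hq : ¬ Shortenable q)
    (h : ∃ r, toWord (p.1⁻¹ * q.1) = r ++ [(q.2, false)]) :
    norm ((conjOf q)⁻¹ * p.1) < norm p.1 := by
  obtain ⟨P, S, Q, h1, h2, h3⟩ := exists_toWord_mul p.1⁻¹ q.1
  obtain ⟨r, hr⟩ := h
  rw [h3] at hr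
  have h1' : toWord p.1 = S ++ invRev P := by
    rw [← inv_inv p.1, toWord_inv, h1]
    simp [invRev_append]
  rcases List.eq_nil_or_concat Q with rfl | ⟨Q', x, rfl⟩
  · simp only [List.append_nil] at hr
    subst hr
    have e1 : q.1 = mk S := by rw [← mk_toWord (x := q.1), h2]; simp
    have e2 : p.1 = mk S * (of q.2 * mk (invRev r)) := by
      rw [← mk_toWord (x := p.1), h1', of, mul_mk, mul_mk]
      simp [invRev]
    have : (conjOf q)⁻¹ * p.1 = mk (S ++ invRev r) := by
      rw [conjOf, e2, e1, ← mul_mk]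
      group
    rw [this]
    calc norm (mk (S ++ invRev r)) ≤ (S ++ invRev r).length := norm_mk_le
      _ < norm p.1 := by rw [FreeGroup.norm, h1']; simp
  · exfalso
    rw [List.concat_eq_append, ← List.append_assoc] at hr
    obtain ⟨-, hr⟩ := List.append_inj' hr rfl
    apply hq
    refine ⟨false, S ++ Q', ?_⟩
    rw [h2, ← hr]
    simp

/-- The letters following the letter `p.2` in the word of the product of the conjugates. -/
def tailWord : FreeGroup α × α → List (FreeGroup α × α) → List (α × Bool)
  | p, [] => toWord p.1⁻¹
  | p, q :: L => toWord (p.1⁻¹ * q.1) ++ (q.2, true) :: tailWord q L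

lemma mk_tailWord (p : FreeGroup α × α) (L : List (FreeGroup α × α)) :
    mk (tailWord p L) = p.1⁻¹ * (L.map conjOf).prod := by
  induction L generalizing p with
  | nil => simp only [tailWord, mk_toWord]; simp
  | cons q L ih =>
    have : mk ((q.2, true) :: tailWord q L) = of q.2 * mk (tailWord q L) := by
      rw [of, mul_mk]; rfl
    rw [tailWord, ← mul_mk, this, ih, mk_toWord, List.map_cons, List.prod_cons, conjOf]
    group

/-- No cancellation of the letters `p.2` and `q.2` in the product of neighbouring conjugates. -/
def NoCancel (p q : FreeGroup α × α) : Prop :=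
  (¬ ∃ r, toWord (p.1⁻¹ * q.1) = (p.2, false) :: r) ∧
    ¬ ∃ r, toWord (p.1⁻¹ * q.1) = r ++ [(q.2, false)]

lemma isReduced_cons_of {β : Type*} {a : β} {r : List (β × Bool)} (hr : IsReduced r)
    (h : ¬ ∃ s, r = (a, false) :: s) : IsReduced ((a, true) :: r) := by
  rcases r with _ | ⟨⟨b, e⟩, r⟩
  · simp [FreeGroup.IsReduced]
  · rw [FreeGroup.IsReduced, List.isChain_cons_cons]
    refine ⟨?_, hr⟩
    rintro h'
    rcases e
    · exact (h ⟨r, by simpa using h'.symm⟩).elim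
    · rfl

lemma isReduced_snoc_of {β : Type*} {a : β} {r : List (β × Bool)} (hr : IsReduced r)
    (h : ¬ ∃ s, r = s ++ [(a, false)]) : IsReduced (r ++ [(a, true)]) := by
  rw [FreeGroup.IsReduced, List.isChain_append]
  refine ⟨hr, by simp, ?_⟩
  rintro ⟨b, e⟩ hx y hy hb
  simp only [List.head?_cons, Option.mem_def, Option.some.injEq] at hy
  subst hy
  rcases e
  · exfalso
    apply h
    obtain ⟨s, hs⟩ := List.getLast?_eq_some_iff.1 hx
    exact ⟨s, by rw [hs]; simp at hb; rw [hb]⟩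
  · rfl

/-- Only the middle letters could cancel against the reduced words between them: `NoCancel` excludes
this between neighbouring conjugates, and the failure of `Shortenable` excludes it at the end. -/
lemma isReduced_tailWord {p : FreeGroup α × α} {L : List (FreeGroup α × α)}
    (hs : ∀ q ∈ p :: L, ¬ Shortenable q) (hc : List.IsChain NoCancel (p :: L)) :
    IsReduced ((p.2, true) :: tailWord p L) := by
  induction L generalizing p with
  | nil =>
    apply isReduced_cons_of isReduced_toWord
    rintro ⟨s, h⟩
    apply hs p (by simp)
    refine ⟨true, invRev s, ?_⟩
    rw [← inv_inv p.1, toWord_inv, h]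
    simp [invRev]
  | cons q L ih =>
    rw [List.isChain_cons_cons] at hc
    have h1 := ih (fun r hr => hs r (List.mem_cons_of_mem _ hr)) hc.2
    rw [tailWord, ← List.cons_append, FreeGroup.IsReduced, List.isChain_split]
    refine ⟨?_, h1⟩
    rcases hw : toWord (p.1⁻¹ * q.1) with _ | ⟨x, r⟩
    · simp
    · have e1 := isReduced_cons_of isReduced_toWord hc.1.1
      have e2 := isReduced_snoc_of isReduced_toWord hc.1.2
      rw [hw] at e1 e2
      rw [FreeGroup.IsReduced, List.isChain_cons_cons] at e1
      rw [List.cons_append, List.cons_append, List.isChain_cons_cons]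
      exact ⟨e1.1, e2⟩

lemma length_tailWord (p : FreeGroup α × α) (L : List (FreeGroup α × α)) :
    L.length ≤ (tailWord p L).length := by
  induction L generalizing p with
  | nil => simp
  | cons q L ih =>
    have := ih q
    simp only [tailWord, List.length_append, List.length_cons]
    omega

/-- The middle letters alone account for the length, so all connecting words `p.1⁻¹ * q.1` are empty
and every conjugator equals the first one. -/
lemma eq_one_of_length_tailWord {p : FreeGroup α × α} {L : List (FreeGroup α × α)}
    (hp : p.1 = 1) (h : (tailWord p L).length = L.length) : ∀ q ∈ L, q.1 = 1 := by
  induction L generalizing p with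
  | nil => simp
  | cons q L ih =>
    have h2 := length_tailWord q L
    simp only [tailWord, List.length_append, List.length_cons] at h
    have h3 : toWord (p.1⁻¹ * q.1) = [] := List.eq_nil_of_length_eq_zero (by omega)
    rw [toWord_eq_nil_iff, hp, inv_one, one_mul] at h3
    have := ih h3 (by omega)
    simpa [h3] using this

lemma toWord_prod_map_of (l : List α) :
    toWord (l.map of).prod = l.map fun a => (a, true) := by
  have hm : (l.map of).prod = mk (l.map fun a => (a, true)) := by
    induction l with
    | nil => rfl
    | cons a l ih => rw [List.map_cons, List.prod_cons, ih, of, mul_mk]; rfl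
  have hred : IsReduced (l.map fun a => (a, true)) := by
    rw [FreeGroup.IsReduced, List.isChain_map]
    exact List.Pairwise.isChain (List.pairwise_of_forall (by simp))
  rw [hm, toWord_mk, hred.reduce_eq]

lemma eq_of_prod_map_of_eq {l l' : List α} (h : (l.map of).prod = (l'.map of).prod) : l = l' := by
  have := congrArg toWord h
  rw [toWord_prod_map_of, toWord_prod_map_of] at this
  exact List.map_injective_iff.2 (fun a b h => by simpa using h) this

/-- Induction step of Artin's argument: if no Hurwitz move shortens the conjugators, then all
conjugators are trivial. -/
lemma map_conjOf_eq {L : List (FreeGroup α × α)} {l : List α} (hl : l.length = L.length)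
    (hprod : (L.map conjOf).prod = (l.map of).prod)
    (hs : ∀ q ∈ L, ¬ Shortenable q) (hc : List.IsChain NoCancel L) :
    L.map conjOf = l.map of := by
  rcases L with _ | ⟨p, L⟩
  · simp at hl; simp [hl]
  have h1 : IsReduced (toWord p.1 ++ (p.2, true) :: tailWord p L) := by
    rw [FreeGroup.IsReduced, List.isChain_split]
    refine ⟨isReduced_snoc_of isReduced_toWord ?_, isReduced_tailWord hs hc⟩
    rintro ⟨s, h⟩
    exact hs p (by simp) ⟨false, s, h⟩
  have h2 : mk (toWord p.1 ++ (p.2, true) :: tailWord p L) = (l.map of).prod := by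
    have : mk ((p.2, true) :: tailWord p L) = of p.2 * mk (tailWord p L) := by
      rw [of, mul_mk]; rfl
    rw [← hprod, ← mul_mk, this, mk_tailWord, mk_toWord, List.map_cons, List.prod_cons,
      conjOf]
    group
  have h3 := congrArg toWord h2
  rw [toWord_mk, h1.reduce_eq, toWord_prod_map_of] at h3
  -- Both words are reduced, hence equal; the right one has one letter for each conjugate, which
  -- leaves no room for conjugators.
  have h4 := congrArg List.length h3
  have h5 := length_tailWord p L
  simp only [List.length_append, List.length_cons, List.length_map] at h4 hl
  have h6 : p.1 = 1 := by
    rw [← toWord_eq_nil_iff]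
    exact List.eq_nil_of_length_eq_zero (by omega)
  have h7 := eq_one_of_length_tailWord (L := L) h6 (by omega)
  have h8 : (p :: L).map conjOf = ((p :: L).map Prod.snd).map of := by
    rw [List.map_map]
    refine List.map_congr_left fun q hq => ?_
    rcases List.mem_cons.1 hq with rfl | hq
    · simp [conjOf, h6]
    · simp [conjOf, h7 q hq]
  rw [h8] at hprod ⊢
  rw [eq_of_prod_map_of_eq hprod]

/-- **Artin's theorem.** A factorization of a positive word of length `n` in a free group into `n`
conjugates of generators is Hurwitz equivalent to the factorization into letters. -/
theorem hurwitzEquiv_of_prod_eq {L : List (FreeGroup α × α)} {l : List α}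
    (hl : l.length = L.length) (hprod : (L.map conjOf).prod = (l.map of).prod) :
    HurwitzEquiv (L.map conjOf) (l.map of) := by
  -- Induction on the total length of the conjugators.
  induction hn : (L.map fun p => FreeGroup.norm p.1).sum using Nat.strong_induction_on generalizing L with
  | _ n ih =>
  subst hn
  by_cases hs : ∀ q ∈ L, ¬ Shortenable q
  swap
  · push Not at hs
    obtain ⟨q, hq, hs⟩ := hs
    obtain ⟨s, t, rfl⟩ := List.append_of_mem hq
    obtain ⟨q', h1, h2⟩ := hs.exists_shorter
    have e : (s ++ q :: t).map conjOf = (s ++ q' :: t).map conjOf := by simp [h1]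
    rw [e] at hprod ⊢
    exact ih _ (by simp; omega) (by simpa using hl) hprod rfl
  by_cases hc : List.IsChain NoCancel L
  · rw [map_conjOf_eq hl hprod hs hc]
    exact .refl _
  · rw [List.isChain_iff_forall_rel_of_append_cons_cons] at hc
    push Not at hc
    obtain ⟨p, q, s, t, rfl, hc⟩ := hc
    rw [NoCancel, not_and_or, not_not, not_not] at hc
    -- In the first case the Hurwitz move turns the conjugator `q.1` into the shorter `conjOf p *
    -- q.1`; in the second the inverse move turns `p.1` into the shorter `(conjOf q)⁻¹ * p.1`.
    rcases hc with hc | hc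
    · have h1 := shorten_left (hs p (by simp)) hc
      have hm : HurwitzMove ((s ++ (conjOf p * q.1, q.2) :: p :: t).map conjOf)
          ((s ++ p :: q :: t).map conjOf) := by
        refine ⟨s.map conjOf, t.map conjOf, conjOf p, conjOf q, by simp, ?_⟩
        simp only [List.map_append, List.map_cons]
        congr 2
        simp only [conjOf]
        group
      refine (Relation.EqvGen.symm _ _ (.rel _ _ hm)).trans _ _ _ (ih _ ?_ ?_ ?_ rfl)
      · simp; omega
      · simpa using hl
      · rw [hm.prod_eq, hprod]
    · have h1 := shorten_right (hs q (by simp)) hc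
      have hm : HurwitzMove ((s ++ p :: q :: t).map conjOf)
          ((s ++ q :: ((conjOf q)⁻¹ * p.1, p.2) :: t).map conjOf) := by
        refine ⟨s.map conjOf, t.map conjOf, conjOf q, conjOf ((conjOf q)⁻¹ * p.1, p.2),
          by simp, ?_⟩
        simp only [List.map_append, List.map_cons]
        congr 2
        simp only [conjOf]
        group
      refine (Relation.EqvGen.rel _ _ hm).trans _ _ _ (ih _ ?_ ?_ ?_ rfl)
      · simp; omega
      · simpa using hl
      · rw [← hm.prod_eq, hprod]

end Artin

/-! ### Transport of loops along paths -/

section Transport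

open scoped unitInterval

variable {X Y : Type*} [TopologicalSpace X] [TopologicalSpace Y]

/-- Homotopy classes of paths. -/
local notation "Cls" => Path.Homotopic.Quotient

/-- The loop class that follows `q`, then `w`, and returns along `q`. -/
def lasso {x y : X} (q : Cls x y) (w : FundamentalGroup X y) : FundamentalGroup X x :=
  FundamentalGroup.fromPath ((q.trans (FundamentalGroup.toPath w)).trans q.symm)

lemma lasso_mk {x y : X} (q : Path x y) (w : Path y y) :
    lasso (.mk q) (FundamentalGroup.fromPath (.mk w)) =
      FundamentalGroup.fromPath (.mk ((q.trans w).trans q.symm)) := rfl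

lemma trans_left_cancel {x y z : X} (p : Cls x y) {q r : Cls y z}
    (h : p.trans q = p.trans r) : q = r := by
  have := congrArg p.symm.trans h
  simpa only [← Path.Homotopic.Quotient.trans_assoc, Path.Homotopic.Quotient.symm_trans,
    Path.Homotopic.Quotient.refl_trans] using this

lemma trans_right_cancel {x y z : X} {p q : Cls x y} (r : Cls y z)
    (h : p.trans r = q.trans r) : p = q := by
  have := congrArg (fun s : Cls x z => s.trans r.symm) h
  simpa only [Path.Homotopic.Quotient.trans_assoc, Path.Homotopic.Quotient.trans_symm,
    Path.Homotopic.Quotient.trans_refl] using this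

lemma cls_symm_trans_cancel {x y z : X} (p : Cls x y) (q : Cls y z) :
    p.symm.trans (p.trans q) = q := by
  rw [← Path.Homotopic.Quotient.trans_assoc, Path.Homotopic.Quotient.symm_trans,
    Path.Homotopic.Quotient.refl_trans]

lemma cls_trans_symm_cancel {x y z : X} (p : Cls x y) (q : Cls x z) :
    p.trans (p.symm.trans q) = q := by
  rw [← Path.Homotopic.Quotient.trans_assoc, Path.Homotopic.Quotient.trans_symm,
    Path.Homotopic.Quotient.refl_trans]

lemma cls_symm_trans_rev {x y z : X} (p : Cls x y) (q : Cls y z) :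
    (p.trans q).symm = q.symm.trans p.symm := by
  apply trans_left_cancel (p.trans q)
  rw [Path.Homotopic.Quotient.trans_symm, Path.Homotopic.Quotient.trans_assoc,
    cls_trans_symm_cancel, Path.Homotopic.Quotient.trans_symm]

lemma lasso_mul {x y : X} (q : Cls x y) (a b : FundamentalGroup X y) :
    lasso q (a * b) = lasso q a * lasso q b := by
  simp only [lasso, FundamentalGroup.mul_def, Path.Homotopic.Quotient.trans_assoc,
    cls_symm_trans_cancel]

lemma lasso_one {x y : X} (q : Cls x y) : lasso q (1 : FundamentalGroup X y) = 1 := by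
  simp only [lasso, FundamentalGroup.one_def, Path.Homotopic.Quotient.trans_refl,
    Path.Homotopic.Quotient.trans_symm]

lemma lasso_trans {x y z : X} (q : Cls x y) (r : Cls y z) (w : FundamentalGroup X z) :
    lasso (q.trans r) w = lasso q (lasso r w) := by
  simp only [lasso, cls_symm_trans_rev, Path.Homotopic.Quotient.trans_assoc]

lemma lasso_refl {x : X} (w : FundamentalGroup X x) : lasso (.refl x) w = w := by
  apply trans_right_cancel (.refl x)
  simp only [lasso, Path.Homotopic.Quotient.refl_trans, Path.Homotopic.Quotient.trans_assoc,
    Path.Homotopic.Quotient.symm_trans]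

lemma lasso_symm_lasso {x y : X} (q : Cls x y) (w : FundamentalGroup X y) :
    lasso q.symm (lasso q w) = w := by
  rw [← lasso_trans, Path.Homotopic.Quotient.symm_trans, lasso_refl]

lemma lasso_lasso_symm {x y : X} (q : Cls x y) (w : FundamentalGroup X x) :
    lasso q (lasso q.symm w) = w := by
  rw [← lasso_trans, Path.Homotopic.Quotient.trans_symm, lasso_refl]

/-- Transport along a path as an isomorphism of fundamental groups. -/
def lassoEquiv {x y : X} (q : Cls x y) : FundamentalGroup X y ≃* FundamentalGroup X x where
  toFun := lasso q
  invFun := lasso q.symm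
  left_inv := lasso_symm_lasso q
  right_inv := lasso_lasso_symm q
  map_mul' := lasso_mul q

/-- Products in `FundamentalGroup` run from right to left: `a * b` traverses `b` first. Hence the
inverse stands on the left. -/
lemma lasso_loop {x : X} (q w : FundamentalGroup X x) : lasso q w = q⁻¹ * w * q := by
  simp only [lasso, FundamentalGroup.mul_def, FundamentalGroup.inv_def,
    Path.Homotopic.Quotient.trans_assoc]

lemma lasso_eq_of_commute {x y : X} {r : Cls x y} {w : FundamentalGroup X x}
    {w' : FundamentalGroup X y}
    (h : Path.Homotopic.Quotient.trans (FundamentalGroup.toPath w) r =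
      r.trans (FundamentalGroup.toPath w')) : lasso r w' = w := by
  apply trans_right_cancel r
  rw [h, lasso]
  simp only [Path.Homotopic.Quotient.trans_assoc, Path.Homotopic.Quotient.symm_trans,
    Path.Homotopic.Quotient.trans_refl]

lemma isConj_lasso {x y : X} (q q' : Cls x y) (w : FundamentalGroup X y) :
    ∃ g : FundamentalGroup X x, lasso q w = g * lasso q' w * g⁻¹ := by
  refine ⟨(FundamentalGroup.fromPath (q.trans q'.symm))⁻¹, ?_⟩
  have := lasso_loop (FundamentalGroup.fromPath (q.trans q'.symm)) (lasso q' w)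
  rw [inv_inv, ← this, ← lasso_trans, Path.Homotopic.Quotient.trans_assoc,
    Path.Homotopic.Quotient.symm_trans, Path.Homotopic.Quotient.trans_refl]

lemma map_lasso (f : C(X, Y)) {x y : X} (q : Cls x y) (w : FundamentalGroup X y) :
    FundamentalGroup.map f x (lasso q w) = lasso (q.map f) (FundamentalGroup.map f y w) := by
  induction q using Path.Homotopic.Quotient.ind with | mk q =>
  induction w using Path.Homotopic.Quotient.ind with | mk w =>
  change FundamentalGroup.map f x (FundamentalGroup.fromPath (.mk ((q.trans w).trans q.symm))) = _
  change Path.Homotopic.Quotient.mk (((q.trans w).trans q.symm).map f.continuous) =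
    Path.Homotopic.Quotient.mk (((q.map f.continuous).trans (w.map f.continuous)).trans
      (q.map f.continuous).symm)
  rw [Path.map_trans, Path.map_trans, Path.map_symm]

/-- The two ways around a square are homotopic. -/
lemma square_homotopic {H : I × I → X} (hH : Continuous H) {a b c d : X} {p : Path a b}
    {q : Path b d} {r : Path a c} {s : Path c d} (hp : ∀ t, p t = H (t, 0))
    (hq : ∀ t, q t = H (1, t)) (hr : ∀ t, r t = H (0, t)) (hs : ∀ t, s t = H (t, 1)) :
    Path.Homotopic.Quotient.mk (p.trans q) = .mk (r.trans s) := by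
  have ha : a = H (0, 0) := by rw [← hp, p.source]
  have hb : b = H (1, 0) := by rw [← hp, p.target]
  have hc : c = H (0, 1) := by rw [← hr, r.target]
  have hd : d = H (1, 1) := by rw [← hs, s.target]
  subst ha hb hc hd
  let P : Path ((0, 0) : I × I) (1, 0) := ⟨⟨fun t => (t, 0), by fun_prop⟩, rfl, rfl⟩
  let Q : Path ((1, 0) : I × I) (1, 1) := ⟨⟨fun t => (1, t), by fun_prop⟩, rfl, rfl⟩
  let R : Path ((0, 0) : I × I) (0, 1) := ⟨⟨fun t => (0, t), by fun_prop⟩, rfl, rfl⟩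
  let S : Path ((0, 1) : I × I) (1, 1) := ⟨⟨fun t => (t, 1), by fun_prop⟩, rfl, rfl⟩
  have hI : ContractibleSpace I := (convex_Icc (0 : ℝ) 1).contractibleSpace ⟨0, by simp⟩
  have : SimplyConnectedSpace (I × I) := inferInstance
  have h : (P.trans Q).Homotopic (R.trans S) := SimplyConnectedSpace.paths_homotopic _ _
  have e1 : p = P.map hH := by ext t; exact hp t
  have e2 : q = Q.map hH := by ext t; exact hq t
  have e3 : r = R.map hH := by ext t; exact hr t
  have e4 : s = S.map hH := by ext t; exact hs t
  rw [e1, e2, e3, e4, ← Path.map_trans, ← Path.map_trans]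
  exact Quotient.sound (h.map ⟨H, hH⟩)

/-- A free homotopy of loops. -/
lemma lasso_of_square {H : I × I → X} (hH : Continuous H) {a b : X} {w : Path a a}
    {w' : Path b b} {r : Path a b} (hw : ∀ t, w t = H (t, 0)) (hr : ∀ t, r t = H (0, t))
    (hr' : ∀ t, r t = H (1, t)) (hw' : ∀ t, w' t = H (t, 1)) :
    lasso (.mk r) (FundamentalGroup.fromPath (.mk w')) = FundamentalGroup.fromPath (.mk w) :=
  lasso_eq_of_commute (square_homotopic hH hw hr' hr hw')

end Transport

/-! ### Simply connected regions -/

section Regions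

open scoped unitInterval

lemma mk_eq_of_mem_region {N E : Set ℂ} (hE : IsSimplyConnected E) (hEN : ∀ z ∈ E, z ∉ N)
    {x y : Punctured N} {p q : Path x y} (hp : ∀ t, (p t : ℂ) ∈ E) (hq : ∀ t, (q t : ℂ) ∈ E) :
    Path.Homotopic.Quotient.mk p = .mk q := by
  have := hE.simplyConnectedSpace
  let f : C(E, Punctured N) := ⟨fun z => ⟨z, hEN z z.2⟩, by fun_prop⟩
  have hx : (x : ℂ) ∈ E := by simpa using hp 0
  have hy : (y : ℂ) ∈ E := by simpa using hp 1
  let P : Path (⟨x, hx⟩ : E) ⟨y, hy⟩ :=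
    ⟨⟨fun t => ⟨p t, hp t⟩, by fun_prop⟩, by simp, by simp⟩
  let Q : Path (⟨x, hx⟩ : E) ⟨y, hy⟩ :=
    ⟨⟨fun t => ⟨q t, hq t⟩, by fun_prop⟩, by simp, by simp⟩
  have h : P.Homotopic Q := SimplyConnectedSpace.paths_homotopic _ _
  exact Quotient.sound (h.map f)

lemma exists_path_of_isPathConnected {N E : Set ℂ} (hE : IsPathConnected E)
    (hEN : ∀ z ∈ E, z ∉ N) {x y : Punctured N} (hx : (x : ℂ) ∈ E) (hy : (y : ℂ) ∈ E) :
    ∃ p : Path x y, ∀ t, (p t : ℂ) ∈ E := by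
  have h := hE.joinedIn x hx y hy
  exact ⟨⟨⟨fun t => ⟨h.somePath t, hEN _ (h.somePath_mem t)⟩, by fun_prop⟩, by simp, by simp⟩,
    h.somePath_mem⟩

lemma isSimplyConnected_of_convex {E : Set ℂ} (hE : Convex ℝ E) (hne : E.Nonempty) :
    IsSimplyConnected E := by
  have := hE.contractibleSpace hne
  exact SimplyConnectedSpace.ofContractible E

/-- A set which is closed under translations in direction `-d`, and which contains a convex set into
which every bounded set can be pushed by such a translation, is simply connected. -/
lemma isSimplyConnected_of_push {E H : Set ℂ} (d : ℂ)
    (hE : ∀ z ∈ E, ∀ t : ℝ, 0 ≤ t → z - t * d ∈ E) (hH : Convex ℝ H) (hHE : H ⊆ E)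
    (hpush : ∀ r : ℝ, ∃ t : ℝ, 0 ≤ t ∧ ∀ z : ℂ, ‖z‖ ≤ r → z - t * d ∈ H) :
    IsSimplyConnected E := by
  have hI : ∀ t : I, (0 : ℝ) ≤ t := fun t => t.2.1
  have hne : H.Nonempty := by
    obtain ⟨t, -, h⟩ := hpush 0
    exact ⟨_, h 0 (by simp)⟩
  have hHs := isSimplyConnected_of_convex hH hne
  have := hHs.simplyConnectedSpace
  let f : C(H, E) := ⟨fun z => ⟨z, hHE z.2⟩, by fun_prop⟩
  let dn : ∀ (x : E) (K : ℝ) (hK : 0 ≤ K), Path x ⟨x - K * d, hE x x.2 K hK⟩ := fun x K hK =>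
    ⟨⟨fun t => ⟨x - (t * K : ℝ) * d, hE x x.2 _ (mul_nonneg (hI t) hK)⟩, by fun_prop⟩,
      by simp, by simp⟩
  refine (simply_connected_iff_paths_homotopic' (Y := E)).2 ⟨?_, ?_⟩
  · obtain ⟨z, hz⟩ := hne
    refine ⟨⟨⟨z, hHE hz⟩⟩, fun x y => ?_⟩
    obtain ⟨K, hK, h⟩ := hpush (max ‖(x : ℂ)‖ ‖(y : ℂ)‖)
    have j : Joined (f ⟨_, h x (le_max_left _ _)⟩) (f ⟨_, h y (le_max_right _ _)⟩) :=
      ⟨(PathConnectedSpace.somePath _ _).map f.continuous⟩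
    exact (Joined.trans ⟨dn x K hK⟩ j).trans (Joined.symm ⟨dn y K hK⟩)
  · intro x y p q
    have hb : ∃ r : ℝ, (∀ t, ‖(p t : ℂ)‖ ≤ r) ∧ ∀ t, ‖(q t : ℂ)‖ ≤ r := by
      have c1 : Continuous fun t => (p t : ℂ) := by fun_prop
      have c2 : Continuous fun t => (q t : ℂ) := by fun_prop
      obtain ⟨r1, h1⟩ := (isCompact_range c1).isBounded.exists_norm_le
      obtain ⟨r2, h2⟩ := (isCompact_range c2).isBounded.exists_norm_le
      exact ⟨max r1 r2, fun t => (h1 _ ⟨t, rfl⟩).trans (le_max_left _ _),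
        fun t => (h2 _ ⟨t, rfl⟩).trans (le_max_right _ _)⟩
    obtain ⟨r, hpr, hqr⟩ := hb
    obtain ⟨K, hK, h⟩ := hpush r
    have hx : ‖(x : ℂ)‖ ≤ r := by simpa using hpr 0
    have hy : ‖(y : ℂ)‖ ≤ r := by simpa using hpr 1
    -- Translation by `-K * d` sweeps out a square between `p` and a path in the convex set `H`; the
    -- other two sides are the translation paths of `x` and `y`, the same for all `p`.
    have key : ∀ p : Path x y, ∀ hpr : ∀ t, ‖(p t : ℂ)‖ ≤ r, ∃ P : Path (⟨_, h x hx⟩ : H)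
        ⟨_, h y hy⟩, Path.Homotopic.Quotient.mk (p.trans (dn y K hK)) =
          .mk ((dn x K hK).trans (P.map f.continuous)) := by
      intro p hpr
      refine ⟨⟨⟨fun t => ⟨_, h (p t) (hpr t)⟩, by fun_prop⟩, by simp, by simp⟩, ?_⟩
      refine square_homotopic (H := fun z : I × I =>
        ⟨p z.1 - (z.2 * K : ℝ) * d, hE _ (p z.1).2 _ (mul_nonneg (hI _) hK)⟩) (by fun_prop)
        ?_ ?_ ?_ ?_
      · intro t; simp
      · intro t; simp [dn]
      · intro t; simp [dn]
      · intro t; simp [f]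
    obtain ⟨P, h1⟩ := key p hpr
    obtain ⟨Q, h2⟩ := key q hqr
    have h3 : Path.Homotopic.Quotient.mk (P.map f.continuous) = .mk (Q.map f.continuous) :=
      Quotient.sound ((SimplyConnectedSpace.paths_homotopic P Q).map f)
    have h4 : (Path.Homotopic.Quotient.mk p).trans (.mk (dn y K hK)) =
        (Path.Homotopic.Quotient.mk q).trans (.mk (dn y K hK)) := by
      rw [← Path.Homotopic.Quotient.mk_trans, ← Path.Homotopic.Quotient.mk_trans, h1, h2,
        Path.Homotopic.Quotient.mk_trans, Path.Homotopic.Quotient.mk_trans, h3]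
    exact Path.Homotopic.Quotient.exact (trans_right_cancel _ h4)

end Regions

/-! ### Loops around punctures -/

section Circles

open scoped unitInterval

variable {N : Set ℂ}

/-- The circle with centre `c` through `v`, as a loop. -/
def circlePath (c : ℂ) (v : Punctured N) (h : ∀ t : ℝ, c + turn t * ((v : ℂ) - c) ∉ N) :
    Path v v where
  toFun t := ⟨c + turn t * ((v : ℂ) - c), h t⟩
  continuous_toFun := by fun_prop
  source' := by ext; simp [turn_zero]
  target' := by ext; simp [turn_one]

lemma isCircle_circlePath (c : ℂ) (v : Punctured N)
    (h : ∀ t : ℝ, c + turn t * ((v : ℂ) - c) ∉ N) : IsCircle c (circlePath c v h) :=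
  fun _ => rfl

lemma dist_rotate (a z : ℂ) (t : ℝ) : dist (a + turn t * (z - a)) a = dist z a := by
  rw [dist_eq_norm, dist_eq_norm, add_sub_cancel_left, norm_mul, norm_turn, one_mul]

lemma rotate_notMem {a : ℂ} {ε : ℝ} (hε : ball a ε ∩ N ⊆ {a}) {z : ℂ} (hz : z ∈ ball a ε)
    (hzN : z ∉ N) (t : ℝ) : a + turn t * (z - a) ∉ N := by
  intro h
  have h1 : a + turn t * (z - a) ∈ ball a ε := by rwa [mem_ball, dist_rotate]
  have h2 : a + turn t * (z - a) = a := hε ⟨h1, h⟩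
  have h3 : z = a := by
    have : turn t * (z - a) = 0 := by simpa using h2
    rcases mul_eq_zero.1 this with h | h
    · exact absurd h (turn_ne_zero t)
    · exact sub_eq_zero.1 h
  rw [h2, ← h3] at h
  exact hzN h

/-- Circles about a puncture are carried to one another along paths near the puncture. -/
lemma lasso_circle {a : ℂ} {ε : ℝ} (hε : ball a ε ∩ N ⊆ {a}) {v v' : Punctured N}
    {w : Path v v} {w' : Path v' v'} (hw : IsCircle a w) (hw' : IsCircle a w') {r : Path v v'}
    (hr : ∀ t, (r t : ℂ) ∈ ball a ε) :
    lasso (.mk r) (FundamentalGroup.fromPath (.mk w')) = FundamentalGroup.fromPath (.mk w) := by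
  refine lasso_of_square (H := fun z : I × I => ⟨a + turn z.1 * ((r z.2 : ℂ) - a),
    rotate_notMem hε (hr _) (r z.2).2 _⟩) (by fun_prop) ?_ ?_ ?_ ?_
  · intro t; ext; simp [hw t]
  · intro t; ext; simp [turn_zero]
  · intro t; ext; simp [turn_one]
  · intro t; ext; simp [hw' t]

end Circles

/-! ### The fundamental group of the complement of points on the real line -/

section RealPoints

open scoped unitInterval Topology

variable {n : ℕ} (p : Fin n → ℝ)

/-- The points `p k` of the real line, as a subset of the complex line. -/
def realPts : Set ℂ := range fun k => (p k : ℂ)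

/-- The complement of the closed vertical rays going up (`true`) or down (`false`) from the
points `p k`. -/
def chart : Bool → Set ℂ
  | true => {z | ∀ k, z.re = p k → z.im < 0}
  | false => {z | ∀ k, z.re = p k → 0 < z.im}

variable {p}

lemma notMem_of_mem_chart {b : Bool} {z : ℂ} (hz : z ∈ chart p b) : z ∉ realPts p := by
  rintro ⟨k, rfl⟩
  cases b <;> simpa using hz k rfl

lemma mem_chart_or (z : Punctured (realPts p)) : ∃ b, (z : ℂ) ∈ chart p b := by
  rcases lt_trichotomy (z : ℂ).im 0 with h | h | h
  · exact ⟨true, fun _ _ => h⟩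
  · refine ⟨true, fun k hk => (z.2 ⟨k, ?_⟩).elim⟩
    apply Complex.ext <;> simp [hk, h]
  · exact ⟨false, fun _ _ => h⟩

lemma mem_chart_true_of_im_nonpos {z : ℂ} (hz : z ∉ realPts p) (h : z.im ≤ 0) :
    z ∈ chart p true := by
  intro k hk
  refine lt_of_le_of_ne h fun h0 => hz ⟨k, ?_⟩
  apply Complex.ext <;> simp [hk, h0]

lemma mem_chart_false_of_im_nonneg {z : ℂ} (hz : z ∉ realPts p) (h : 0 ≤ z.im) :
    z ∈ chart p false := by
  intro k hk
  refine lt_of_le_of_ne h fun h0 => hz ⟨k, ?_⟩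
  apply Complex.ext <;> simp [hk, ← h0]

/-- Vertical translation away from the removed rays pushes every bounded set into an open half
plane. -/
lemma isSimplyConnected_chart (b : Bool) : IsSimplyConnected (chart p b) := by
  cases b
  · refine isSimplyConnected_of_push (H := {z | 0 < z.im}) (-Complex.I) ?_
      (convex_halfSpace_im_gt 0) (fun z hz _ _ => hz) ?_
    · intro z hz t ht k hk
      have := hz k (by simpa using hk)
      simp
      linarith
    · intro r
      refine ⟨|r| + 1, by positivity, fun z hz => ?_⟩
      have := (abs_le.1 (Complex.abs_im_le_norm z)).1
      simp
      linarith [le_abs_self r]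
  · refine isSimplyConnected_of_push (H := {z | z.im < 0}) Complex.I ?_
      (convex_halfSpace_im_lt 0) (fun z hz _ _ => hz) ?_
    · intro z hz t ht k hk
      have := hz k (by simpa using hk)
      simp
      linarith
    · intro r
      refine ⟨|r| + 1, by positivity, fun z hz => ?_⟩
      have := (abs_le.1 (Complex.abs_im_le_norm z)).2
      simp
      linarith [le_abs_self r]

lemma isOpen_chart (b : Bool) : IsOpen (chart p b) := by
  cases b
  · have : chart p false = ⋂ k, ({z : ℂ | z.re ≠ p k} ∪ {z | 0 < z.im}) := by
      ext z; simp [chart, imp_iff_not_or]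
    rw [this]
    exact isOpen_iInter_of_finite fun k =>
      (isOpen_ne_fun Complex.continuous_re continuous_const).union
        (isOpen_lt continuous_const Complex.continuous_im)
  · have : chart p true = ⋂ k, ({z : ℂ | z.re ≠ p k} ∪ {z | z.im < 0}) := by
      ext z; simp [chart, imp_iff_not_or]
    rw [this]
    exact isOpen_iInter_of_finite fun k =>
      (isOpen_ne_fun Complex.continuous_re continuous_const).union
        (isOpen_lt Complex.continuous_im continuous_const)

/-- The class of the paths from `x` to `y` inside a chart. -/
def chartCls (b : Bool) {x y : Punctured (realPts p)} (hx : (x : ℂ) ∈ chart p b)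
    (hy : (y : ℂ) ∈ chart p b) : Path.Homotopic.Quotient x y :=
  .mk (exists_path_of_isPathConnected (isSimplyConnected_chart b).isPathConnected
    (fun _ => notMem_of_mem_chart) hx hy).choose

lemma mk_eq_chartCls {b : Bool} {x y : Punctured (realPts p)} {γ : Path x y}
    (h : ∀ t, (γ t : ℂ) ∈ chart p b) (hx : (x : ℂ) ∈ chart p b) (hy : (y : ℂ) ∈ chart p b) :
    Path.Homotopic.Quotient.mk γ = chartCls b hx hy :=
  mk_eq_of_mem_region (isSimplyConnected_chart b) (fun _ => notMem_of_mem_chart) h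
    (exists_path_of_isPathConnected (isSimplyConnected_chart b).isPathConnected
      (fun _ => notMem_of_mem_chart) hx hy).choose_spec

lemma exists_chartCls_eq (b : Bool) {x y : Punctured (realPts p)} (hx : (x : ℂ) ∈ chart p b)
    (hy : (y : ℂ) ∈ chart p b) :
    ∃ γ : Path x y, chartCls b hx hy = .mk γ ∧ ∀ t, (γ t : ℂ) ∈ chart p b :=
  ⟨_, rfl, (exists_path_of_isPathConnected (isSimplyConnected_chart b).isPathConnected
      (fun _ => notMem_of_mem_chart) hx hy).choose_spec⟩

lemma chartCls_trans {b : Bool} {x y z : Punctured (realPts p)} (hx : (x : ℂ) ∈ chart p b)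
    (hy : (y : ℂ) ∈ chart p b) (hz : (z : ℂ) ∈ chart p b) :
    (chartCls b hx hy).trans (chartCls b hy hz) = chartCls b hx hz := by
  obtain ⟨γ, h1, h2⟩ := exists_chartCls_eq b hx hy
  obtain ⟨γ', h3, h4⟩ := exists_chartCls_eq b hy hz
  rw [h1, h3, ← Path.Homotopic.Quotient.mk_trans]
  refine mk_eq_chartCls (fun t => ?_) hx hz
  rw [Path.trans_apply]
  split_ifs
  exacts [h2 _, h4 _]

lemma chartCls_self {b : Bool} {x : Punctured (realPts p)} (hx : (x : ℂ) ∈ chart p b) :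
    chartCls b hx hx = .refl x := by
  rw [← mk_eq_chartCls (γ := Path.refl x) (fun t => hx) hx hx]
  rfl

lemma chartCls_symm {b : Bool} {x y : Punctured (realPts p)} (hx : (x : ℂ) ∈ chart p b)
    (hy : (y : ℂ) ∈ chart p b) : (chartCls b hx hy).symm = chartCls b hy hx := by
  apply trans_left_cancel (chartCls b hx hy)
  rw [Path.Homotopic.Quotient.trans_symm, chartCls_trans, chartCls_self]

/-- The number of points `p k` to the left of `z`. -/
def stripIdx (p : Fin n → ℝ) (z : ℂ) : ℕ := (Finset.univ.filter fun k => p k < z.re).card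

/-- No point `p k` lies between the real parts, so the vertical strip they span is convex and
contained in both charts; a path in it represents both classes. -/
lemma chartCls_eq_of_strip {x y : Punctured (realPts p)} (hx : ∀ b, (x : ℂ) ∈ chart p b)
    (hy : ∀ b, (y : ℂ) ∈ chart p b) (h : ∀ k, p k < (x : ℂ).re ↔ p k < (y : ℂ).re) :
    chartCls true (hx _) (hy _) = chartCls false (hx _) (hy _) := by
  have hne : ∀ z : ℂ, (∀ b, z ∈ chart p b) → ∀ k, z.re ≠ p k := fun z hz k hk =>
    lt_asymm (hz true k hk) (hz false k hk)
  let E : Set ℂ := Complex.reLm ⁻¹' segment ℝ (x : ℂ).re (y : ℂ).re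
  have hE : Convex ℝ E := (convex_segment _ _).linear_preimage Complex.reLm
  have hEb : ∀ b, ∀ z ∈ E, z ∈ chart p b := by
    intro b z hz
    have : ∀ k, z.re ≠ p k := by
      intro k hk
      have hz' : z.re ∈ segment ℝ (x : ℂ).re (y : ℂ).re := hz
      rw [segment_eq_uIcc, mem_uIcc, hk] at hz'
      have h1 := hne x hx k
      have h2 := hne y hy k
      have h3 := h k
      rcases hz' with ⟨h4, h5⟩ | ⟨h4, h5⟩
      · exact absurd (h3.2 (lt_of_le_of_ne h5 h2.symm)) (not_lt.2 h4)
      · exact absurd (h3.1 (lt_of_le_of_ne h5 h1.symm)) (not_lt.2 h4)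
    cases b <;> exact fun k hk => (this k hk).elim
  have hxE : (x : ℂ) ∈ E := left_mem_segment ℝ _ _
  have hyE : (y : ℂ) ∈ E := right_mem_segment ℝ _ _
  obtain ⟨γ, hγ⟩ := exists_path_of_isPathConnected (hE.isPathConnected ⟨_, hxE⟩)
    (fun z hz => notMem_of_mem_chart (hEb true z hz)) hxE hyE
  rw [← mk_eq_chartCls (fun t => hEb true _ (hγ t)), ← mk_eq_chartCls (fun t => hEb false _ (hγ t))]

/-- The loop that goes from `u` to `z` below the points `p k` and returns above them. -/
def aroundLoop {u z : Punctured (realPts p)} (hu : ∀ b, (u : ℂ) ∈ chart p b)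
    (hz : ∀ b, (z : ℂ) ∈ chart p b) : FundamentalGroup (Punctured (realPts p)) u :=
  FundamentalGroup.fromPath ((chartCls true (hu _) (hz _)).trans (chartCls false (hz _) (hu _)))

lemma aroundLoop_self {u : Punctured (realPts p)} (hu : ∀ b, (u : ℂ) ∈ chart p b) :
    aroundLoop hu hu = 1 := by
  rw [aroundLoop, chartCls_self, chartCls_self, Path.Homotopic.Quotient.refl_trans]
  rfl

lemma aroundLoop_eq {u z z' : Punctured (realPts p)} (hu : ∀ b, (u : ℂ) ∈ chart p b)
    (hz : ∀ b, (z : ℂ) ∈ chart p b) (hz' : ∀ b, (z' : ℂ) ∈ chart p b)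
    (h : ∀ k, p k < (z : ℂ).re ↔ p k < (z' : ℂ).re) : aroundLoop hu hz = aroundLoop hu hz' := by
  rw [aroundLoop, aroundLoop, ← chartCls_trans (hu true) (hz' true) (hz true),
    chartCls_eq_of_strip hz' hz (fun k => (h k).symm), Path.Homotopic.Quotient.trans_assoc,
    chartCls_trans]


end RealPoints

/-! ### Circles centred on the real line, and generators of the fundamental group -/

section RealPoints

open scoped unitInterval Topology

variable {n : ℕ} {p : Fin n → ℝ}

lemma turn_re (t : ℝ) : (turn t).re = Real.cos (2 * Real.pi * t) := by
  have h : turn t = Complex.exp ((2 * Real.pi * t : ℝ) * Complex.I) := by simp [turn]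
  rw [h, Complex.exp_ofReal_mul_I_re]

lemma turn_im (t : ℝ) : (turn t).im = Real.sin (2 * Real.pi * t) := by
  have h : turn t = Complex.exp ((2 * Real.pi * t : ℝ) * Complex.I) := by simp [turn]
  rw [h, Complex.exp_ofReal_mul_I_im]

lemma turn_add (s t : ℝ) : turn (s + t) = turn s * turn t := by
  rw [turn, turn, turn, ← Complex.exp_add]
  congr 1
  push_cast
  ring

lemma aroundLoop_inv_mul {u z w : Punctured (realPts p)} (hu : ∀ b, (u : ℂ) ∈ chart p b)
    (hz : ∀ b, (z : ℂ) ∈ chart p b) (hw : ∀ b, (w : ℂ) ∈ chart p b) :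
    (aroundLoop hu hw)⁻¹ * aroundLoop hu hz =
      FundamentalGroup.fromPath (((chartCls true (hu _) (hz _)).trans
        (chartCls false (hz _) (hw _))).trans (chartCls true (hw _) (hu _))) := by
  rw [FundamentalGroup.mul_def, FundamentalGroup.inv_def]
  simp only [aroundLoop, cls_symm_trans_rev, chartCls_symm]
  rw [Path.Homotopic.Quotient.trans_assoc, ← Path.Homotopic.Quotient.trans_assoc _ _
    (chartCls true (hw _) (hu _)), chartCls_trans, Path.Homotopic.Quotient.trans_assoc]

/-- A circle with centre on the real line in terms of the loops `aroundLoop`. -/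
lemma lasso_circle_eq {u e w : Punctured (realPts p)} (hu : ∀ b, (u : ℂ) ∈ chart p b)
    (he : ∀ b, (e : ℂ) ∈ chart p b) (hw : ∀ b, (w : ℂ) ∈ chart p b) {a r : ℝ} (hr : 0 < r)
    (hea : (e : ℂ) = (a + r : ℝ)) (hwa : (w : ℂ) = (a - r : ℝ)) {ω : Path e e}
    (hω : IsCircle a ω) :
    lasso (chartCls true (hu _) (he _)) (FundamentalGroup.fromPath (.mk ω)) =
      (aroundLoop hu hw)⁻¹ * aroundLoop hu he := by
  have hsub : (e : ℂ) - a = r := by rw [hea]; push_cast; ring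
  have hnot : ∀ t : I, (a : ℂ) + turn t * r ∉ realPts p := fun t => by
    rw [← hsub, ← hω t]; exact (ω t).2
  have him : ∀ t : ℝ, ((a : ℂ) + turn t * r).im = Real.sin (2 * Real.pi * t) * r := by
    intro t; simp [turn_im]
  have ht1 : ∀ t : I, (t / 2 : ℝ) ∈ I := fun t => ⟨by linarith [t.2.1], by linarith [t.2.2]⟩
  have ht2 : ∀ t : I, ((1 + t) / 2 : ℝ) ∈ I := fun t =>
    ⟨by linarith [t.2.1], by linarith [t.2.2]⟩
  have hpi := Real.pi_pos
  -- The upper half circle lies in the chart `false`, the lower one in the chart `true`.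
  let up : Path e w := ⟨⟨fun t => ⟨a + turn (t / 2) * r, hnot ⟨_, ht1 t⟩⟩, by fun_prop⟩,
    by ext; simp [turn_zero, hea], by
      ext; simp only [Icc.coe_one, turn_half, hwa]; push_cast; ring⟩
  let dn : Path w e := ⟨⟨fun t => ⟨a + turn ((1 + t) / 2) * r, hnot ⟨_, ht2 t⟩⟩, by fun_prop⟩,
    by ext; simp only [Icc.coe_zero, add_zero, turn_half, hwa]; push_cast; ring, by
      ext; simp only [Icc.coe_one]; norm_num [turn_one, hea]⟩
  have h1 : ω = up.trans dn := by
    ext t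
    rw [hω t, Path.trans_apply, hsub]
    split_ifs with h
    · change _ = (a : ℂ) + turn ((2 * (t : ℝ)) / 2) * r
      congr 3; ring
    · change _ = (a : ℂ) + turn ((1 + (2 * (t : ℝ) - 1)) / 2) * r
      congr 3; ring
  have h2 : Path.Homotopic.Quotient.mk up = chartCls false (he _) (hw _) := by
    refine mk_eq_chartCls (fun t => mem_chart_false_of_im_nonneg (up t).2 ?_) _ _
    change 0 ≤ ((a : ℂ) + turn (t / 2) * r).im
    rw [him]
    refine mul_nonneg (Real.sin_nonneg_of_nonneg_of_le_pi ?_ ?_) hr.le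
    · have := t.2.1; positivity
    · nlinarith [t.2.2]
  have h3 : Path.Homotopic.Quotient.mk dn = chartCls true (hw _) (he _) := by
    refine mk_eq_chartCls (fun t => mem_chart_true_of_im_nonpos (dn t).2 ?_) _ _
    change ((a : ℂ) + turn ((1 + t) / 2) * r).im ≤ 0
    rw [him]
    refine mul_nonpos_of_nonpos_of_nonneg ?_ hr.le
    have : 2 * Real.pi * ((1 + t) / 2) = Real.pi * t + Real.pi := by ring
    rw [this, Real.sin_add_pi, neg_nonpos]
    refine Real.sin_nonneg_of_nonneg_of_le_pi ?_ ?_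
    · have := t.2.1; positivity
    · nlinarith [t.2.2]
  rw [aroundLoop_inv_mul, h1, lasso, Path.Homotopic.Quotient.mk_trans, h2, h3, chartCls_symm]
  simp only [Path.Homotopic.Quotient.trans_assoc]
  rw [chartCls_trans]

/-- An induction principle for homotopy classes of paths in a space covered by two charts. -/
lemma cls_induction {u : Punctured (realPts p)}
    (P : ∀ z : Punctured (realPts p), Path.Homotopic.Quotient u z → Prop)
    (h0 : P u (.refl u))
    (hs : ∀ (b : Bool) (x y : Punctured (realPts p)) (c : Path.Homotopic.Quotient u x)
      (hx : (x : ℂ) ∈ chart p b) (hy : (y : ℂ) ∈ chart p b), P x c →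
        P y (c.trans (chartCls b hx hy)))
    {z : Punctured (realPts p)} (c : Path.Homotopic.Quotient u z) : P z c := by
  induction c using Path.Homotopic.Quotient.ind with | mk γ =>
  -- By compactness the path is cut into finitely many pieces, each inside one chart.
  obtain ⟨t, ht0, htm, ⟨N, hN⟩, ht⟩ := exists_monotone_Icc_subset_open_cover_unitInterval
    (c := fun b : Bool => {s : I | (γ s : ℂ) ∈ chart p b})
    (fun b => (isOpen_chart b).preimage (by fun_prop))
    (fun s _ => mem_iUnion.2 (mem_chart_or (γ s)))
  have key : ∀ k, P (γ (t k)) ((Path.Homotopic.Quotient.mk (γ.subpath 0 (t k))).cast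
      γ.source.symm rfl) := by
    intro k
    induction k with
    | zero =>
      rw [ht0, Path.subpath_self]
      have : ∀ x : Punctured (realPts p), ∀ h : u = x, P x ((Path.Homotopic.Quotient.mk
          (Path.refl x)).cast h rfl) := by
        rintro x rfl
        exact h0
      exact this _ _
    | succ k ih =>
      obtain ⟨b, hb⟩ := ht k
      have hle : t k ≤ t (k + 1) := htm (Nat.le_succ k)
      have hx := hb (left_mem_Icc.2 hle)
      have hy := hb (right_mem_Icc.2 hle)
      have h1 := hs b _ _ _ hx hy ih
      have h2 : Path.Homotopic.Quotient.mk (γ.subpath (t k) (t (k + 1))) = chartCls b hx hy := by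
        refine mk_eq_chartCls (fun s => ?_) _ _
        have : γ.subpath (t k) (t (k + 1)) s ∈ range (γ.subpath (t k) (t (k + 1))) := ⟨s, rfl⟩
        rw [Path.range_subpath_of_le _ _ _ hle] at this
        obtain ⟨s', hs', h⟩ := this
        rw [← h]
        exact hb hs'
      rw [← h2] at h1
      have h3 : Path.Homotopic.Quotient.mk (γ.subpath 0 (t (k + 1))) =
          (Path.Homotopic.Quotient.mk (γ.subpath 0 (t k))).trans (.mk (γ.subpath (t k) (t (k + 1)))) :=
        (Path.Homotopic.Quotient.eq.2 ⟨Path.Homotopy.subpathTransSubpath γ 0 (t k) (t (k + 1))⟩).symm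
      rw [h3]
      have h4 : ∀ {a b c d : Punctured (realPts p)} (h : d = a) (q : Path.Homotopic.Quotient a b)
          (r : Path.Homotopic.Quotient b c), (q.trans r).cast h rfl = (q.cast h rfl).trans r := by
        rintro a b c d rfl q r
        rw [Path.Homotopic.Quotient.cast_rfl_rfl, Path.Homotopic.Quotient.cast_rfl_rfl]
      rw [h4]
      exact h1
  have := key N
  rw [hN N le_rfl] at this
  have h5 : ∀ (x : Punctured (realPts p)) (h : z = x) (q : Path.Homotopic.Quotient u x),
      P x q → P z (q.cast rfl h) := by
    rintro x rfl q hq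
    rwa [Path.Homotopic.Quotient.cast_rfl_rfl]
  have h6 := h5 _ γ.target.symm _ this
  rw [Path.Homotopic.Quotient.cast_cast, Path.subpath_zero_one, ← Path.Homotopic.Quotient.mk_cast]
    at h6
  exact h6

/-- A subgroup which contains the loops `aroundLoop` is the whole fundamental group. -/
lemma eq_top_of_aroundLoop_mem {u : Punctured (realPts p)} (hu : ∀ b, (u : ℂ) ∈ chart p b)
    (H : Subgroup (FundamentalGroup (Punctured (realPts p)) u))
    (hH : ∀ (z : Punctured (realPts p)) (hz : ∀ b, (z : ℂ) ∈ chart p b), aroundLoop hu hz ∈ H) :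
    H = ⊤ := by
  -- Invariant of the induction: a class is an element of `H` followed by the direct class inside a
  -- chart containing its end point. Changing the chart at a point of both charts costs one loop
  -- `aroundLoop` or its inverse.
  let P : ∀ z : Punctured (realPts p), Path.Homotopic.Quotient u z → Prop := fun z c =>
    (∀ hz : (z : ℂ) ∈ chart p true, ∃ h ∈ H, c = Path.Homotopic.Quotient.trans
      (FundamentalGroup.toPath h) (chartCls true (hu _) hz)) ∧
    (∀ hz : (z : ℂ) ∈ chart p false, ∃ h ∈ H, c = Path.Homotopic.Quotient.trans
      (FundamentalGroup.toPath h) (chartCls false (hu _) hz))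
  have hP : ∀ (z : Punctured (realPts p)) (c : Path.Homotopic.Quotient u z), P z c := by
    intro z c
    refine cls_induction P ?_ ?_ c
    · refine ⟨fun hz => ⟨1, H.one_mem, ?_⟩, fun hz => ⟨1, H.one_mem, ?_⟩⟩
      all_goals
        rw [chartCls_self, FundamentalGroup.one_def, Path.Homotopic.Quotient.trans_refl]
    · rintro b x y c hx hy ⟨h1, h2⟩
      have hboth : ∀ b b' : Bool, b ≠ b' → ∀ z : ℂ, z ∈ chart p b → z ∈ chart p b' →
          ∀ b, z ∈ chart p b := by
        rintro (_ | _) (_ | _) h z h1 h2 (_ | _) <;> first | exact h1 | exact h2 | exact (h rfl).elim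
      rcases b with _ | _
      · obtain ⟨h, hh, rfl⟩ := h2 hx
        simp only [Path.Homotopic.Quotient.trans_assoc, chartCls_trans]
        refine ⟨fun hz => ⟨(aroundLoop hu (hboth _ _ (by simp) _ hz hy))⁻¹ * h,
          H.mul_mem (H.inv_mem (hH _ _)) hh, ?_⟩, fun hz => ⟨h, hh, rfl⟩⟩
        rw [FundamentalGroup.mul_def, FundamentalGroup.inv_def, aroundLoop, cls_symm_trans_rev,
          chartCls_symm, chartCls_symm]
        simp only [Path.Homotopic.Quotient.trans_assoc, chartCls_trans, chartCls_self,
          Path.Homotopic.Quotient.trans_refl]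
      · obtain ⟨h, hh, rfl⟩ := h1 hx
        simp only [Path.Homotopic.Quotient.trans_assoc, chartCls_trans]
        refine ⟨fun hz => ⟨h, hh, rfl⟩, fun hz => ⟨aroundLoop hu (hboth _ _ (by simp) _ hz hy) * h,
          H.mul_mem (hH _ _) hh, ?_⟩⟩
        rw [FundamentalGroup.mul_def, aroundLoop]
        simp only [Path.Homotopic.Quotient.trans_assoc, chartCls_trans, chartCls_self,
          Path.Homotopic.Quotient.trans_refl]
  rw [eq_top_iff]
  intro g _
  obtain ⟨h, hh, e⟩ := (hP u (FundamentalGroup.toPath g)).1 (hu _)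
  rw [chartCls_self, Path.Homotopic.Quotient.trans_refl] at e
  have : g = h := e
  rwa [this]

/-! ### A covering of the complement of points on the real line -/

lemma eventually_strip {x : ℂ} (hx : ∀ k, x.re ≠ p k) :
    ∀ᶠ z in 𝓝 x, ∀ k, p k < z.re ↔ p k < x.re := by
  rw [Filter.eventually_all]
  intro k
  rcases lt_or_gt_of_ne (hx k) with h | h
  · filter_upwards [(isOpen_lt Complex.continuous_re continuous_const).mem_nhds h] with z hz
    exact ⟨fun h' => absurd hz (not_lt.2 h'.le), fun h' => absurd h (not_lt.2 h'.le)⟩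
  · filter_upwards [(isOpen_lt continuous_const Complex.continuous_re).mem_nhds h] with z hz
    exact ⟨fun _ => h, fun _ => hz⟩

variable {F : Type} [Group F] [TopologicalSpace F] [DiscreteTopology F]

/-- The principal bundle over the complement of the points `p k` with transition function `h j`
on the `j`-th strip of the intersection of the two charts. -/
def coreOf (p : Fin n → ℝ) (h : ℕ → F) : FiberBundleCore Bool (Punctured (realPts p)) F where
  baseSet b := {z | (z : ℂ) ∈ chart p b}
  isOpen_baseSet b := (isOpen_chart b).preimage continuous_subtype_val
  indexAt z := (mem_chart_or z).choose
  mem_baseSet_at z := (mem_chart_or z).choose_spec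
  -- For `b = b'` the two factors cancel and otherwise one of them is `1`, so their order does not
  -- matter although `F` is not commutative.
  coordChange b b' z g :=
    (if b then 1 else (h (stripIdx p z))⁻¹) * ((if b' then 1 else h (stripIdx p z)) * g)
  coordChange_self b z _ g := by cases b <;> simp
  continuousOn_coordChange b b' := by
    rintro ⟨z, g⟩ ⟨hz, -⟩
    by_cases hbb : b = b'
    · subst hbb
      refine ContinuousWithinAt.congr (f := Prod.snd) continuous_snd.continuousWithinAt ?_ ?_
      · rintro ⟨y, g'⟩ _; cases b <;> simp
      · cases b <;> simp
    have hne : ∀ k, (z : ℂ).re ≠ p k := by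
      intro k hk
      have h1 := hz.1 
      have h2 := hz.2
      cases b <;> cases b' <;> first | exact hbb rfl | exact lt_asymm (h1 k hk) (h2 k hk)
    have h1 : ∀ᶠ y : Punctured (realPts p) × F in 𝓝 (z, g), stripIdx p y.1 = stripIdx p z ∧
        y.2 = g := by
      have e1 : ∀ᶠ y : Punctured (realPts p) in 𝓝 z, stripIdx p y = stripIdx p z := by
        filter_upwards [continuous_subtype_val.continuousAt.eventually (eventually_strip hne)]
          with y hy
        simp only [stripIdx, hy]
      have e2 : ∀ᶠ y : F in 𝓝 g, y = g := by simp
      exact e1.prodMk_nhds e2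
    apply ContinuousAt.continuousWithinAt
    refine (continuousAt_const (y := (if b then 1 else (h (stripIdx p z))⁻¹) *
      ((if b' then 1 else h (stripIdx p z)) * g))).congr ?_
    filter_upwards [h1] with y hy
    rw [hy.1, hy.2]
  coordChange_comp i j k z _ g := by cases i <;> cases j <;> cases k <;> simp

lemma isCoveringMap_coreOf (p : Fin n → ℝ) (h : ℕ → F) : IsCoveringMap (coreOf p h).proj :=
  FiberBundle.isCoveringMap (F := F) (E := (coreOf p h).Fiber)

/-- The point over `x` with coordinate `g` in the chart `b`. -/
def bundlePt (h : ℕ → F) (b : Bool) (x : Punctured (realPts p)) (g : F) :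
    (coreOf p h).proj ⁻¹' {x} :=
  ⟨((coreOf p h).localTriv b).toOpenPartialHomeomorph.symm (x, g), rfl⟩

lemma bundlePt_eq (h : ℕ → F) {x : Punctured (realPts p)} (hx : ∀ b, (x : ℂ) ∈ chart p b)
    (g : F) : bundlePt h true x g = bundlePt h false x (h (stripIdx p x) * g) := by
  apply Subtype.ext
  simp only [bundlePt]
  apply ((coreOf p h).localTriv true).toOpenPartialHomeomorph.injOn
  · exact hx true
  · exact hx true
  · rw [OpenPartialHomeomorph.right_inv]
    · change (x, g) = (x, (coreOf p h).coordChange ((coreOf p h).indexAt x) true x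
        ((coreOf p h).coordChange false ((coreOf p h).indexAt x) x (h (stripIdx p x) * g)))
      rw [(coreOf p h).coordChange_comp _ _ _ _ ⟨⟨hx _, (coreOf p h).mem_baseSet_at x⟩, hx _⟩]
      simp [coreOf]
    · exact ⟨hx true, mem_univ _⟩

lemma bundlePt_injective (h : ℕ → F) {b : Bool} {x : Punctured (realPts p)}
    (hx : (x : ℂ) ∈ chart p b) : Function.Injective (bundlePt h b x) := by
  intro g g' hg
  have h1 := congrArg Subtype.val hg
  simp only [bundlePt] at h1
  have h2 := ((coreOf p h).localTriv b).toOpenPartialHomeomorph.symm.injOn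
    (show (x, g) ∈ _ from ⟨hx, mem_univ _⟩) (show (x, g') ∈ _ from ⟨hx, mem_univ _⟩) h1
  exact (Prod.ext_iff.1 h2).2

/-- In the trivialization over a chart, the lift of a path is the path with constant coordinate. -/
lemma monodromy_chartCls (h : ℕ → F) {b : Bool} {x y : Punctured (realPts p)}
    (hx : (x : ℂ) ∈ chart p b) (hy : (y : ℂ) ∈ chart p b) (g : F) :
    (isCoveringMap_coreOf p h).monodromy (chartCls b hx hy) (bundlePt h b x g) =
      bundlePt h b y g := by
  obtain ⟨γ, h1, h2⟩ := exists_chartCls_eq b hx hy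
  rw [h1]
  apply Subtype.ext
  let Γ : I → (coreOf p h).TotalSpace := fun t =>
    ((coreOf p h).localTriv b).toOpenPartialHomeomorph.symm (γ t, g)
  have hΓ : Continuous Γ := by
    refine (((coreOf p h).localTriv b).toOpenPartialHomeomorph.continuousOn_symm).comp_continuous
      (by fun_prop) fun t => ⟨h2 t, mem_univ _⟩
  have := ((isCoveringMap_coreOf p h).eq_liftPath_iff (γ := (γ : C(I, _)))
    (e := (bundlePt h b x g).1) (by simp [bundlePt]) (Γ := Γ)).2
    ⟨hΓ, rfl, congrArg (fun z => ((coreOf p h).localTriv b).toOpenPartialHomeomorph.symm (z, g))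
      γ.source⟩
  have h3 := congrFun this 1
  exact h3.symm.trans (congrArg
    (fun z => ((coreOf p h).localTriv b).toOpenPartialHomeomorph.symm (z, g)) γ.target)

/-- The coordinate changes only where the loop changes charts: by `h` of the strip of `z` on the way
out, and by the inverse of `h` of the strip of `u` at the end. -/
lemma monodromyPerm_aroundLoop (h : ℕ → F) {u z : Punctured (realPts p)}
    (hu : ∀ b, (u : ℂ) ∈ chart p b) (hz : ∀ b, (z : ℂ) ∈ chart p b) (g : F) :
    (isCoveringMap_coreOf p h).monodromyPerm u (aroundLoop hu hz) (bundlePt h true u g) =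
      bundlePt h true u ((h (stripIdx p u))⁻¹ * (h (stripIdx p z) * g)) := by
  rw [IsCoveringMap.coe_monodromyPerm, aroundLoop]
  change (isCoveringMap_coreOf p h).monodromy ((chartCls true (hu _) (hz _)).trans
    (chartCls false (hz _) (hu _))) _ = _
  rw [IsCoveringMap.monodromy_trans_apply, monodromy_chartCls, bundlePt_eq h hz,
    monodromy_chartCls, bundlePt_eq h hu, mul_inv_cancel_left]

end RealPoints

/-! ### The loops around the points of the real line are free generators -/

section RealPoints

open scoped unitInterval Topology

variable {n : ℕ} {p : Fin n → ℝ}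

lemma lt_re_iff_lt_stripIdx (hp : StrictMono p) (z : ℂ) (k : Fin n) :
    p k < z.re ↔ (k : ℕ) < stripIdx p z := by
  constructor
  · intro h
    have : Finset.Iic k ⊆ Finset.univ.filter fun k => p k < z.re := by
      intro i hi
      rw [Finset.mem_Iic] at hi
      simpa using (hp.monotone hi).trans_lt h
    have := Finset.card_le_card this
    rw [Fin.card_Iic] at this
    exact this
  · intro h
    by_contra hk
    have : (Finset.univ.filter fun k => p k < z.re) ⊆ Finset.Iio k := by
      intro i hi
      rw [Finset.mem_Iio]
      by_contra hik
      rw [not_lt] at hik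
      simp only [Finset.mem_filter, Finset.mem_univ, true_and] at hi
      exact hk ((hp.monotone hik).trans_lt hi)
    have := Finset.card_le_card this
    rw [Fin.card_Iio] at this
    exact absurd h (not_lt.2 this)

lemma stripIdx_le (z : ℂ) : stripIdx p z ≤ n := by
  have := Finset.card_filter_le (Finset.univ : Finset (Fin n)) fun k => p k < z.re
  rwa [Finset.card_univ, Fintype.card_fin] at this

lemma stripIdx_eq_of {z : ℂ} {j : ℕ} (hj : j ≤ n) (h : ∀ k, p k < z.re ↔ (k : ℕ) < j) :
    stripIdx p z = j := by
  have : (Finset.univ.filter fun k => p k < z.re) =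
      (Finset.univ : Finset (Fin n)).filter fun k : Fin n => (k : ℕ) < j := by
    ext k; simp [h]
  rw [stripIdx, this, Fin.card_filter_val_lt, min_eq_right hj]

lemma mem_chart_of_re_ne {z : ℂ} (h : ∀ k, z.re ≠ p k) (b : Bool) : z ∈ chart p b := by
  cases b <;> exact fun k hk => (h k hk).elim

/-- The class of the loops `aroundLoop` through the `j`-th strip. -/
def stripLoop {u : Punctured (realPts p)} (hu : ∀ b, (u : ℂ) ∈ chart p b) (j : ℕ) :
    FundamentalGroup (Punctured (realPts p)) u := by
  classical
  -- For increasing `p` the strips `0, …, n` are nonempty (`exists_strip`), so the default value `1`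
  -- is taken only for `j > n`.
  exact if h : ∃ z : Punctured (realPts p), (∀ b, (z : ℂ) ∈ chart p b) ∧ stripIdx p z = j then
    aroundLoop hu h.choose_spec.1 else 1

lemma aroundLoop_eq_stripLoop (hp : StrictMono p) {u z : Punctured (realPts p)}
    (hu : ∀ b, (u : ℂ) ∈ chart p b) (hz : ∀ b, (z : ℂ) ∈ chart p b) :
    aroundLoop hu hz = stripLoop hu (stripIdx p z) := by
  have h : ∃ z' : Punctured (realPts p), (∀ b, (z' : ℂ) ∈ chart p b) ∧
    stripIdx p z' = stripIdx p z := ⟨z, hz, rfl⟩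
  rw [stripLoop, dif_pos h]
  apply aroundLoop_eq
  intro k
  rw [lt_re_iff_lt_stripIdx hp, lt_re_iff_lt_stripIdx hp, h.choose_spec.2]

/-- The loop around the point `p k`. -/
def ptLoop {u : Punctured (realPts p)} (hu : ∀ b, (u : ℂ) ∈ chart p b) (k : ℕ) :
    FundamentalGroup (Punctured (realPts p)) u :=
  (stripLoop hu k)⁻¹ * stripLoop hu (k + 1)

lemma stripLoop_stripIdx_self (hp : StrictMono p) {u : Punctured (realPts p)}
    (hu : ∀ b, (u : ℂ) ∈ chart p b) : stripLoop hu (stripIdx p u) = 1 := by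
  rw [← aroundLoop_eq_stripLoop hp hu hu, aroundLoop_self]

/-- The product telescopes, and the loop through the strip `0`, which contains `u`, is trivial. -/
lemma prod_ptLoop (hp : StrictMono p) {u : Punctured (realPts p)}
    (hu : ∀ b, (u : ℂ) ∈ chart p b) (h0 : stripIdx p u = 0) (j : ℕ) :
    ((List.range j).map (ptLoop hu)).prod = stripLoop hu j := by
  induction j with
  | zero => rw [← h0, stripLoop_stripIdx_self hp hu]; simp [h0]
  | succ j ih =>
    rw [List.range_succ, List.map_append, List.prod_append, ih]
    rw [List.map_singleton, List.prod_singleton, ptLoop, mul_inv_cancel_left]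

lemma exists_strip (hp : StrictMono p) {j : ℕ} (hj : j ≤ n) :
    ∃ z : Punctured (realPts p), (∀ b, (z : ℂ) ∈ chart p b) ∧ stripIdx p z = j := by
  obtain ⟨r, hr⟩ : ∃ r : ℝ, (∀ k : Fin n, (k : ℕ) < j → p k < r) ∧
      ∀ k : Fin n, j ≤ (k : ℕ) → r < p k := by
    have := Set.Finite.exists_between' (s := p '' {k | (k : ℕ) < j}) (t := p '' {k | j ≤ (k : ℕ)})
      (toFinite _) (toFinite _) (by
        rintro _ ⟨k, hk, rfl⟩ _ ⟨k', hk', rfl⟩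
        exact hp (Fin.lt_def.2 (lt_of_lt_of_le hk hk')))
    obtain ⟨r, h1, h2⟩ := this
    exact ⟨r, fun k hk => h1 _ ⟨k, hk, rfl⟩, fun k hk => h2 _ ⟨k, hk, rfl⟩⟩
  have hne : ∀ k, ((r : ℂ)).re ≠ p k := by
    intro k hk
    rw [Complex.ofReal_re] at hk
    rcases lt_or_ge (k : ℕ) j with h | h
    · exact absurd (hr.1 k h) (by simp [hk])
    · exact absurd (hr.2 k h) (by simp [hk])
  refine ⟨⟨r, notMem_of_mem_chart (mem_chart_of_re_ne hne true)⟩, mem_chart_of_re_ne hne, ?_⟩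
  refine stripIdx_eq_of hj fun k => ?_
  simp only [Complex.ofReal_re]
  rcases lt_or_ge (k : ℕ) j with h | h
  · exact ⟨fun _ => h, fun _ => hr.1 k h⟩
  · exact ⟨fun h' => absurd h' (not_lt.2 (hr.2 k h).le), fun h' => absurd h' (not_lt.2 h)⟩

/-- The homomorphism from the free group to the fundamental group given by the loops around the
points. -/
def freeToLoops {u : Punctured (realPts p)} (hu : ∀ b, (u : ℂ) ∈ chart p b) :
    FreeGroup (Fin n) →* FundamentalGroup (Punctured (realPts p)) u :=
  FreeGroup.lift fun k => ptLoop hu k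

lemma freeToLoops_surjective (hp : StrictMono p) {u : Punctured (realPts p)}
    (hu : ∀ b, (u : ℂ) ∈ chart p b) (h0 : stripIdx p u = 0) :
    Function.Surjective (freeToLoops hu) := by
  rw [← MonoidHom.range_eq_top]
  refine eq_top_of_aroundLoop_mem hu _ fun z hz => ?_
  rw [aroundLoop_eq_stripLoop hp, ← prod_ptLoop hp hu h0]
  refine Subgroup.list_prod_mem _ fun x hx => ?_
  rw [List.mem_map] at hx
  obtain ⟨k, hk, rfl⟩ := hx
  rw [List.mem_range] at hk
  exact ⟨FreeGroup.of ⟨k, hk.trans_le (stripIdx_le _)⟩, by simp [freeToLoops]⟩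

/-- In the covering whose fibre is the free group itself and whose transition over the strip `j` is
the product of the first `j` generators, the loop around `p k` multiplies the coordinate by the
generator `k`. Hence a word `w` moves the coordinate `1` to `w`, and a word with trivial image is
trivial. -/
lemma freeToLoops_injective (hp : StrictMono p) {u : Punctured (realPts p)}
    (hu : ∀ b, (u : ℂ) ∈ chart p b) (h0 : stripIdx p u = 0) :
    Function.Injective (freeToLoops hu) := by
  let _ : TopologicalSpace (FreeGroup (Fin n)) := ⊥
  have : DiscreteTopology (FreeGroup (Fin n)) := ⟨rfl⟩
  -- Chosen so that `(h k)⁻¹ * h (k + 1)` is the generator `k`, in parallel with the definition of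
  -- `ptLoop`.
  let h : ℕ → FreeGroup (Fin n) := fun j => (((List.finRange n).take j).map FreeGroup.of).prod
  have hh : ∀ k : Fin n, h (k + 1) = h k * FreeGroup.of k := by
    intro k
    simp only [h]
    rw [List.take_succ_eq_append_getElem (by simp), List.map_append, List.prod_append]
    simp
  have h00 : h 0 = 1 := by simp [h]
  let M := (isCoveringMap_coreOf p h).monodromyPerm u
  have hstrip : ∀ j ≤ n, ∀ g, M (stripLoop hu j) (bundlePt h true u g) =
      bundlePt h true u (h j * g) := by
    intro j hj g
    obtain ⟨z, hz, rfl⟩ := exists_strip hp hj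
    rw [← aroundLoop_eq_stripLoop hp hu hz, monodromyPerm_aroundLoop, h0, h00, inv_one, one_mul]
  have hpt : ∀ (k : Fin n) g, M (ptLoop hu k) (bundlePt h true u g) =
      bundlePt h true u (FreeGroup.of k * g) := by
    intro k g
    rw [ptLoop, map_mul, map_inv, Equiv.Perm.mul_apply, hstrip _ k.2, hh, Equiv.Perm.inv_eq_iff_eq,
      hstrip _ k.2.le, mul_assoc]
  have hall : ∀ (w g : FreeGroup (Fin n)), M (freeToLoops hu w) (bundlePt h true u g) =
      bundlePt h true u (w * g) := by
    intro w
    induction w using FreeGroup.induction_on with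
    | C1 => intro g; rw [map_one, map_one, Equiv.Perm.one_apply, one_mul]
    | of k => intro g; simpa [freeToLoops] using hpt k g
    | inv_of k _ =>
      intro g
      rw [map_inv, map_inv, Equiv.Perm.inv_eq_iff_eq]
      simpa [freeToLoops] using (hpt k ((FreeGroup.of k)⁻¹ * g)).symm
    | mul x y hx hy => intro g; rw [map_mul, map_mul, Equiv.Perm.mul_apply, hy, hx, mul_assoc]
  rw [injective_iff_map_eq_one]
  intro w hw
  have h1 := hall w 1
  rw [hw, map_one, Equiv.Perm.one_apply, mul_one] at h1
  exact (bundlePt_injective h (hu true) h1).symm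

/-- A small circle around the point `p k`, reached from below. -/
lemma lasso_circle_eq_ptLoop (hp : StrictMono p) {u e : Punctured (realPts p)}
    (hu : ∀ b, (u : ℂ) ∈ chart p b) (he : (e : ℂ) ∈ chart p true) {k : Fin n} {r : ℝ}
    (hr : 0 < r) (hk : ∀ j, j ≠ k → r < |p j - p k|) (hea : (e : ℂ) = (p k + r : ℝ))
    {ω : Path e e} (hω : IsCircle (p k) ω) :
    lasso (chartCls true (hu _) he) (FundamentalGroup.fromPath (.mk ω)) = ptLoop hu k := by
  have lt_of : ∀ j, j < k → p j < p k - r := fun j hj => by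
    have h1 := hk j hj.ne
    have h2 := hp hj
    rw [abs_of_neg (by linarith)] at h1
    linarith
  have gt_of : ∀ j, k < j → p k + r < p j := fun j hj => by
    have h1 := hk j hj.ne'
    have h2 := hp hj
    rw [abs_of_pos (by linarith)] at h1
    linarith
  have hne1 : ∀ j, ((p k + r : ℝ) : ℂ).re ≠ p j := by
    intro j
    rw [Complex.ofReal_re]
    rcases lt_trichotomy j k with h | rfl | h
    · exact (by linarith [lt_of j h] : p j < p k + r).ne'
    · simp [hr.ne']
    · exact (gt_of j h).ne
  have hne2 : ∀ j, ((p k - r : ℝ) : ℂ).re ≠ p j := by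
    intro j
    rw [Complex.ofReal_re]
    rcases lt_trichotomy j k with h | rfl | h
    · exact (lt_of j h).ne'
    · simp [hr.ne']
    · exact (by linarith [gt_of j h] : p k - r < p j).ne
  have he' : ∀ b, (e : ℂ) ∈ chart p b := by rw [hea]; exact mem_chart_of_re_ne hne1
  let w : Punctured (realPts p) := ⟨_, notMem_of_mem_chart (mem_chart_of_re_ne hne2 true)⟩
  have hw : ∀ b, (w : ℂ) ∈ chart p b := mem_chart_of_re_ne hne2
  rw [lasso_circle_eq hu he' hw hr hea rfl hω, aroundLoop_eq_stripLoop hp,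
    aroundLoop_eq_stripLoop hp, ptLoop]
  have e1 : stripIdx p e = k + 1 := by
    refine stripIdx_eq_of k.2 fun j => ?_
    rw [hea, Complex.ofReal_re]
    rcases lt_trichotomy j k with h | rfl | h
    · exact ⟨fun _ => by have := Fin.lt_def.1 h; omega, fun _ => by linarith [lt_of j h]⟩
    · exact ⟨fun _ => by omega, fun _ => by linarith⟩
    · exact ⟨fun h' => by linarith [gt_of j h], fun h' => by have := Fin.lt_def.1 h; omega⟩
  have e2 : stripIdx p w = k := by
    refine stripIdx_eq_of k.2.le fun j => ?_
    change p j < ((p k - r : ℝ) : ℂ).re ↔ _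
    rw [Complex.ofReal_re]
    rcases lt_trichotomy j k with h | rfl | h
    · exact ⟨fun _ => Fin.lt_def.1 h, fun _ => lt_of j h⟩
    · exact ⟨fun _ => by linarith, fun _ => by omega⟩
    · exact ⟨fun h' => by linarith [gt_of j h], fun h' => by have := Fin.lt_def.1 h; omega⟩
  rw [e1, e2]

end RealPoints

/-! ### Loops along paths -/

section LoopAlong

open scoped unitInterval Topology

variable {N : Set ℂ} {u : Punctured N} {a : ℂ}

/-- The punctured disc is the image of a half plane under the shifted exponential. -/
lemma isPathConnected_puncturedBall (a : ℂ) {ε : ℝ} (hε : 0 < ε) :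
    IsPathConnected (ball a ε \ {a}) := by
  have h1 : ball a ε \ {a} = (fun z => a + Complex.exp z) '' {z : ℂ | z.re < Real.log ε} := by
    ext z
    simp only [mem_sdiff, mem_ball, mem_singleton_iff, mem_image, mem_ofPred_eq]
    constructor
    · rintro ⟨h1, h2⟩
      have h3 : z - a ≠ 0 := sub_ne_zero.2 h2
      refine ⟨Complex.log (z - a), ?_, by rw [Complex.exp_log h3]; ring⟩
      rw [Complex.log_re]
      exact Real.log_lt_log (norm_pos_iff.2 h3) (by rwa [← dist_eq_norm])
    · rintro ⟨w, hw, rfl⟩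
      refine ⟨?_, by simp⟩
      rw [dist_eq_norm, add_sub_cancel_left, Complex.norm_exp]
      rwa [← Real.lt_log_iff_exp_lt hε]
  rw [h1]
  refine ((convex_halfSpace_re_lt _).isPathConnected ⟨((Real.log ε - 1 : ℝ) : ℂ), ?_⟩).image
    (by fun_prop)
  simp

/-- Loops along two paths with the same end point are conjugate. -/
lemma exists_conj_of_isLoopAlong (ha : a ∈ N) {T T' : Path (u : ℂ) a}
    {δ δ' : FundamentalGroup (Punctured N) u} (h : IsLoopAlong T δ) (h' : IsLoopAlong T' δ') :
    ∃ g, δ = g * δ' * g⁻¹ := by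
  obtain ⟨s, ε, hε, hT, v, q, ω, hq, hω, rfl⟩ := h
  obtain ⟨s', ε', hε', hT', v', q', ω', hq', hω', rfl⟩ := h'
  -- The larger of the two discs contains both `v` and `v'` and still isolates `a`; inside it one
  -- circle can be carried to the other.
  obtain ⟨η, hη, hv, hv'⟩ : ∃ η, ball a η ∩ N ⊆ {a} ∧ (v : ℂ) ∈ ball a η ∧ (v' : ℂ) ∈ ball a η := by
    have h1 : (v : ℂ) ∈ ball a ε := by
      have := hq 1
      rw [q.target, mul_one] at this
      rw [this]; exact hT s le_rfl
    have h2 : (v' : ℂ) ∈ ball a ε' := by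
      have := hq' 1
      rw [q'.target, mul_one] at this
      rw [this]; exact hT' s' le_rfl
    rcases le_total ε ε' with h | h
    · exact ⟨ε', hε', ball_subset_ball h h1, h2⟩
    · exact ⟨ε, hε, h1, ball_subset_ball h h2⟩
  have hv0 : (v : ℂ) ∈ ball a η \ {a} := ⟨hv, fun h => v.2 (by rw [mem_singleton_iff.1 h]; exact ha)⟩
  have hv0' : (v' : ℂ) ∈ ball a η \ {a} :=
    ⟨hv', fun h => v'.2 (by rw [mem_singleton_iff.1 h]; exact ha)⟩
  obtain ⟨r, hr⟩ := exists_path_of_isPathConnected (N := N)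
    (isPathConnected_puncturedBall a (pos_of_mem_ball hv))
    (fun z hz hzN => hz.2 (hη ⟨hz.1, hzN⟩)) hv0 hv0'
  have h1 := lasso_circle hη hω hω' (r := r) fun t => (hr t).1
  obtain ⟨g, hg⟩ := isConj_lasso ((Path.Homotopic.Quotient.mk q).trans (.mk r)) (.mk q')
    (FundamentalGroup.fromPath (.mk ω'))
  rw [lasso_trans, h1] at hg
  exact ⟨g, hg⟩

/-- The circle in a loop along a path may be chosen small. -/
lemma IsLoopAlong.shrink (ha : a ∈ N) {T : Path (u : ℂ) a} (hinj : Function.Injective T)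
    (hend : ∀ t, T t ∈ N → T t = a) {δ : FundamentalGroup (Punctured N) u}
    (h : IsLoopAlong T δ) {r : ℝ} (hr : 0 < r) :
    ∃ (s : I) (ε : ℝ), ε ≤ r ∧ ball a ε ∩ N ⊆ {a} ∧ (∀ t, s ≤ t → T t ∈ ball a ε) ∧
      ∃ (v : Punctured N) (q : Path u v) (ω : Path v v),
        (∀ t, (q t : ℂ) = T (s * t)) ∧ IsCircle a ω ∧
        δ = FundamentalGroup.fromPath (.mk ((q.trans ω).trans q.symm)) := by
  obtain ⟨s, ε, hε, hT, v, q, ω, hq, hω, rfl⟩ := h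
  have hlt : ∀ t : I, t < 1 → T t ∉ N := by
    intro t ht h
    exact ht.ne (hinj ((hend t h).trans T.target.symm))
  have hv : (v : ℂ) = T s := by
    have := hq 1
    rwa [q.target, mul_one] at this
  have hs1 : s < 1 := by
    refine lt_of_le_of_ne s.2.2 fun h => v.2 ?_
    rw [hv, h, T.target]
    exact ha
  have hε0 : 0 < ε := pos_of_mem_ball (hT s le_rfl)
  obtain ⟨s', hs', hss', hT'⟩ : ∃ s' : I, s' < 1 ∧ s ≤ s' ∧
      ∀ t, s' ≤ t → T t ∈ ball a (min ε r) := by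
    have h1 : ∀ᶠ t in 𝓝 (1 : I), T t ∈ ball a (min ε r) := by
      apply T.continuous.continuousAt.eventually
      rw [T.target]
      exact ball_mem_nhds _ (lt_min hε0 hr)
    obtain ⟨l, hl, hl'⟩ := exists_Ioc_subset_of_mem_nhds h1 ⟨s, hs1⟩
    obtain ⟨m, hm1, hm2⟩ := exists_between (show max l s < 1 from max_lt hl hs1)
    exact ⟨m, hm2, (le_max_right _ _).trans hm1.le, fun t ht =>
      hl' ⟨(le_max_left _ _).trans_lt (hm1.trans_le ht), t.2.2⟩⟩
  have hmul : ∀ x y : I, x < 1 → x * y < 1 := fun x y hx =>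
    lt_of_le_of_lt (by
      apply Subtype.coe_le_coe.1
      have := mul_le_of_le_one_right x.2.1 y.2.2
      simpa using this) hx
  let v' : Punctured N := ⟨T s', hlt s' hs'⟩
  let q' : Path u v' := ⟨⟨fun t => ⟨T (s' * t), hlt _ (hmul _ _ hs')⟩, by fun_prop⟩,
    by ext; simp, by ext; simp [v']⟩
  have hcc : ∀ τ : I, Icc.convexComb s s' τ ∈ Icc s s' := by
    intro τ
    have : Icc.convexComb s s' τ ∈ range (Icc.convexComb s s') := ⟨τ, rfl⟩
    rwa [Path.range_subpathAux, uIcc_of_le hss'] at this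
  let pc : Path v v' := ⟨⟨fun τ => ⟨T (Icc.convexComb s s' τ), hlt _ ((hcc τ).2.trans_lt hs')⟩,
    by fun_prop⟩, by ext; simp [hv], by ext; simp [v']⟩
  have hcirc : ∀ t : ℝ, a + turn t * ((v' : ℂ) - a) ∉ N :=
    rotate_notMem hε (hT s' hss') v'.2
  have h1 : Path.Homotopic.Quotient.mk q' = (Path.Homotopic.Quotient.mk q).trans (.mk pc) := by
    have := square_homotopic (X := Punctured N) (H := fun z : I × I =>
      ⟨T (Icc.convexComb s s' z.2 * z.1), hlt _ (hmul _ _ ((hcc z.2).2.trans_lt hs'))⟩)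
      (by fun_prop) (p := q) (q := pc) (r := Path.refl u) (s := q')
      (fun t => by ext; simp [hq t]) (fun t => by ext; simp [pc]) (fun t => by ext; simp)
      (fun t => by ext; simp [q'])
    rw [Path.Homotopic.Quotient.mk_trans, Path.Homotopic.Quotient.mk_trans,
      Path.Homotopic.Quotient.mk_refl, Path.Homotopic.Quotient.refl_trans] at this
    exact this.symm
  refine ⟨s', min ε r, min_le_right _ _, ?_, hT', v', q', circlePath a v' hcirc, fun t => rfl,
    isCircle_circlePath _ _ _, ?_⟩
  · exact fun z hz => hε ⟨ball_subset_ball (min_le_left _ _) hz.1, hz.2⟩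
  · have h2 := lasso_circle hε hω (isCircle_circlePath a v' hcirc) (r := pc)
      fun t => hT _ (hcc t).1
    rw [← lasso_mk, ← lasso_mk, h1, lasso_trans, h2]

end LoopAlong

/-! ### Homeomorphisms and geometric bases -/

/-- Homeomorphisms of the complex line that carry a disc with a base point on its boundary and a
set `N` of punctures to other such data, and which are similarities near the punctures. -/
structure DiscHomeo {N N' : Set ℂ} (c : ℂ) (R : ℝ) (u : Punctured N) (c' : ℂ) (R' : ℝ)
    (u' : Punctured N') where
  toHomeo : ℂ ≃ₜ ℂ
  circle : ∀ t : ℝ, toHomeo (c + turn t * ((u : ℂ) - c)) = c' + turn t * ((u' : ℂ) - c')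
  disc : ∀ z, z ∈ closedBall c R ↔ toHomeo z ∈ closedBall c' R'
  mem_iff : ∀ z, z ∈ N ↔ toHomeo z ∈ N'
  similar : ∀ a ∈ N, ∃ α : ℂ, α ≠ 0 ∧ ∃ r > 0, ∀ z ∈ ball a r,
    toHomeo z = toHomeo a + α * (z - a)

namespace DiscHomeo

open scoped unitInterval Topology

variable {N N' N'' : Set ℂ} {c c' c'' : ℂ} {R R' R'' : ℝ} {u : Punctured N} {u' : Punctured N'}
  {u'' : Punctured N''}

/-- Composition. -/
def trans (h : DiscHomeo c R u c' R' u') (h' : DiscHomeo c' R' u' c'' R'' u'') :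
    DiscHomeo c R u c'' R'' u'' where
  toHomeo := h.toHomeo.trans h'.toHomeo
  circle t := by simp [h.circle, h'.circle]
  disc z := by rw [h.disc, h'.disc]; rfl
  mem_iff z := by rw [h.mem_iff, h'.mem_iff]; rfl
  similar a ha := by
    obtain ⟨α, hα, r, hr, h1⟩ := h.similar a ha
    obtain ⟨α', hα', r', hr', h2⟩ := h'.similar _ ((h.mem_iff a).1 ha)
    have h3 : ∀ᶠ z in 𝓝 a, h.toHomeo z ∈ ball (h.toHomeo a) r' :=
      h.toHomeo.continuous.continuousAt.eventually (ball_mem_nhds _ hr')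
    obtain ⟨r'', hr'', h4⟩ := Metric.eventually_nhds_iff_ball.1 (h3.and (ball_mem_nhds a hr))
    refine ⟨α' * α, mul_ne_zero hα' hα, r'', hr'', fun z hz => ?_⟩
    have h5 := h2 _ (h4 z hz).1
    simp only [Homeomorph.trans_apply]
    rw [h5, h1 z (h4 z hz).2]
    ring

/-- Inverse. -/
def symm (h : DiscHomeo c R u c' R' u') : DiscHomeo c' R' u' c R u where
  toHomeo := h.toHomeo.symm
  circle t := by rw [← h.circle, Homeomorph.symm_apply_apply]
  disc z := by rw [h.disc, Homeomorph.apply_symm_apply]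
  mem_iff z := by rw [h.mem_iff, Homeomorph.apply_symm_apply]
  similar b hb := by
    have ha : h.toHomeo.symm b ∈ N := by rwa [h.mem_iff, Homeomorph.apply_symm_apply]
    obtain ⟨α, hα, r, hr, h1⟩ := h.similar _ ha
    rw [Homeomorph.apply_symm_apply] at h1
    have h3 : ∀ᶠ z in 𝓝 b, h.toHomeo.symm z ∈ ball (h.toHomeo.symm b) r :=
      h.toHomeo.symm.continuous.continuousAt.eventually (ball_mem_nhds _ hr)
    obtain ⟨r', hr', h4⟩ := Metric.eventually_nhds_iff_ball.1 h3
    refine ⟨α⁻¹, inv_ne_zero hα, r', hr', fun z hz => ?_⟩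
    have h5 := h1 _ (h4 z hz)
    rw [Homeomorph.apply_symm_apply] at h5
    have h6 : z - b = α * (h.toHomeo.symm z - h.toHomeo.symm b) := by linear_combination h5
    rw [h6, inv_mul_cancel_left₀ hα]
    ring

lemma map_base (h : DiscHomeo c R u c' R' u') : h.toHomeo u = u' := by
  simpa [turn_zero] using h.circle 0

/-- The induced map of punctured planes. -/
def toMap (h : DiscHomeo c R u c' R' u') : C(Punctured N, Punctured N') :=
  ⟨fun z => ⟨h.toHomeo z, fun hz => z.2 ((h.mem_iff z).2 hz)⟩, by fun_prop⟩

lemma toMap_base (h : DiscHomeo c R u c' R' u') : h.toMap u = u' := Subtype.ext h.map_base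

/-- The induced homomorphism of fundamental groups. -/
def push (h : DiscHomeo c R u c' R' u') :
    FundamentalGroup (Punctured N) u →* FundamentalGroup (Punctured N') u' :=
  FundamentalGroup.mapOfEq h.toMap h.toMap_base

lemma push_mk (h : DiscHomeo c R u c' R' u') {γ : Path u u} {γ' : Path u' u'}
    (hγ : ∀ t, (γ' t : ℂ) = h.toHomeo (γ t)) :
    h.push (FundamentalGroup.fromPath (.mk γ)) = FundamentalGroup.fromPath (.mk γ') := by
  rw [push, FundamentalGroup.mapOfEq_apply]
  change Path.Homotopic.Quotient.mk ((γ.map h.toMap.continuous).cast h.toMap_base.symm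
    h.toMap_base.symm) = _
  congr 1
  ext t
  rw [hγ t]
  rfl

lemma push_lasso (h : DiscHomeo c R u c' R' u') {v : Punctured N} {v' : Punctured N'}
    {q : Path u v} {ω : Path v v} {q' : Path u' v'} {ω' : Path v' v'}
    (hq : ∀ t, (q' t : ℂ) = h.toHomeo (q t)) (hω : ∀ t, (ω' t : ℂ) = h.toHomeo (ω t)) :
    h.push (lasso (.mk q) (FundamentalGroup.fromPath (.mk ω))) =
      lasso (.mk q') (FundamentalGroup.fromPath (.mk ω')) := by
  rw [lasso_mk, lasso_mk]
  apply push_mk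
  intro t
  simp only [Path.trans_apply, Path.symm_apply]
  split_ifs
  exacts [hq _, hω _, hq _]

lemma push_symm_push (h : DiscHomeo c R u c' R' u') (x : FundamentalGroup (Punctured N) u) :
    h.symm.push (h.push x) = x := by
  induction x using Path.Homotopic.Quotient.ind with | mk γ =>
  have h1 := h.push_mk (γ := γ) (γ' := (γ.map h.toMap.continuous).cast h.toMap_base.symm
    h.toMap_base.symm) fun t => rfl
  change h.symm.push (h.push (FundamentalGroup.fromPath (.mk γ))) = _
  rw [h1]
  apply push_mk
  intro t
  exact (h.toHomeo.symm_apply_apply _).symm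

lemma push_push_symm (h : DiscHomeo c R u c' R' u') (x : FundamentalGroup (Punctured N') u') :
    h.push (h.symm.push x) = x := h.symm.push_symm_push x

lemma push_trans (h : DiscHomeo c R u c' R' u') (h' : DiscHomeo c' R' u' c'' R'' u'')
    (x : FundamentalGroup (Punctured N) u) : (h.trans h').push x = h'.push (h.push x) := by
  induction x using Path.Homotopic.Quotient.ind with | mk γ =>
  have h1 := h.push_mk (γ := γ) (γ' := (γ.map h.toMap.continuous).cast h.toMap_base.symm
    h.toMap_base.symm) fun t => rfl
  change _ = h'.push (h.push (FundamentalGroup.fromPath (.mk γ)))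
  rw [h1]
  have h2 := h'.push_mk (γ := (γ.map h.toMap.continuous).cast h.toMap_base.symm
    h.toMap_base.symm) (γ' := (((γ.map h.toMap.continuous).cast h.toMap_base.symm
    h.toMap_base.symm).map h'.toMap.continuous).cast h'.toMap_base.symm
    h'.toMap_base.symm) fun t => rfl
  rw [h2]
  exact push_mk _ fun t => rfl

lemma push_circle (h : DiscHomeo c R u c' R' u') {ω : Path u u} {ω' : Path u' u'}
    (hω : IsCircle c ω) (hω' : IsCircle c' ω') :
    h.push (FundamentalGroup.fromPath (.mk ω)) = FundamentalGroup.fromPath (.mk ω') :=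
  h.push_mk fun t => by rw [hω t, hω' t, h.circle]

/-- After shrinking, the circle of the loop lies where `h` is a similarity, so its image is again a
round circle run through once counterclockwise at uniform speed, as `IsCircle` demands. -/
lemma push_isLoopAlong (h : DiscHomeo c R u c' R' u') {a : ℂ} (ha : a ∈ N) {T : Path (u : ℂ) a}
    (hinj : Function.Injective T) (hend : ∀ t, T t ∈ N → T t = a)
    {δ : FundamentalGroup (Punctured N) u} (hδ : IsLoopAlong T δ)
    {T' : Path (u' : ℂ) (h.toHomeo a)} (hT' : ∀ t, T' t = h.toHomeo (T t)) :
    IsLoopAlong T' (h.push δ) := by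
  obtain ⟨α, hα, r, hr, h1⟩ := h.similar a ha
  obtain ⟨s, ε, hεr, hε, hT, v, q, ω, hq, hω, rfl⟩ := hδ.shrink ha hinj hend hr
  have hα' : 0 < ‖α‖ := norm_pos_iff.2 hα
  have hb : ∀ z ∈ ball a ε, h.toHomeo z ∈ ball (h.toHomeo a) (‖α‖ * ε) := by
    intro z hz
    rw [h1 z (ball_subset_ball hεr hz), mem_ball, dist_eq_norm, add_sub_cancel_left, norm_mul]
    exact mul_lt_mul_of_pos_left (by rwa [← dist_eq_norm]) hα'
  have hb' : ∀ w ∈ ball (h.toHomeo a) (‖α‖ * ε), ∃ z ∈ ball a ε, h.toHomeo z = w := by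
    intro w hw
    have hz : a + (w - h.toHomeo a) / α ∈ ball a ε := by
      rw [mem_ball, dist_eq_norm, add_sub_cancel_left, norm_div, div_lt_iff₀ hα', mul_comm,
        ← dist_eq_norm]
      exact hw
    refine ⟨_, hz, ?_⟩
    rw [h1 _ (ball_subset_ball hεr hz)]
    field_simp
    ring
  have hv : (v : ℂ) ∈ ball a ε := by
    have := hq 1
    rw [q.target, mul_one] at this
    rw [this]
    exact hT s le_rfl
  refine ⟨s, ‖α‖ * ε, ?_, ?_, h.toMap v, (q.map h.toMap.continuous).cast h.toMap_base.symm rfl,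
    ω.map h.toMap.continuous, ?_, ?_, ?_⟩
  · rintro w ⟨hw, hwN⟩
    obtain ⟨z, hz, rfl⟩ := hb' w hw
    rw [hε ⟨hz, (h.mem_iff z).2 hwN⟩]
    rfl
  · intro t ht
    rw [hT']
    exact hb _ (hT t ht)
  · intro t
    change h.toHomeo (q t) = _
    rw [hq t, hT']
  · intro t
    change h.toHomeo (ω t) = h.toHomeo a + turn t * (h.toHomeo v - h.toHomeo a)
    have h2 : (ω t : ℂ) ∈ ball a ε := by rw [hω t, mem_ball, dist_rotate]; exact hv
    rw [h1 _ (ball_subset_ball hεr h2), h1 _ (ball_subset_ball hεr hv), hω t]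
    ring
  · exact h.push_lasso (q := q) (ω := ω) (fun t => rfl) fun t => rfl

lemma push_isGeometricBase (h : DiscHomeo c R u c' R' u')
    {δ : List (FundamentalGroup (Punctured N) u)} (hδ : IsGeometricBase c R u δ) :
    IsGeometricBase c' R' u' (δ.map h.push) := by
  obtain ⟨⟨a, T, hb, hT⟩, ω, hω, hprod⟩ := hδ
  have hl : (δ.map h.push).length = δ.length := List.length_map _
  have haN : ∀ i, a i ∈ N := fun i => by rw [← hb.range_endpoint]; exact ⟨i, rfl⟩
  refine ⟨⟨fun i => h.toHomeo (a (i.cast hl)), fun i =>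
    ((T (i.cast hl)).map h.toHomeo.continuous).cast h.map_base.symm rfl, ?_, ?_⟩, ?_⟩
  · constructor
    · intro i j hij
      have := hb.endpoint_injective (h.toHomeo.injective hij)
      simpa using this
    · ext z
      constructor
      · rintro ⟨i, rfl⟩
        exact (h.mem_iff _).1 (haN _)
      · intro hz
        have h1 : h.toHomeo.symm z ∈ N := by rwa [h.mem_iff, Homeomorph.apply_symm_apply]
        obtain ⟨i, hi⟩ := hb.range_endpoint.superset h1
        exact ⟨i.cast hl.symm, by simp [hi]⟩
    · intro i
      exact h.toHomeo.injective.comp (hb.simple _)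
    · intro i t
      exact (h.disc _).1 (hb.mem_disc _ t)
    · intro i t ht
      exact congrArg h.toHomeo (hb.eq_endpoint _ t ((h.mem_iff _).2 ht))
    · intro i j hij s t hst
      have h1 : i.cast hl ≠ j.cast hl := fun h => hij (by simpa using h)
      have := hb.disjoint _ _ h1 s t (h.toHomeo.injective hst)
      exact (congrArg h.toHomeo this).trans h.map_base
  · intro i
    have h1 : (δ.map h.push).get i = h.push (δ.get (i.cast hl)) := by simp
    rw [h1]
    exact h.push_isLoopAlong (haN _) (hb.simple _) (hb.eq_endpoint _) (hT _) fun t => rfl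
  · have hcirc : ∀ t : I, c' + turn t * ((u' : ℂ) - c') ∉ N' := by
      intro t
      rw [← h.circle, ← hω t, ← h.mem_iff]
      exact (ω t).2
    let ω' : Path u' u' := ⟨⟨fun t => ⟨_, hcirc t⟩, by fun_prop⟩, by ext; simp [turn_zero],
      by ext; simp [turn_one]⟩
    refine ⟨ω', fun t => rfl, ?_⟩
    rw [← h.push_circle hω (fun t => rfl : IsCircle c' ω'), ← hprod, map_list_prod]

end DiscHomeo

/-! ### Small circles approached from the lower half plane -/

section RealPoints

open scoped unitInterval Topology

variable {n : ℕ} {p : Fin n → ℝ}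

/-- A small circle around the point `p k`, reached from the lower half plane. -/
lemma lasso_circle_eq_ptLoop_of_im_nonpos (hp : StrictMono p) {u v : Punctured (realPts p)}
    (hu : ∀ b, (u : ℂ) ∈ chart p b) (hv : (v : ℂ) ∈ chart p true) {k : Fin n} {r : ℝ}
    (hk : ∀ j, j ≠ k → r < |p j - p k|) (hvr : (v : ℂ) ∈ ball (p k : ℂ) r) (him : (v : ℂ).im ≤ 0)
    {ω : Path v v} (hω : IsCircle (p k) ω) :
    lasso (chartCls true (hu _) hv) (FundamentalGroup.fromPath (.mk ω)) = ptLoop hu k := by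
  have hr : 0 < r := pos_of_mem_ball hvr
  have hiso : ball (p k : ℂ) r ∩ realPts p ⊆ {(p k : ℂ)} := by
    rintro _ ⟨h1, ⟨j, rfl⟩⟩
    by_contra hne
    have hj : j ≠ k := fun h => hne (by simp [h])
    have h2 := hk j hj
    rw [mem_ball, Complex.dist_of_im_eq (by simp), Real.dist_eq] at h1
    simp only [Complex.ofReal_re] at h1
    linarith
  -- The closed lower half of the disc without its centre is star-shaped about `m`, so `v` can be
  -- joined in it to a point of the real line to the right of `p k`.
  let E : Set ℂ := {z | z ∈ ball (p k : ℂ) r ∧ z.im ≤ 0 ∧ z ≠ p k}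
  let m : ℂ := p k - (r / 2 : ℝ) * Complex.I
  have hm : m ∈ E := by
    refine ⟨?_, by simp [m]; linarith, ?_⟩
    · rw [mem_ball, dist_eq_norm]
      simp only [m, sub_sub_cancel_left, norm_neg, norm_mul, Complex.norm_I, Complex.norm_real]
      rw [Real.norm_of_nonneg (by linarith)]
      linarith
    · intro h
      have := congrArg Complex.im h
      simp [m] at this
      exact hr.ne' this
  have hE : StarConvex ℝ m E := by
    rw [starConvex_iff_forall_pos hm]
    intro z hz a b ha hb hab
    refine ⟨(convex_ball (p k : ℂ) r) hm.1 hz.1 ha.le hb.le hab, ?_, ?_⟩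
    · have : (a • m + b • z).im = a * m.im + b * z.im := by simp
      rw [this]
      nlinarith [hm.2.1, hz.2.1]
    · intro h
      have := congrArg Complex.im h
      have h2 : (a • m + b • z).im = a * m.im + b * z.im := by simp
      rw [h2, Complex.ofReal_im] at this
      have h3 : m.im = -(r / 2) := by simp [m]
      rw [h3] at this
      nlinarith [hz.2.1, mul_pos ha hr]
  have hEN : ∀ z ∈ E, z ∉ realPts p := fun z hz hzN => hz.2.2 (hiso ⟨hz.1, hzN⟩)
  have hr2 : (p k : ℂ) + (r / 2 : ℝ) ∈ E := by
    refine ⟨?_, by simp, ?_⟩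
    · rw [mem_ball, dist_eq_norm, add_sub_cancel_left, Complex.norm_real,
        Real.norm_of_nonneg (by linarith)]
      linarith
    · intro h
      have := congrArg Complex.re h
      simp at this
      exact hr.ne' this
  let e : Punctured (realPts p) := ⟨p k + (r / 2 : ℝ), hEN _ hr2⟩
  have he : (e : ℂ) ∈ chart p true := mem_chart_true_of_im_nonpos e.2 hr2.2.1
  obtain ⟨γ, hγ⟩ := exists_path_of_isPathConnected (hE.isPathConnected hm) hEN
    (x := v) (y := e) ⟨hvr, him, fun h => v.2 (h ▸ ⟨k, rfl⟩)⟩ hr2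
  have hc := rotate_notMem hiso hr2.1 e.2
  have h1 := lasso_circle hiso hω (isCircle_circlePath (p k : ℂ) e hc) (r := γ) fun t => (hγ t).1
  rw [← h1, ← lasso_trans, mk_eq_chartCls (fun t => mem_chart_true_of_im_nonpos (γ t).2
    (hγ t).2.1) hv he, chartCls_trans]
  refine lasso_circle_eq_ptLoop hp hu he (r := r / 2) (by linarith)
    (fun j hj => by linarith [hk j hj]) (by simp [e]) (isCircle_circlePath _ _ _)

end RealPoints

/-! ### The standard geometric base -/

section Standard

open scoped unitInterval Topology

variable (n : ℕ)

/-- The distance of neighbouring standard points. -/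
def gap : ℝ := 1 / (n + 2)

/-- The standard points, equally spaced in the interval from `0` to `1`. -/
def stdPt (k : Fin n) : ℝ := (k + 1) * gap n

lemma gap_pos : 0 < gap n := by unfold gap; positivity

lemma gap_mul : (n + 2) * gap n = 1 := by unfold gap; field_simp

lemma gap_le : gap n ≤ 1 / 2 := by
  unfold gap
  apply one_div_le_one_div_of_le <;> linarith [Nat.cast_nonneg (α := ℝ) n]

lemma stdPt_strictMono : StrictMono (stdPt n) := by
  intro i j hij
  have h : (i : ℝ) < j := by exact_mod_cast hij
  exact mul_lt_mul_of_pos_right (by linarith) (gap_pos n)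

lemma stdPt_pos (k : Fin n) : 0 < stdPt n k := by
  have := gap_pos n
  unfold stdPt
  positivity

lemma stdPt_le (k : Fin n) : stdPt n k + gap n * 2 ≤ 1 + gap n := by
  have h : (k : ℝ) + 1 ≤ n := by exact_mod_cast k.2
  have h1 := gap_mul n
  have h2 := gap_pos n
  unfold stdPt
  nlinarith

lemma gap_le_abs_sub {j k : Fin n} (h : j ≠ k) : gap n ≤ |stdPt n j - stdPt n k| := by
  have h1 : stdPt n j - stdPt n k = ((j : ℤ) - (k : ℤ) : ℤ) * gap n := by
    unfold stdPt; push_cast; ring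
  have h2 : (1 : ℝ) ≤ |(((j : ℤ) - (k : ℤ) : ℤ) : ℝ)| := by
    rw [← Int.cast_abs]
    have : (j : ℤ) - (k : ℤ) ≠ 0 := by
      intro h'
      apply h
      ext
      omega
    exact_mod_cast Int.one_le_abs this
  rw [h1, abs_mul, abs_of_pos (gap_pos n)]
  nlinarith [gap_pos n]

/-- The base point `-i` on the unit circle. -/
def stdBase : Punctured (realPts (stdPt n)) :=
  ⟨-Complex.I, by
    rintro ⟨k, hk⟩
    have := congrArg Complex.im hk
    simp at this⟩

lemma stdBase_mem_chart (b : Bool) : (stdBase n : ℂ) ∈ chart (stdPt n) b :=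
  mem_chart_of_re_ne (fun k => by simpa [stdBase] using (stdPt_pos n k).ne) b

lemma stripIdx_stdBase : stripIdx (stdPt n) (stdBase n) = 0 :=
  stripIdx_eq_of (Nat.zero_le _) fun k => by
    simpa [stdBase] using (stdPt_pos n k).le

/-- The standard geometric base. -/
def stdGens : List (FundamentalGroup (Punctured (realPts (stdPt n))) (stdBase n)) :=
  (List.range n).map (ptLoop (stdBase_mem_chart n))

lemma norm_ne_one_of_mem {z : ℂ} (hz : ‖z‖ = 1) : z ∉ realPts (stdPt n) := by
  rintro ⟨k, rfl⟩
  simp only [Complex.norm_real] at hz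
  rw [Real.norm_of_nonneg (stdPt_pos n k).le] at hz
  linarith [stdPt_le n k, gap_pos n]

lemma norm_stdBase_rotate (t τ : ℝ) : ‖turn t * (-Complex.I * turn τ)‖ = 1 := by
  simp [norm_turn]

lemma turn_quarter : turn (1 / 4) = Complex.I := by
  apply Complex.ext
  · rw [turn_re, Complex.I_re, show 2 * Real.pi * (1 / 4) = Real.pi / 2 by ring, Real.cos_pi_div_two]
  · rw [turn_im, Complex.I_im, show 2 * Real.pi * (1 / 4) = Real.pi / 2 by ring, Real.sin_pi_div_two]

/-- Sliding the base point of the unit circle along the quarter arc from `-i` to `1`, which stays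
below the points, turns the circle into the one of `lasso_circle_eq`: its two crossings of the real
line are in the strips `n` and `0`. -/
lemma stdGens_prod {ω : Path (stdBase n) (stdBase n)} (hω : IsCircle 0 ω) :
    (stdGens n).prod = FundamentalGroup.fromPath (.mk ω) := by
  have hp := stdPt_strictMono n
  have hu := stdBase_mem_chart n
  rw [stdGens, prod_ptLoop hp hu (stripIdx_stdBase n)]
  have hlt : ∀ k, stdPt n k < 1 := fun k => by linarith [stdPt_le n k, gap_pos n]
  have hnot : ∀ t τ : ℝ, turn t * (-Complex.I * turn τ) ∉ realPts (stdPt n) := fun t τ =>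
    norm_ne_one_of_mem n (norm_stdBase_rotate t τ)
  let e : Punctured (realPts (stdPt n)) := ⟨1, norm_ne_one_of_mem n (by simp)⟩
  let w : Punctured (realPts (stdPt n)) := ⟨-1, norm_ne_one_of_mem n (by simp)⟩
  have he : ∀ b, (e : ℂ) ∈ chart (stdPt n) b := mem_chart_of_re_ne fun k => by
    simpa [e] using (hlt k).ne'
  have hw : ∀ b, (w : ℂ) ∈ chart (stdPt n) b := mem_chart_of_re_ne fun k => by
    simp only [w, Complex.neg_re, Complex.one_re]
    exact (by linarith [stdPt_pos n k] : -1 < stdPt n k).ne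
  have hq : -Complex.I * turn (1 / 4) = 1 := by rw [turn_quarter]; simp
  let r : Path (stdBase n) e :=
    ⟨⟨fun τ => ⟨turn 0 * (-Complex.I * turn (τ / 4)), hnot _ _⟩, by fun_prop⟩,
      by ext; simp [turn_zero, stdBase], by ext; simpa [turn_zero, e] using hq⟩
  let ω' : Path e e :=
    ⟨⟨fun t => ⟨turn t * (-Complex.I * turn (1 / 4)), hnot _ _⟩, by fun_prop⟩,
      by ext; simpa [turn_zero, e] using hq, by ext; simpa [turn_one, e] using hq⟩
  have hr : ∀ τ, (r τ : ℂ) ∈ chart (stdPt n) true := fun τ => by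
    refine mem_chart_true_of_im_nonpos (r τ).2 ?_
    have h1 : (r τ : ℂ).im = - Real.cos (2 * Real.pi * (τ / 4)) := by
      simp [r, turn_zero, turn_re]
    rw [h1, neg_nonpos]
    have h2 := τ.2.1
    have h3 := τ.2.2
    have h4 := Real.pi_pos
    apply Real.cos_nonneg_of_neg_pi_div_two_le_of_le <;> nlinarith
  have h1 := lasso_of_square (X := Punctured (realPts (stdPt n)))
    (H := fun q : I × I => ⟨turn q.1 * (-Complex.I * turn (q.2 / 4)), hnot _ _⟩) (by fun_prop)
    (w := ω) (w' := ω') (r := r) (fun t => Subtype.ext (by rw [hω t]; simp [turn_zero, stdBase]))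
    (fun t => by ext; simp [r]) (fun t => by ext; simp [r, turn_one, turn_zero])
    (fun t => by ext; simp [ω'])
  rw [← h1, mk_eq_chartCls hr (hu _) (he _), lasso_circle_eq hu he hw (a := 0) (r := 1)
    one_pos (by simp [e]) (by simp [w]) (fun t => by
      change turn t * (-Complex.I * turn (1 / 4)) = _
      rw [hq]; simp [e]),
    aroundLoop_eq_stripLoop hp, aroundLoop_eq_stripLoop hp,
    stripIdx_eq_of (z := w) (Nat.zero_le _) (fun k => by
      simp only [w, Complex.neg_re, Complex.one_re, not_lt_zero, iff_false, not_lt]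
      linarith [stdPt_pos n k]),
    stripIdx_eq_of (z := e) le_rfl (fun k => by simpa [e] using hlt k)]
  have h2 := stripLoop_stripIdx_self hp hu
  rw [stripIdx_stdBase] at h2
  rw [h2, inv_one, one_mul]

/-- The segment from the base point to a standard point. -/
def stdSegment (k : Fin n) : Path (stdBase n : ℂ) (stdPt n k : ℂ) where
  toFun t := -Complex.I + (t : ℝ) * (stdPt n k + Complex.I)
  continuous_toFun := by fun_prop
  source' := by simp [stdBase]
  target' := by simp

lemma stdSegment_apply (k : Fin n) (t : I) :
    stdSegment n k t = -Complex.I + (t : ℝ) * (stdPt n k + Complex.I) := rfl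

lemma stdSegment_re (k : Fin n) (t : I) : (stdSegment n k t).re = t * stdPt n k := by
  simp [stdSegment_apply]

lemma stdSegment_im (k : Fin n) (t : I) : (stdSegment n k t).im = t - 1 := by
  simp [stdSegment_apply]
  ring

lemma dist_stdSegment (k : Fin n) (t : I) :
    dist (stdSegment n k t) (stdPt n k) ≤ (1 - t) * 2 := by
  have h : stdSegment n k t - stdPt n k = ((t - 1 : ℝ) : ℂ) * (stdPt n k + Complex.I) := by
    rw [stdSegment_apply]; push_cast; ring
  rw [dist_eq_norm, h, norm_mul, Complex.norm_real, Real.norm_eq_abs, abs_sub_comm,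
    abs_of_nonneg (by linarith [t.2.2])]
  refine mul_le_mul_of_nonneg_left ?_ (by linarith [t.2.2])
  refine (norm_add_le _ _).trans ?_
  rw [Complex.norm_I, Complex.norm_real, Real.norm_of_nonneg (stdPt_pos n k).le]
  linarith [stdPt_le n k, gap_pos n]

lemma realPts_im {z : ℂ} (hz : z ∈ realPts (stdPt n)) : z.im = 0 := by
  obtain ⟨k, rfl⟩ := hz
  simp

lemma stdSegment_mem {k : Fin n} {t : I} (h : stdSegment n k t ∈ realPts (stdPt n)) : t = 1 := by
  have := realPts_im n h
  rw [stdSegment_im] at this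
  exact Subtype.ext (by simpa [sub_eq_zero] using this)

lemma isLoopAlong_stdSegment (k : Fin n) :
    IsLoopAlong (stdSegment n k) (ptLoop (stdBase_mem_chart n) k) := by
  have hd := gap_pos n
  have hd2 := gap_le n
  -- By `dist_stdSegment` the rest of the segment is within `gap n / 2` of its end point, strictly
  -- inside the disc of radius `gap n / 4 * 3` and far from the other points.
  let s : I := ⟨1 - gap n / 4, by linarith, by linarith⟩
  have hs : (s : ℝ) = 1 - gap n / 4 := rfl
  have hiso : ball (stdPt n k : ℂ) (gap n) ∩ realPts (stdPt n) ⊆ {(stdPt n k : ℂ)} := by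
    rintro _ ⟨h1, ⟨j, rfl⟩⟩
    by_contra hne
    have hj : j ≠ k := fun h => hne (by simp [h])
    have h2 := gap_le_abs_sub n hj
    rw [mem_ball, Complex.dist_of_im_eq (by simp), Real.dist_eq] at h1
    simp only [Complex.ofReal_re] at h1
    linarith
  have hball : ∀ t, s ≤ t → stdSegment n k t ∈ ball (stdPt n k : ℂ) (gap n / 4 * 3) := by
    intro t ht
    have h1 : (s : ℝ) ≤ t := ht
    refine (dist_stdSegment n k t).trans_lt ?_
    linarith
  have hN : ∀ t : I, stdSegment n k (s * t) ∉ realPts (stdPt n) := by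
    intro t ht
    have h1 := congrArg Subtype.val (stdSegment_mem n ht)
    have h2 : (s : ℝ) * t = 1 := h1
    nlinarith [t.2.1, t.2.2]
  have hN1 := hN 1
  rw [mul_one] at hN1
  let v : Punctured (realPts (stdPt n)) := ⟨stdSegment n k s, hN1⟩
  let q : Path (stdBase n) v := ⟨⟨fun t => ⟨stdSegment n k (s * t), hN t⟩, by fun_prop⟩,
    by ext; simp, by ext; simp [v]⟩
  have hv := hball s le_rfl
  have him : ∀ t, (q t : ℂ).im ≤ 0 := by
    intro t
    change (stdSegment n k (s * t)).im ≤ 0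
    rw [stdSegment_im]
    linarith [(s * t).2.2]
  have hqc : ∀ t, (q t : ℂ) ∈ chart (stdPt n) true := fun t =>
    mem_chart_true_of_im_nonpos (q t).2 (him t)
  have hvc : (v : ℂ) ∈ chart (stdPt n) true := by simpa using hqc 1
  have hvim : (v : ℂ).im ≤ 0 := by simpa using him 1
  refine ⟨s, gap n, hiso, fun t ht => ball_subset_ball (by linarith) (hball t ht), v, q,
    circlePath _ v (rotate_notMem hiso (ball_subset_ball (by linarith) hv) hN1), fun t => rfl,
    isCircle_circlePath _ _ _, ?_⟩
  rw [← lasso_mk, mk_eq_chartCls hqc (stdBase_mem_chart n _) hvc]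
  exact (lasso_circle_eq_ptLoop_of_im_nonpos (stdPt_strictMono n) (stdBase_mem_chart n) hvc
    (fun j hj => by linarith [gap_le_abs_sub n hj]) hv hvim (isCircle_circlePath _ _ _)).symm

lemma stdGens_length : (stdGens n).length = n := by simp [stdGens]

lemma isGeometricBase_stdGens : IsGeometricBase 0 1 (stdBase n) (stdGens n) := by
  have hl := stdGens_length n
  refine ⟨⟨fun i => stdPt n (i.cast hl), fun i => stdSegment n (i.cast hl), ⟨?_, ?_, ?_, ?_, ?_, ?_⟩,
    fun i => ?_⟩, circlePath 0 (stdBase n) fun t => norm_ne_one_of_mem n ?_,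
    isCircle_circlePath _ _ _, stdGens_prod n (isCircle_circlePath _ _ _)⟩
  · intro i j hij
    simpa using (stdPt_strictMono n).injective (Complex.ofReal_injective hij)
  · ext z
    constructor
    · rintro ⟨i, rfl⟩
      exact ⟨_, rfl⟩
    · rintro ⟨k, rfl⟩
      exact ⟨k.cast hl.symm, by simp⟩
  · intro i s t hst
    have := congrArg Complex.im hst
    rw [stdSegment_im, stdSegment_im] at this
    exact Subtype.ext (by linarith)
  · intro i t
    have h1 : ∀ z : ℂ, z ∈ closedBall (0 : ℂ) 1 ↔ ‖z‖ ≤ 1 := fun z => mem_closedBall_zero_iff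
    have h2 : stdSegment n (i.cast hl) t =
        (1 - t : ℝ) • (-Complex.I) + (t : ℝ) • (stdPt n (i.cast hl) : ℂ) := by
      rw [stdSegment_apply, Complex.real_smul, Complex.real_smul]; push_cast; ring
    rw [h2]
    refine convex_closedBall (0 : ℂ) 1 ?_ ?_ (by linarith [t.2.2]) t.2.1 (by ring)
    · rw [h1]; simp
    · rw [h1, Complex.norm_real, Real.norm_of_nonneg (stdPt_pos n _).le]
      linarith [stdPt_le n (i.cast hl), gap_pos n]
  · intro i t ht
    rw [stdSegment_mem n ht, Path.target]
  · intro i j hij s t hst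
    have h1 := congrArg Complex.im hst
    have h2 := congrArg Complex.re hst
    rw [stdSegment_im, stdSegment_im] at h1
    have h3 : s = t := Subtype.ext (by linarith)
    subst h3
    rw [stdSegment_re, stdSegment_re] at h2
    have h4 : stdPt n (i.cast hl) ≠ stdPt n (j.cast hl) := fun h => hij (by
      simpa using (stdPt_strictMono n).injective h)
    have h5 : (s : ℝ) = 0 := by
      by_contra h
      exact h4 (mul_left_cancel₀ h h2)
    have h6 : s = 0 := Subtype.ext h5
    rw [h6, Path.source]
  · have h1 : (stdGens n).get i = ptLoop (stdBase_mem_chart n) (i.cast hl) := by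
      change (List.map _ (List.range n))[(i : ℕ)] = _
      rw [List.getElem_map, List.getElem_range]
      rfl
    rw [h1]
    exact isLoopAlong_stdSegment n _
  · simp [norm_turn, stdBase]

end Standard

/-! ### Half twists of the disc -/

section Twist

open scoped unitInterval Topology

lemma turn_neg_half : turn (-(1 / 2)) = -1 := by
  have h := turn_add (1 / 2) (-(1 / 2))
  rw [add_neg_cancel, turn_zero, turn_half] at h
  linear_combination h

/-- The points at distance `ρ` from `m` are turned around `m` by the angle `2πθ(ρ)`. -/
def twist (m : ℂ) (θ : ℝ → ℝ) (z : ℂ) : ℂ := m + turn (θ ‖z - m‖) * (z - m)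

lemma norm_twist_sub (m : ℂ) (θ : ℝ → ℝ) (z : ℂ) : ‖twist m θ z - m‖ = ‖z - m‖ := by
  rw [twist, add_sub_cancel_left, norm_mul, norm_turn, one_mul]

lemma twist_neg_twist (m : ℂ) (θ : ℝ → ℝ) (z : ℂ) : twist m (-θ) (twist m θ z) = z := by
  have h := norm_twist_sub m θ z
  rw [twist, h, twist, Pi.neg_apply, add_sub_cancel_left, ← mul_assoc, ← turn_add,
    neg_add_cancel, turn_zero]
  ring

/-- Twisting around `m` is a homeomorphism. -/
def twistHomeo (m : ℂ) (θ : ℝ → ℝ) (hθ : Continuous θ) : ℂ ≃ₜ ℂ where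
  toFun := twist m θ
  invFun := twist m (-θ)
  left_inv := twist_neg_twist m θ
  right_inv z := by simpa using twist_neg_twist m (-θ) z
  continuous_toFun := by unfold twist; fun_prop
  continuous_invFun := by unfold twist; fun_prop

variable (n : ℕ)

/-- The angle of the half twist. -/
def halfAngle (ρ : ℝ) : ℝ := max 0 (min (1 / 2) (2 * (gap n - ρ) / gap n))

lemma continuous_halfAngle : Continuous (halfAngle n) := by
  unfold halfAngle
  fun_prop

/-- The exchanged points lie at distance `gap n / 2` from the midpoint. The larger radius makes the
twist a rigid half turn on a neighbourhood of them, as `DiscHomeo.similar` needs. -/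
lemma halfAngle_of_le {ρ : ℝ} (h : ρ ≤ 3 / 4 * gap n) : halfAngle n ρ = 1 / 2 := by
  have h1 : 1 / 2 ≤ 2 * (gap n - ρ) / gap n := by
    rw [le_div_iff₀ (gap_pos n)]
    linarith
  rw [halfAngle, min_eq_left h1, max_eq_right (by norm_num)]

lemma halfAngle_of_ge {ρ : ℝ} (h : gap n ≤ ρ) : halfAngle n ρ = 0 := by
  have h1 : 2 * (gap n - ρ) / gap n ≤ 0 :=
    div_nonpos_of_nonpos_of_nonneg (by linarith) (gap_pos n).le
  rw [halfAngle, min_eq_right (by linarith), max_eq_left h1]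

lemma halfAngle_nonneg (ρ : ℝ) : 0 ≤ halfAngle n ρ := le_max_left _ _

lemma halfAngle_le (ρ : ℝ) : halfAngle n ρ ≤ 1 / 2 :=
  max_le (by norm_num) (min_le_left _ _)

variable {n} {k : ℕ}

/-- The midpoint between neighbouring standard points. -/
def midPt (n k : ℕ) : ℝ := (k + 1 + 1 / 2) * gap n

lemma twist_of_ge {θ : ℝ → ℝ} (h0 : ∀ ρ, gap n ≤ ρ → θ ρ = 0) {m z : ℂ} (h : gap n ≤ ‖z - m‖) :
    twist m θ z = z := by
  rw [twist, h0 _ h, turn_zero]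
  ring

lemma twist_of_le {θ : ℝ → ℝ} (h1 : ∀ ρ, ρ ≤ 3 / 4 * gap n → turn (θ ρ) = -1) {m z : ℂ}
    (h : ‖z - m‖ ≤ 3 / 4 * gap n) : twist m θ z = 2 * m - z := by
  rw [twist, h1 _ h]
  ring

lemma norm_stdPt_sub_midPt (j : Fin n) :
    ‖(stdPt n j : ℂ) - midPt n k‖ = |(j : ℝ) - k - 1 / 2| * gap n := by
  rw [← Complex.ofReal_sub, Complex.norm_real, Real.norm_eq_abs, ← abs_of_pos (gap_pos n),
    ← abs_mul, stdPt, midPt]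
  congr 1
  ring

lemma far_or {j : ℕ} (h : j ≠ k) (h' : j ≠ k + 1) : (3 : ℝ) / 2 ≤ |(j : ℝ) - k - 1 / 2| := by
  rcases lt_or_gt_of_ne h with h1 | h1
  · have : (j : ℝ) + 1 ≤ k := by exact_mod_cast h1
    rw [abs_of_nonpos (by linarith)]
    linarith
  · have : (k : ℝ) + 2 ≤ j := by exact_mod_cast (by omega : k + 2 ≤ j)
    rw [abs_of_nonneg (by linarith)]
    linarith

lemma gap_le_norm_stdPt_sub {j : Fin n} (h : (j : ℕ) ≠ k) (h' : (j : ℕ) ≠ k + 1) :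
    3 / 2 * gap n ≤ ‖(stdPt n j : ℂ) - midPt n k‖ := by
  rw [norm_stdPt_sub_midPt]
  exact mul_le_mul_of_nonneg_right (far_or h h') (gap_pos n).le

lemma two_mul_midPt_sub (hk : k + 1 < n) :
    2 * (midPt n k : ℂ) - stdPt n ⟨k, Nat.lt_of_succ_lt hk⟩ = stdPt n ⟨k + 1, hk⟩ := by
  rw [midPt, stdPt, stdPt]
  push_cast
  ring

lemma norm_stdPt_sub_left (hk : k + 1 < n) :
    ‖(stdPt n ⟨k, Nat.lt_of_succ_lt hk⟩ : ℂ) - midPt n k‖ = 1 / 2 * gap n := by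
  rw [norm_stdPt_sub_midPt]
  norm_num

lemma norm_stdPt_sub_right (hk : k + 1 < n) :
    ‖(stdPt n ⟨k + 1, hk⟩ : ℂ) - midPt n k‖ = 1 / 2 * gap n := by
  rw [norm_stdPt_sub_midPt]
  push_cast
  rw [show (k : ℝ) + 1 - k - 1 / 2 = 1 / 2 by ring, abs_of_pos (by norm_num)]


/-- A general angle function is allowed so that the half twist and its inverse are both covered. -/
lemma twist_mem_realPts {θ : ℝ → ℝ} (h0 : ∀ ρ, gap n ≤ ρ → θ ρ = 0)
    (h1 : ∀ ρ, ρ ≤ 3 / 4 * gap n → turn (θ ρ) = -1) (hk : k + 1 < n) {z : ℂ}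
    (hz : z ∈ realPts (stdPt n)) : twist (midPt n k) θ z ∈ realPts (stdPt n) := by
  have hd := gap_pos n
  obtain ⟨j, rfl⟩ := hz
  have e := two_mul_midPt_sub hk
  by_cases hj : (j : ℕ) = k
  · have hj' : j = ⟨k, Nat.lt_of_succ_lt hk⟩ := Fin.ext hj
    subst hj'
    rw [twist_of_le h1 (by rw [norm_stdPt_sub_left hk]; linarith), e]
    exact ⟨_, rfl⟩
  by_cases hj' : (j : ℕ) = k + 1
  · have hj' : j = ⟨k + 1, hk⟩ := Fin.ext hj'
    subst hj'
    rw [twist_of_le h1 (by rw [norm_stdPt_sub_right hk]; linarith)]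
    exact ⟨⟨k, Nat.lt_of_succ_lt hk⟩, by simp only [← e]; ring⟩
  · rw [twist_of_ge h0 ((by linarith : gap n ≤ 3 / 2 * gap n).trans (gap_le_norm_stdPt_sub hj hj'))]
    exact ⟨_, rfl⟩

lemma midPt_pos : 0 < midPt n k := by
  have := gap_pos n
  unfold midPt
  positivity

/-- The disc that is moved by the half twist stays inside the unit disc, so the unit circle is
fixed. -/
lemma midPt_add_gap_le (hk : k + 1 < n) : midPt n k + gap n ≤ 1 := by
  have h1 := stdPt_le n ⟨k + 1, hk⟩
  have h2 := gap_pos n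
  rw [midPt]
  rw [stdPt] at h1
  push_cast at h1
  linarith

lemma gap_le_norm_sub_midPt (hk : k + 1 < n) {z : ℂ} (hz : 1 ≤ ‖z‖) :
    gap n ≤ ‖z - midPt n k‖ := by
  have h1 := norm_sub_norm_le z (midPt n k : ℂ)
  rw [Complex.norm_real, Real.norm_of_nonneg midPt_pos.le] at h1
  linarith [midPt_add_gap_le hk]

lemma turn_halfAngle (ρ : ℝ) (h : ρ ≤ 3 / 4 * gap n) : turn (halfAngle n ρ) = -1 := by
  rw [halfAngle_of_le n h, turn_half]

/-- The positive half twist that exchanges two neighbouring standard points. -/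
def halfTwistHomeo (hk : k + 1 < n) : DiscHomeo 0 1 (stdBase n) 0 1 (stdBase n) where
  toHomeo := twistHomeo (midPt n k) (halfAngle n) (continuous_halfAngle n)
  circle t := twist_of_ge (fun _ => halfAngle_of_ge n)
    (gap_le_norm_sub_midPt hk (by simp [norm_turn, stdBase]))
  disc z := by
    change _ ↔ twist _ _ z ∈ _
    rw [mem_closedBall_zero_iff, mem_closedBall_zero_iff]
    rcases le_or_gt (gap n) ‖z - midPt n k‖ with h | h
    · rw [twist_of_ge (fun _ => halfAngle_of_ge n) h]
    · have h2 : ‖twist (midPt n k) (halfAngle n) z - midPt n k‖ < gap n := by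
        rwa [norm_twist_sub]
      have key : ∀ w : ℂ, ‖w - midPt n k‖ < gap n → ‖w‖ ≤ 1 := by
        intro w hw
        have h3 := norm_sub_norm_le w (midPt n k : ℂ)
        rw [Complex.norm_real, Real.norm_of_nonneg midPt_pos.le] at h3
        linarith [midPt_add_gap_le hk]
      exact ⟨fun _ => key _ h2, fun _ => key _ h⟩
  mem_iff z := by
    refine ⟨twist_mem_realPts (fun _ => halfAngle_of_ge n) turn_halfAngle hk, fun h => ?_⟩
    rw [← twist_neg_twist (midPt n k) (halfAngle n) z]
    refine twist_mem_realPts (fun ρ h => ?_) (fun ρ h => ?_) hk h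
    · simp [halfAngle_of_ge n h]
    · rw [Pi.neg_apply, halfAngle_of_le n h, turn_neg_half]
  similar a ha := by
    have hd := gap_pos n
    change ∃ α : ℂ, α ≠ 0 ∧ ∃ r > 0, ∀ z ∈ ball a r, twist _ _ z = twist _ _ a + α * (z - a)
    -- No puncture lies in the annulus where the angle varies: the distance to the midpoint is `gap
    -- n / 2` or at least `3 / 2 * gap n`. So the map is a half turn or the identity near `a`.
    rcases le_or_gt ‖a - midPt n k‖ (gap n) with h | h
    · have h' : ‖a - midPt n k‖ = 1 / 2 * gap n := by
        obtain ⟨j, rfl⟩ := ha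
        by_cases hj : (j : ℕ) = k
        · have hj' : j = ⟨k, Nat.lt_of_succ_lt hk⟩ := Fin.ext hj
          subst hj'
          exact norm_stdPt_sub_left hk
        by_cases hj' : (j : ℕ) = k + 1
        · have hj' : j = ⟨k + 1, hk⟩ := Fin.ext hj'
          subst hj'
          exact norm_stdPt_sub_right hk
        · have := gap_le_norm_stdPt_sub hj hj'
          simp only at h
          linarith
      refine ⟨-1, by simp, gap n / 4, by linarith, fun z hz => ?_⟩
      rw [mem_ball, dist_eq_norm] at hz
      have h2 : ‖z - midPt n k‖ ≤ 3 / 4 * gap n := by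
        have := norm_add_le (z - a) (a - midPt n k)
        rw [sub_add_sub_cancel] at this
        linarith
      rw [twist_of_le turn_halfAngle h2, twist_of_le turn_halfAngle (by linarith)]
      ring
    · refine ⟨1, by simp, ‖a - midPt n k‖ - gap n, by linarith, fun z hz => ?_⟩
      rw [mem_ball, dist_eq_norm] at hz
      have h2 : gap n ≤ ‖z - midPt n k‖ := by
        have := norm_sub_norm_le (a - midPt n k) (a - z)
        rw [sub_sub_sub_cancel_left, norm_sub_rev a z] at this
        linarith
      rw [twist_of_ge (fun _ => halfAngle_of_ge n) h2,
        twist_of_ge (fun _ => halfAngle_of_ge n) h.le]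
      ring

lemma exists_path_of_joinedIn {N E : Set ℂ} (hEN : ∀ z ∈ E, z ∉ N) {x y : Punctured N}
    (h : JoinedIn E (x : ℂ) y) : ∃ p : Path x y, ∀ t, (p t : ℂ) ∈ E := by
  obtain ⟨γ, hγ⟩ := h
  exact ⟨⟨⟨fun t => ⟨γ t, hEN _ (hγ t)⟩, by fun_prop⟩, by ext; simp, by ext; simp⟩, hγ⟩

/-- A loop around a point is recognized as `ptLoop` once its tail stays in the closed lower half
plane. It therefore suffices to have one path to `v` which lies there together with its image under
`h`. -/
lemma push_ptLoop (h : DiscHomeo 0 1 (stdBase n) 0 1 (stdBase n)) {j j' : Fin n} {v : ℂ}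
    (hv : v ∈ ball (stdPt n j : ℂ) (gap n / 2))
    (hv' : h.toHomeo v ∈ ball (stdPt n j' : ℂ) (gap n / 2))
    (hJ : JoinedIn {z | z ∉ realPts (stdPt n) ∧ z.im ≤ 0 ∧ (h.toHomeo z).im ≤ 0} (stdBase n) v)
    (hcirc : ∀ t : ℝ, h.toHomeo (stdPt n j + turn t * (v - stdPt n j)) =
      stdPt n j' + turn t * (h.toHomeo v - stdPt n j')) :
    h.push (ptLoop (stdBase_mem_chart n) j) = ptLoop (stdBase_mem_chart n) j' := by
  have hd := gap_pos n
  have hiso : ∀ i : Fin n, ball (stdPt n i : ℂ) (gap n / 2) ∩ realPts (stdPt n) ⊆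
      {(stdPt n i : ℂ)} := by
    rintro i _ ⟨h1, ⟨j, rfl⟩⟩
    by_contra hne
    have hj : j ≠ i := fun h => hne (by simp [h])
    have h2 := gap_le_abs_sub n hj
    rw [mem_ball, Complex.dist_of_im_eq (by simp), Real.dist_eq] at h1
    simp only [Complex.ofReal_re] at h1
    linarith
  let v₀ : Punctured (realPts (stdPt n)) := ⟨v, hJ.target_mem.1⟩
  have hNv : h.toHomeo v ∉ realPts (stdPt n) := fun hh => hJ.target_mem.1 ((h.mem_iff _).2 hh)
  let v₁ : Punctured (realPts (stdPt n)) := ⟨h.toHomeo v, hNv⟩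
  obtain ⟨q, hq⟩ := exists_path_of_joinedIn (x := stdBase n) (y := v₀) (fun z hz => hz.1) hJ
  let q' : Path (stdBase n) v₁ := (q.map h.toMap.continuous).cast h.toMap_base.symm rfl
  have hq1 : ∀ t, (q t : ℂ) ∈ chart (stdPt n) true := fun t =>
    mem_chart_true_of_im_nonpos (q t).2 (hq t).2.1
  have hq2 : ∀ t, (q' t : ℂ) ∈ chart (stdPt n) true := fun t =>
    mem_chart_true_of_im_nonpos (q' t).2 (hq t).2.2
  have hv0 : (v₀ : ℂ) ∈ chart (stdPt n) true := by simpa using hq1 1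
  have hv1 : (v₁ : ℂ) ∈ chart (stdPt n) true := by simpa using hq2 1
  have hk : ∀ i j' : Fin n, j' ≠ i → gap n / 2 < |stdPt n j' - stdPt n i| := fun i j' hj => by
    linarith [gap_le_abs_sub n hj]
  have hc := rotate_notMem (hiso j) hv v₀.2
  have hc' := rotate_notMem (hiso j') hv' v₁.2
  rw [← lasso_circle_eq_ptLoop_of_im_nonpos (stdPt_strictMono n) (stdBase_mem_chart n) hv0
    (hk j) hv hJ.target_mem.2.1 (isCircle_circlePath (stdPt n j : ℂ) v₀ hc),
    ← lasso_circle_eq_ptLoop_of_im_nonpos (stdPt_strictMono n) (stdBase_mem_chart n) hv1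
    (hk j') hv' hJ.target_mem.2.2 (isCircle_circlePath (stdPt n j' : ℂ) v₁ hc'),
    ← mk_eq_chartCls hq1, ← mk_eq_chartCls hq2]
  exact h.push_lasso (fun t => rfl) fun t => (hcirc t).symm

lemma halfTwistHomeo_of_ge (hk : k + 1 < n) {z : ℂ} (h : gap n ≤ ‖z - midPt n k‖) :
    (halfTwistHomeo hk).toHomeo z = z := twist_of_ge (fun _ => halfAngle_of_ge n) h

lemma halfTwistHomeo_of_le (hk : k + 1 < n) {z : ℂ} (h : ‖z - midPt n k‖ ≤ 3 / 4 * gap n) :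
    (halfTwistHomeo hk).toHomeo z = 2 * midPt n k - z := twist_of_le turn_halfAngle h

lemma joinedIn_of_fixed (hk : k + 1 < n) {x y : ℂ}
    (h : ∀ t : ℝ, 0 ≤ t → t ≤ 1 → x + t * (y - x) ∉ realPts (stdPt n) ∧
      (x + t * (y - x)).im ≤ 0 ∧ gap n ≤ ‖x + t * (y - x) - midPt n k‖) :
    JoinedIn {z | z ∉ realPts (stdPt n) ∧ z.im ≤ 0 ∧ ((halfTwistHomeo hk).toHomeo z).im ≤ 0}
      x y := by
  apply JoinedIn.of_segment_subset
  rw [segment_eq_image']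
  rintro _ ⟨t, ht, rfl⟩
  obtain ⟨h1, h2, h3⟩ := h t ht.1 ht.2
  simp only [Complex.real_smul, mem_ofPred_eq]
  exact ⟨h1, h2, by rwa [halfTwistHomeo_of_ge hk h3]⟩

lemma joinedIn_base (hk : k + 1 < n) (x : ℝ) :
    JoinedIn {z | z ∉ realPts (stdPt n) ∧ z.im ≤ 0 ∧ ((halfTwistHomeo hk).toHomeo z).im ≤ 0}
      (stdBase n) (x - Complex.I) := by
  refine joinedIn_of_fixed hk fun t _ _ => ?_
  have h : (stdBase n : ℂ) + t * (x - Complex.I - stdBase n) = (t * x : ℝ) - Complex.I := by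
    simp only [stdBase]; push_cast; ring
  have him : ((t * x : ℝ) - Complex.I).im = -1 := by simp
  rw [h]
  refine ⟨fun hh => ?_, by rw [him]; norm_num, gap_le_norm_sub_midPt hk ?_⟩
  · have := realPts_im n hh
    rw [him] at this
    norm_num at this
  · have := Complex.abs_im_le_norm ((t * x : ℝ) - Complex.I)
    rw [him] at this
    simpa using this

lemma gap_le_of_re {z : ℂ} (h : gap n ≤ |z.re - midPt n k|) : gap n ≤ ‖z - midPt n k‖ := by
  have := Complex.abs_re_le_norm (z - midPt n k)
  rw [Complex.sub_re, Complex.ofReal_re] at this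
  exact h.trans this

lemma push_halfTwistHomeo_of_ne (hk : k + 1 < n) {j : Fin n} (h : (j : ℕ) ≠ k)
    (h' : (j : ℕ) ≠ k + 1) :
    (halfTwistHomeo hk).push (ptLoop (stdBase_mem_chart n) j) =
      ptLoop (stdBase_mem_chart n) j := by
  have hd := gap_pos n
  have hd2 := gap_le n
  have hfar : 3 / 2 * gap n ≤ |stdPt n j - midPt n k| := by
    have := gap_le_norm_stdPt_sub h h'
    rwa [← Complex.ofReal_sub, Complex.norm_real] at this
  have hv : stdPt n j - (gap n / 4 : ℝ) * Complex.I ∈ ball (stdPt n j : ℂ) (gap n / 2) := by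
    rw [mem_ball, dist_eq_norm, sub_sub_cancel_left, norm_neg, norm_mul, Complex.norm_I,
      Complex.norm_real, Real.norm_of_nonneg (by linarith)]
    linarith
  have hfix : ∀ z ∈ ball (stdPt n j : ℂ) (gap n / 2), (halfTwistHomeo hk).toHomeo z = z := by
    intro z hz
    apply halfTwistHomeo_of_ge
    rw [mem_ball, dist_eq_norm] at hz
    have := norm_sub_norm_le ((stdPt n j : ℂ) - midPt n k) (stdPt n j - z)
    rw [sub_sub_sub_cancel_left, norm_sub_rev _ z] at this
    linarith [gap_le_norm_stdPt_sub h h']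
  refine push_ptLoop _ hv (by rwa [hfix _ hv]) ?_ fun t => ?_
  · refine (joinedIn_base hk (stdPt n j)).trans (joinedIn_of_fixed hk fun t h0 h1 => ?_)
    have e : (stdPt n j : ℂ) - Complex.I + t * (stdPt n j - (gap n / 4 : ℝ) * Complex.I -
        (stdPt n j - Complex.I)) = stdPt n j - ((1 - t) + t * (gap n / 4) : ℝ) * Complex.I := by
      push_cast; ring
    have hre : (stdPt n j - ((1 - t) + t * (gap n / 4) : ℝ) * Complex.I).re = stdPt n j := by simp
    have him : (stdPt n j - ((1 - t) + t * (gap n / 4) : ℝ) * Complex.I).im =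
      -((1 - t) + t * (gap n / 4)) := by simp
    have hpos : 0 < (1 - t) + t * (gap n / 4) := by nlinarith
    rw [e]
    refine ⟨fun hh => ?_, by rw [him]; linarith, gap_le_of_re (by rw [hre]; linarith)⟩
    have := realPts_im n hh
    rw [him] at this
    linarith
  · rw [hfix _ hv, hfix]
    rw [mem_ball, dist_rotate]
    exact hv

/-- The tail runs at height `-1` to below `m - gap n`, rises to the real line outside the twisted
disc, and continues on the real line to `m - 3 / 4 * gap n`. The twist turns this last piece, which
lies left of the centre, by an angle between `0` and `π`, hence into the closed lower half plane.
Its end goes to `m + 3 / 4 * gap n`, beside the right point. -/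
lemma push_halfTwistHomeo_left (hk : k + 1 < n) :
    (halfTwistHomeo hk).push (ptLoop (stdBase_mem_chart n) k) =
      ptLoop (stdBase_mem_chart n) (k + 1) := by
  have hd := gap_pos n
  have hd2 := gap_le n
  let m : ℝ := midPt n k
  have hpk : stdPt n ⟨k, Nat.lt_of_succ_lt hk⟩ = m - gap n / 2 := by
    simp only [stdPt, m, midPt]; ring
  have hpk' : stdPt n ⟨k + 1, hk⟩ = m + gap n / 2 := by
    simp only [stdPt, m, midPt]; push_cast; ring
  have hnot : ∀ z : ℂ, m - gap n ≤ z.re → z.re ≤ m - 3 / 4 * gap n → z ∉ realPts (stdPt n) := by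
    rintro _ h1 h2 ⟨j, rfl⟩
    simp only [Complex.ofReal_re, stdPt, m, midPt] at h1 h2
    have h3 : (k : ℝ) < j + 1 := by
      by_contra h
      have h4 : (j : ℝ) + 1 ≤ k := not_lt.1 h
      nlinarith
    have h4 : (j : ℝ) < k := by
      by_contra h
      have h4 : (k : ℝ) ≤ j := not_lt.1 h
      nlinarith
    have h3' : k < (j : ℕ) + 1 := by exact_mod_cast h3
    have h4' : (j : ℕ) < k := by exact_mod_cast h4
    omega
  have hnorm : ∀ x : ℝ, 0 ≤ x → ‖((m - x : ℝ) : ℂ) - midPt n k‖ = x := by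
    intro x hx
    rw [← Complex.ofReal_sub, Complex.norm_real, Real.norm_eq_abs]
    simp only [m]
    rw [sub_sub_cancel_left, abs_neg, abs_of_nonneg hx]
  have hσv : (halfTwistHomeo hk).toHomeo ((m - 3 / 4 * gap n : ℝ) : ℂ) =
      ((m + 3 / 4 * gap n : ℝ) : ℂ) := by
    rw [halfTwistHomeo_of_le hk (by rw [hnorm _ (by linarith)])]
    simp only [m]
    push_cast
    ring
  have hv : ((m - 3 / 4 * gap n : ℝ) : ℂ) ∈
      ball (stdPt n ⟨k, Nat.lt_of_succ_lt hk⟩ : ℂ) (gap n / 2) := by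
    rw [hpk, mem_ball, dist_eq_norm, ← Complex.ofReal_sub, Complex.norm_real, Real.norm_eq_abs,
      abs_lt]
    constructor <;> linarith
  refine push_ptLoop (j := ⟨k, Nat.lt_of_succ_lt hk⟩) (j' := ⟨k + 1, hk⟩) _ hv ?_ ?_ fun t => ?_
  · rw [hσv, hpk', mem_ball, dist_eq_norm, ← Complex.ofReal_sub, Complex.norm_real,
      Real.norm_eq_abs, abs_lt]
    constructor <;> linarith
  · refine (joinedIn_base hk (m - gap n)).trans ((joinedIn_of_fixed hk
      (y := ((m - gap n : ℝ) : ℂ)) fun t h0 h1 => ?_).trans ?_)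
    · have e : ((m - gap n : ℝ) : ℂ) - Complex.I + t * (((m - gap n : ℝ) : ℂ) -
        (((m - gap n : ℝ) : ℂ) - Complex.I)) = ((m - gap n : ℝ) : ℂ) - (1 - t : ℝ) * Complex.I := by
        push_cast; ring
      have hre : (((m - gap n : ℝ) : ℂ) - (1 - t : ℝ) * Complex.I).re = m - gap n := by simp
      have him : (((m - gap n : ℝ) : ℂ) - (1 - t : ℝ) * Complex.I).im = -(1 - t) := by simp
      rw [e]
      refine ⟨hnot _ (by rw [hre]) (by rw [hre]; linarith), by rw [him]; linarith,
        gap_le_of_re (by rw [hre]; simp only [m]; rw [sub_sub_cancel_left, abs_neg, abs_of_pos hd])⟩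
    · apply JoinedIn.of_segment_subset
      rw [segment_eq_image']
      rintro _ ⟨t, ht, rfl⟩
      have e : ((m - gap n : ℝ) : ℂ) + t • (((m - 3 / 4 * gap n : ℝ) : ℂ) - (m - gap n : ℝ)) =
          ((m - (1 - t / 4) * gap n : ℝ) : ℂ) := by
        rw [Complex.real_smul]; push_cast; ring
      simp only
      rw [e]
      have h0 := ht.1
      have h1 := ht.2
      refine ⟨hnot _ ?_ ?_, by simp, ?_⟩
      · rw [Complex.ofReal_re]; nlinarith
      · rw [Complex.ofReal_re]; nlinarith
      · change (twist _ _ _).im ≤ 0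
        have h2 : ((m - (1 - t / 4) * gap n : ℝ) : ℂ) - midPt n k =
            ((-((1 - t / 4) * gap n) : ℝ) : ℂ) := by
          simp only [m]; push_cast; ring
        rw [twist, h2, Complex.add_im, Complex.ofReal_im, Complex.im_mul_ofReal, turn_im, zero_add]
        set θ := halfAngle n ‖((-((1 - t / 4) * gap n) : ℝ) : ℂ)‖
        have h3 : 0 ≤ θ := halfAngle_nonneg n _
        have h4 : θ ≤ 1 / 2 := halfAngle_le n _
        have h5 : 0 ≤ Real.sin (2 * Real.pi * θ) := by
          apply Real.sin_nonneg_of_nonneg_of_le_pi <;> nlinarith [Real.pi_pos]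
        have h6 : 0 ≤ (1 - t / 4) * gap n := mul_nonneg (by linarith) hd.le
        nlinarith
  · have hz : ∀ z ∈ closedBall (stdPt n ⟨k, Nat.lt_of_succ_lt hk⟩ : ℂ) (gap n / 4),
        (halfTwistHomeo hk).toHomeo z = 2 * midPt n k - z := by
      intro z hz
      apply halfTwistHomeo_of_le
      rw [mem_closedBall, dist_eq_norm] at hz
      have := norm_add_le (z - stdPt n ⟨k, Nat.lt_of_succ_lt hk⟩)
        (stdPt n ⟨k, Nat.lt_of_succ_lt hk⟩ - midPt n k)
      rw [sub_add_sub_cancel, norm_stdPt_sub_left hk] at this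
      linarith
    have hv2 : ((m - 3 / 4 * gap n : ℝ) : ℂ) ∈
        closedBall (stdPt n ⟨k, Nat.lt_of_succ_lt hk⟩ : ℂ) (gap n / 4) := by
      rw [hpk, mem_closedBall, dist_eq_norm, ← Complex.ofReal_sub, Complex.norm_real,
        Real.norm_eq_abs, abs_le]
      constructor <;> linarith
    rw [hz _ hv2, hz _ (by rw [mem_closedBall, dist_rotate]; exact hv2), ← two_mul_midPt_sub hk]
    ring

end Twist

namespace DiscHomeo

variable {N : Set ℂ} {c : ℂ} {R : ℝ} {u : Punctured N}

/-- The identity. -/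
def refl (c : ℂ) (R : ℝ) (u : Punctured N) : DiscHomeo c R u c R u where
  toHomeo := Homeomorph.refl ℂ
  circle _ := rfl
  disc _ := Iff.rfl
  mem_iff _ := Iff.rfl
  similar a _ := ⟨1, one_ne_zero, 1, one_pos, fun z _ => by simp⟩

lemma push_refl (x : FundamentalGroup (Punctured N) u) : (refl c R u).push x = x := by
  induction x using Path.Homotopic.Quotient.ind with | mk γ =>
  exact push_mk _ fun t => rfl

end DiscHomeo

/-! ### Hurwitz moves and half twists -/

section HurwitzTwist

lemma range_split {n k : ℕ} (hk : k + 1 < n) :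
    List.range n = List.range k ++ k :: (k + 1) :: List.range' (k + 2) (n - k - 2) := by
  apply List.ext_getElem
  · simp; omega
  · intro i h1 h2
    rw [List.getElem_range, List.getElem_append]
    split_ifs with h
    · simp
    · simp only [List.length_range, not_lt] at h
      rcases Nat.lt_or_ge i (k + 2) with h3 | h3
      · have : i = k ∨ i = k + 1 := by omega
        rcases this with rfl | rfl <;> simp
      · obtain ⟨j, rfl⟩ := Nat.exists_eq_add_of_le h3
        have : k + 2 + j - k = j + 2 := by omega
        simp [this]

lemma map_range_split {n : ℕ} {A : Type*} {f : ℕ → A} {l r : List A} {x y : A}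
    (h : (List.range n).map f = l ++ x :: y :: r) :
    ∃ k, k + 1 < n ∧ l = (List.range k).map f ∧ x = f k ∧ y = f (k + 1) ∧
      r = (List.range' (k + 2) (n - k - 2)).map f := by
  have hlen := congrArg List.length h
  simp only [List.length_map, List.length_range, List.length_append, List.length_cons] at hlen
  have hk : l.length + 1 < n := by omega
  refine ⟨l.length, hk, ?_⟩
  rw [range_split hk, List.map_append] at h
  obtain ⟨h1, h2⟩ := List.append_inj h (by simp)
  simp only [List.map_cons, List.cons.injEq] at h2
  exact ⟨h1.symm, h2.1.symm, h2.2.1.symm, h2.2.2.symm⟩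

variable {n k : ℕ}

local notation "pt" => ptLoop (stdBase_mem_chart n)

lemma map_push_range (hk : k + 1 < n) :
    (List.range k).map (fun j => (halfTwistHomeo hk).push (pt j)) = (List.range k).map pt := by
  refine List.map_congr_left fun j hj => ?_
  rw [List.mem_range] at hj
  exact push_halfTwistHomeo_of_ne hk (j := ⟨j, by omega⟩) (by simp; omega) (by simp; omega)

lemma map_push_range' (hk : k + 1 < n) :
    (List.range' (k + 2) (n - k - 2)).map (fun j => (halfTwistHomeo hk).push (pt j)) =
      (List.range' (k + 2) (n - k - 2)).map pt := by
  refine List.map_congr_left fun j hj => ?_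
  rw [List.mem_range'_1] at hj
  exact push_halfTwistHomeo_of_ne hk (j := ⟨j, by omega⟩) (by simp; omega) (by simp; omega)

/-- No path need be followed: the product of all generators is the boundary circle, which is
preserved, and the images of all other generators are known. -/
lemma push_halfTwistHomeo_right (hk : k + 1 < n) :
    (halfTwistHomeo hk).push (pt (k + 1)) = (pt (k + 1))⁻¹ * pt k * pt (k + 1) := by
  have hc : IsCircle 0 (circlePath 0 (stdBase n)
      fun t => norm_ne_one_of_mem n (by simp [norm_turn, stdBase])) := isCircle_circlePath _ _ _
  have h1 := (halfTwistHomeo hk).push_circle hc hc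
  rw [← stdGens_prod n hc, map_list_prod, stdGens, List.map_map] at h1
  rw [range_split hk, List.map_append, List.map_append, List.prod_append, List.prod_append] at h1
  simp only [List.map_cons, List.prod_cons, Function.comp_def] at h1
  rw [map_push_range, map_push_range', push_halfTwistHomeo_left hk] at h1
  have h2 := mul_left_cancel h1
  rw [← mul_assoc, ← mul_assoc] at h2
  have h3 := mul_right_cancel h2
  rw [mul_assoc, ← h3, inv_mul_cancel_left]

lemma stdGens_split (hk : k + 1 < n) :
    stdGens n = (List.range k).map pt ++ pt k :: pt (k + 1) ::
      (List.range' (k + 2) (n - k - 2)).map pt := by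
  rw [stdGens, range_split hk, List.map_append]
  rfl

lemma stdGens_push (hk : k + 1 < n) :
    (stdGens n).map (halfTwistHomeo hk).push = (List.range k).map pt ++ pt (k + 1) ::
      ((pt (k + 1))⁻¹ * pt k * pt (k + 1)) :: (List.range' (k + 2) (n - k - 2)).map pt := by
  rw [stdGens_split hk, List.map_append, List.map_cons, List.map_cons, List.map_map,
    List.map_map, push_halfTwistHomeo_left, push_halfTwistHomeo_right]
  congr 1
  · exact map_push_range hk
  · congr 2
    exact map_push_range' hk

lemma stdGens_push_symm (hk : k + 1 < n) :
    (stdGens n).map (halfTwistHomeo hk).symm.push = (List.range k).map pt ++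
      (pt k * pt (k + 1) * (pt k)⁻¹) :: pt k :: (List.range' (k + 2) (n - k - 2)).map pt := by
  have h0 : ∀ x y, (halfTwistHomeo hk).push x = y → (halfTwistHomeo hk).symm.push y = x := by
    rintro x _ rfl
    exact (halfTwistHomeo hk).push_symm_push x
  rw [stdGens_split hk, List.map_append, List.map_cons, List.map_cons, List.map_map,
    List.map_map]
  congr 1
  · conv_lhs => rw [← List.map_map, ← map_push_range hk, List.map_map]
    exact List.map_congr_left fun j _ => (halfTwistHomeo hk).push_symm_push _
  · congr 1
    · apply h0
      rw [map_mul, map_mul, map_inv, push_halfTwistHomeo_left, push_halfTwistHomeo_right]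
      group
    congr 1
    · exact h0 _ _ (push_halfTwistHomeo_left hk)
    · conv_lhs => rw [← List.map_map, ← map_push_range' hk, List.map_map]
      exact List.map_congr_left fun j _ => (halfTwistHomeo hk).push_symm_push _

/-- Every tuple that is Hurwitz equivalent to the standard geometric base is obtained from it by a
homeomorphism of the disc. -/
lemma exists_push_of_hurwitzEquiv {b : List (FundamentalGroup (Punctured (realPts (stdPt n)))
    (stdBase n))} (h : HurwitzEquiv (stdGens n) b) :
    ∃ f : DiscHomeo 0 1 (stdBase n) 0 1 (stdBase n), b = (stdGens n).map f.push := by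
  have hmap : ∀ (f : DiscHomeo 0 1 (stdBase n) 0 1 (stdBase n)) (L : List ℕ),
      (L.map pt).map f.push = L.map fun j => f.push (pt j) := fun f L => by
    rw [List.map_map]; rfl
  -- An equivalence is proved so that the `symm` case of the induction goes through. In each step
  -- the half twist is applied before `f`: a move on the image of the standard base is the image of
  -- a move on the standard base.
  have key : ∀ a b : List (FundamentalGroup (Punctured (realPts (stdPt n))) (stdBase n)),
      HurwitzEquiv a b → ((∃ f : DiscHomeo 0 1 (stdBase n) 0 1 (stdBase n),
        a = (stdGens n).map f.push) ↔ ∃ f : DiscHomeo 0 1 (stdBase n) 0 1 (stdBase n),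
        b = (stdGens n).map f.push) := by
    intro a b hab
    induction hab with
    | rel a b h =>
      obtain ⟨l, r, x, y, rfl, rfl⟩ := h
      constructor
      · rintro ⟨f, hf⟩
        rw [stdGens, hmap] at hf
        obtain ⟨k, hk, h1, h2, h3, h4⟩ := map_range_split hf.symm
        refine ⟨(halfTwistHomeo hk).trans f, ?_⟩
        have e : ((halfTwistHomeo hk).trans f).push = f.push.comp (halfTwistHomeo hk).push :=
          MonoidHom.ext fun z => DiscHomeo.push_trans _ _ z
        rw [e, MonoidHom.coe_comp, ← List.map_map, stdGens_push, List.map_append, List.map_cons,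
          List.map_cons, hmap, hmap, ← h1, ← h4, map_mul, map_mul, map_inv, ← h2, ← h3]
        congr 3
        group
      · rintro ⟨f, hf⟩
        rw [stdGens, hmap] at hf
        obtain ⟨k, hk, h1, h2, h3, h4⟩ := map_range_split hf.symm
        refine ⟨(halfTwistHomeo hk).symm.trans f, ?_⟩
        have e : ((halfTwistHomeo hk).symm.trans f).push =
            f.push.comp (halfTwistHomeo hk).symm.push :=
          MonoidHom.ext fun z => DiscHomeo.push_trans _ _ z
        rw [e, MonoidHom.coe_comp, ← List.map_map, stdGens_push_symm, List.map_append,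
          List.map_cons, List.map_cons, hmap, hmap, ← h1, ← h4, map_mul, map_mul, map_inv, ← h2,
          ← h3]
    | refl a => rfl
    | symm a b _ ih => exact ih.symm
    | trans a b c _ _ ih1 ih2 => exact ih1.trans ih2
  refine (key _ _ h).1 ⟨DiscHomeo.refl 0 1 (stdBase n), ?_⟩
  have e : (DiscHomeo.refl 0 1 (stdBase n)).push = MonoidHom.id _ :=
    MonoidHom.ext fun z => DiscHomeo.push_refl z
  rw [e]
  exact (List.map_id _).symm

end HurwitzTwist

/-! ### Moving points in the disc -/

section Push

open scoped Topology NNReal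

/-- The open disc is homeomorphic to the plane, where complements of countable sets are path
connected. -/
lemma isPreconnected_ball_diff_finite {F : Set ℂ} (hF : F.Finite) :
    IsPreconnected (ball (0 : ℂ) 1 \ F) := by
  let f : ℂ → ℂ := fun z => (Homeomorph.unitBall z : ℂ)
  have hf : Function.Injective f := Subtype.val_injective.comp Homeomorph.unitBall.injective
  have h1 : ball (0 : ℂ) 1 \ F = f '' (f ⁻¹' F)ᶜ := by
    ext z
    constructor
    · rintro ⟨h1, h2⟩
      refine ⟨Homeomorph.unitBall.symm ⟨z, h1⟩, ?_, ?_⟩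
      · simpa [f] using h2
      · simp [f]
    · rintro ⟨w, hw, rfl⟩
      exact ⟨(Homeomorph.unitBall w).2, hw⟩
  rw [h1]
  refine (Set.Countable.isPathConnected_compl_of_one_lt_rank ?_ ?_).isConnected.isPreconnected.image
    _ (by fun_prop)
  · rw [Complex.rank_real_complex]; norm_num
  · exact (hF.preimage hf.injOn).countable

/-- A cut-off function. -/
def cutoff (r ρ : ℝ) : ℝ := max 0 (min 1 (2 - ρ / r))

lemma cutoff_of_le {r ρ : ℝ} (hr : 0 < r) (h : ρ ≤ r) : cutoff r ρ = 1 := by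
  have : ρ / r ≤ 1 := (div_le_one hr).2 h
  rw [cutoff, min_eq_left (by linarith), max_eq_right zero_le_one]

lemma cutoff_of_ge {r ρ : ℝ} (hr : 0 < r) (h : 2 * r ≤ ρ) : cutoff r ρ = 0 := by
  have : 2 ≤ ρ / r := (le_div_iff₀ hr).2 h
  rw [cutoff, min_eq_right (by linarith), max_eq_left (by linarith)]

lemma abs_cutoff_sub {r : ℝ} (hr : 0 < r) (x y : ℝ) :
    |cutoff r x - cutoff r y| ≤ |x - y| / r := by
  have h1 := abs_max_sub_max_le_max 0 (min 1 (2 - x / r)) 0 (min 1 (2 - y / r))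
  have h2 := abs_min_sub_min_le_max 1 (2 - x / r) 1 (2 - y / r)
  rw [sub_self, abs_zero, max_eq_right (b := |_ - _|) (abs_nonneg _)] at h1 h2
  refine h1.trans (h2.trans ?_)
  rw [sub_sub_sub_cancel_left, ← sub_div, abs_div, abs_of_pos hr, abs_sub_comm]

/-- The cut-off function has Lipschitz constant `1 / r`, so the map differs from the identity by a
map with Lipschitz constant `1 / 2` and is a homeomorphism. -/
lemma exists_homeo_push {p q : ℂ} {r : ℝ} (hr : 0 < r) (hq : ‖q - p‖ ≤ r / 2) :
    ∃ h : ℂ ≃ₜ ℂ, ∀ z, h z = z + cutoff r ‖z - p‖ * (q - p) := by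
  have key : ApproximatesLinearOn (fun z : ℂ => z + cutoff r ‖z - p‖ * (q - p))
      ((ContinuousLinearEquiv.refl ℝ ℂ : ℂ ≃L[ℝ] ℂ) : ℂ →L[ℝ] ℂ) univ (1 / 2 : ℝ≥0) := by
    intro x _ y _
    have e : x + cutoff r ‖x - p‖ * (q - p) - (y + cutoff r ‖y - p‖ * (q - p)) -
        ((ContinuousLinearEquiv.refl ℝ ℂ : ℂ ≃L[ℝ] ℂ) : ℂ →L[ℝ] ℂ) (x - y) =
        ((cutoff r ‖x - p‖ - cutoff r ‖y - p‖ : ℝ) : ℂ) * (q - p) := by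
      simp only [ContinuousLinearEquiv.coe_coe, ContinuousLinearEquiv.refl_apply]
      push_cast
      ring
    rw [e, norm_mul, Complex.norm_real, Real.norm_eq_abs]
    have h1 := abs_cutoff_sub hr ‖x - p‖ ‖y - p‖
    have h2 : |‖x - p‖ - ‖y - p‖| ≤ ‖x - y‖ := by
      have := abs_norm_sub_norm_le (x - p) (y - p)
      rwa [sub_sub_sub_cancel_right] at this
    calc _ ≤ ‖x - y‖ / r * (r / 2) :=
          mul_le_mul (h1.trans (div_le_div_of_nonneg_right h2 hr.le)) hq (norm_nonneg _)
            (by positivity)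
      _ = _ := by push_cast; field_simp
  refine ⟨key.toHomeomorph _ (Or.inr ?_), fun z => rfl⟩
  have : ‖((ContinuousLinearEquiv.refl ℝ ℂ : ℂ ≃L[ℝ] ℂ).symm : ℂ →L[ℝ] ℂ)‖₊ = 1 := by
    have h := ContinuousLinearMap.norm_id (𝕜 := ℝ) (E := ℂ)
    exact NNReal.eq h
  rw [this]
  norm_num

/-- A homeomorphism that rests outside the unit disc and near the points of `F`, moves `p` to `q`
and is a translation near `p`. -/
def IsMove (F : Set ℂ) (p q : ℂ) (h : ℂ ≃ₜ ℂ) : Prop :=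
  (∀ z, 1 ≤ ‖z‖ → h z = z) ∧ (∀ a ∈ F, ∀ᶠ z in 𝓝 a, h z = z) ∧ ∀ᶠ z in 𝓝 p, h z = z + (q - p)

lemma IsMove.apply {F : Set ℂ} {p q : ℂ} {h : ℂ ≃ₜ ℂ} (hm : IsMove F p q h) : h p = q := by
  rw [hm.2.2.self_of_nhds]
  ring

/-- Being movable to one another is symmetric and transitive and holds for nearby points, hence
holds throughout a connected set. -/
lemma exists_isMove {F : Set ℂ} (hF : F.Finite) {p q : ℂ} (hp : p ∈ ball (0 : ℂ) 1 \ F)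
    (hq : q ∈ ball (0 : ℂ) 1 \ F) : ∃ h, IsMove F p q h := by
  refine (isPreconnected_ball_diff_finite hF).induction₂ (fun p q => ∃ h, IsMove F p q h) ?_ ?_ ?_
    hp hq
  · intro p hp
    have hopen : IsOpen (ball (0 : ℂ) 1 \ F) := isOpen_ball.sdiff hF.isClosed
    obtain ⟨ε, hε, hball⟩ := Metric.isOpen_iff.1 hopen p hp
    refine mem_nhdsWithin_of_mem_nhds ?_
    filter_upwards [ball_mem_nhds p (by positivity : 0 < ε / 8)] with q hq
    rw [mem_ball, dist_eq_norm] at hq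
    -- With `r = ε / 4` the condition on `q` is `‖q - p‖ ≤ ε / 8`, and nothing moves outside the
    -- disc of radius `2 * r = ε / 2`.
    obtain ⟨h, hh⟩ := exists_homeo_push (p := p) (q := q) (r := ε / 4) (by positivity) (by linarith)
    have hrest : ∀ z, z ∉ ball p (ε / 2) → h z = z := by
      intro z hz
      rw [mem_ball, dist_eq_norm, not_lt] at hz
      rw [hh, cutoff_of_ge (by positivity) (by linarith)]
      simp
    refine ⟨h, ?_, ?_, ?_⟩
    · intro z hz
      refine hrest z fun h => ?_
      have := (hball (ball_subset_ball (by linarith) h)).1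
      rw [mem_ball_zero_iff] at this
      linarith
    · intro a ha
      have : a ∉ closedBall p (ε / 2) := fun h =>
        (hball (closedBall_subset_ball (by linarith) h)).2 ha
      filter_upwards [isClosed_closedBall.isOpen_compl.mem_nhds this] with z hz
      exact hrest z fun h => hz (ball_subset_closedBall h)
    · filter_upwards [ball_mem_nhds p (by positivity : 0 < ε / 4)] with z hz
      rw [mem_ball, dist_eq_norm] at hz
      rw [hh, cutoff_of_le (by positivity) hz.le]
      simp
  · rintro x y z - - - ⟨h, hh⟩ ⟨h', hh'⟩
    refine ⟨h.trans h', fun w hw => ?_, fun a ha => ?_, ?_⟩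
    · rw [Homeomorph.trans_apply, hh.1 w hw, hh'.1 w hw]
    · filter_upwards [hh.2.1 a ha, hh'.2.1 a ha] with w h1 h2
      rw [Homeomorph.trans_apply, h1, h2]
    · have h1 : ∀ᶠ w in 𝓝 x, h' (h w) = h w + (z - y) :=
        h.continuous.continuousAt.eventually (by rw [hh.apply]; exact hh'.2.2)
      filter_upwards [h1, hh.2.2] with w h1 h2
      rw [Homeomorph.trans_apply, h1, h2]
      ring
  · rintro x y - - ⟨h, hh⟩
    refine ⟨h.symm, fun w hw => ?_, fun a ha => ?_, ?_⟩
    · rw [Homeomorph.symm_apply_eq, hh.1 w hw]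
    · filter_upwards [hh.2.1 a ha] with w h1
      rw [Homeomorph.symm_apply_eq, h1]
    · have h2 : ∀ᶠ w in 𝓝 y, h (w - (y - x)) = w - (y - x) + (y - x) := by
        have hc : ContinuousAt (fun w : ℂ => w - (y - x)) y := by fun_prop
        exact hc.eventually (by simpa using hh.2.2)
      filter_upwards [h2] with w h2
      rw [Homeomorph.symm_apply_eq]
      rw [show w + (x - y) = w - (y - x) by ring, h2]
      ring

/-- The base point `-i` of the unit disc. -/
def discBase (A : Finset ℂ) (hA : (A : Set ℂ) ⊆ ball 0 1) : Punctured (A : Set ℂ) :=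
  ⟨-Complex.I, fun h => by simpa using hA h⟩

/-- One point of `A \ B` at a time is moved to a point of `B \ A`, with the other points of `A`
fixed. -/
lemma nonempty_discHomeo_finset (k : ℕ) : ∀ (A B : Finset ℂ) (hA : (A : Set ℂ) ⊆ ball 0 1)
    (hB : (B : Set ℂ) ⊆ ball 0 1), A.card = B.card → (A \ B).card = k →
      Nonempty (DiscHomeo 0 1 (discBase A hA) 0 1 (discBase B hB)) := by
  induction k with
  | zero =>
    intro A B hA hB hcard h
    rw [Finset.card_eq_zero, Finset.sdiff_eq_empty_iff_subset] at h
    have := Finset.eq_of_subset_of_card_le h hcard.ge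
    subst this
    exact ⟨DiscHomeo.refl _ _ _⟩
  | succ k ih =>
    intro A B hA hB hcard h
    obtain ⟨p, hp⟩ : (A \ B).Nonempty := by rw [← Finset.card_pos]; omega
    have hBA : (B \ A).card = (A \ B).card := Finset.card_sdiff_comm hcard.symm
    obtain ⟨q, hq⟩ : (B \ A).Nonempty := by rw [← Finset.card_pos]; omega
    rw [Finset.mem_sdiff] at hp hq
    have hpq : p ≠ q := by rintro rfl; exact hp.2 hq.1
    let A' := insert q (A.erase p)
    have hA' : (A' : Set ℂ) ⊆ ball 0 1 := by
      intro z hz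
      simp only [A', Finset.coe_insert, Finset.coe_erase, mem_insert_iff, mem_sdiff] at hz
      rcases hz with rfl | hz
      · exact hB hq.1
      · exact hA hz.1
    have hqA : q ∉ A.erase p := fun h => hq.2 (Finset.mem_of_mem_erase h)
    have hc1 : A'.card = A.card := by
      rw [Finset.card_insert_of_notMem hqA, Finset.card_erase_add_one hp.1]
    have hc2 : (A' \ B).card = k := by
      have : A' \ B = (A \ B).erase p := by
        ext z
        simp only [A', Finset.mem_sdiff, Finset.mem_insert, Finset.mem_erase]
        constructor
        · rintro ⟨rfl | ⟨h1, h2⟩, h3⟩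
          · exact absurd hq.1 h3
          · exact ⟨h1, h2, h3⟩
        · rintro ⟨h1, h2, h3⟩
          exact ⟨Or.inr ⟨h1, h2⟩, h3⟩
      rw [this, Finset.card_erase_of_mem (Finset.mem_sdiff.2 hp), h]
      rfl
    obtain ⟨g⟩ := ih A' B hA' hB (hc1.trans hcard) hc2
    obtain ⟨f, hf⟩ := exists_isMove (F := (A.erase p : Set ℂ)) (A.erase p).finite_toSet
      (p := p) (q := q) ⟨hA hp.1, by simp⟩ ⟨hB hq.1, by exact_mod_cast hqA⟩
    refine ⟨DiscHomeo.trans (u' := discBase A' hA') ⟨f, ?_, ?_, ?_, ?_⟩ g⟩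
    · intro t
      exact hf.1 _ (by simp [norm_turn, discBase])
    · intro z
      rw [mem_closedBall_zero_iff, mem_closedBall_zero_iff]
      rcases le_or_gt 1 ‖z‖ with h | h
      · rw [hf.1 z h]
      · refine ⟨fun _ => ?_, fun _ => h.le⟩
        by_contra h1
        have := f.injective (hf.1 _ (not_le.1 h1).le)
        rw [this] at h1
        exact h1 h.le
    · intro z
      simp only [A', Finset.mem_coe, Finset.mem_insert]
      have hfix : ∀ a ∈ A.erase p, f a = a := fun a ha => (hf.2.1 a ha).self_of_nhds
      constructor
      · intro hz
        by_cases hzp : z = p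
        · left; rw [hzp]; exact hf.apply
        · right
          have hz' := Finset.mem_erase.2 ⟨hzp, hz⟩
          rwa [hfix z hz']
      · rintro (hz | hz)
        · rw [← hf.apply] at hz
          rw [f.injective hz]
          exact hp.1
        · have := f.injective (hfix _ hz)
          rw [this] at hz
          exact Finset.mem_of_mem_erase hz
    · intro a ha
      refine ⟨1, one_ne_zero, ?_⟩
      by_cases hap : a = p
      · subst hap
        obtain ⟨r, hr, h1⟩ := Metric.eventually_nhds_iff_ball.1 hf.2.2
        refine ⟨r, hr, fun z hz => ?_⟩
        rw [h1 z hz, hf.apply]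
        ring
      · have ha' : a ∈ A.erase p := Finset.mem_erase.2 ⟨hap, ha⟩
        obtain ⟨r, hr, h1⟩ := Metric.eventually_nhds_iff_ball.1 (hf.2.1 a ha')
        refine ⟨r, hr, fun z hz => ?_⟩
        rw [h1 z hz, h1 a (mem_ball_self hr)]
        ring

end Push

/-! ### Geometric bases form a Hurwitz class -/

section GeometricBases

variable {N : Set ℂ} {c : ℂ} {R : ℝ} {u : Punctured N}

lemma discHomeo_of_eq {N' : Set ℂ} (h : N = N') {u' : Punctured N'} (hu : (u : ℂ) = u') :
    Nonempty (DiscHomeo c R u c R u') := by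
  subst h
  have : u = u' := Subtype.ext hu
  subst this
  exact ⟨DiscHomeo.refl _ _ _⟩

/-- Any finite set in a disc is the image of the standard points under a homeomorphism. -/
lemma nonempty_discHomeo (hN : N.Finite) (hNb : N ⊆ ball c R) (hR : 0 < R)
    (hu : (u : ℂ) ∈ sphere c R) : Nonempty (DiscHomeo 0 1 (stdBase N.ncard) c R u) := by
  have hu' : ‖(u : ℂ) - c‖ = R := by rwa [← dist_eq_norm]
  have hα : Complex.I * ((u : ℂ) - c) ≠ 0 := by
    refine mul_ne_zero Complex.I_ne_zero fun h => ?_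
    rw [h, norm_zero] at hu'
    exact hR.ne hu'
  have hαn : ‖Complex.I * ((u : ℂ) - c)‖ = R := by rw [norm_mul, Complex.norm_I, one_mul, hu']
  -- The similarity `z ↦ c + α * z` takes the unit disc to the given disc and `-i` to `u`.
  let α := Complex.I * ((u : ℂ) - c)
  let f : ℂ ≃ₜ ℂ := (Homeomorph.mulLeft₀ α hα).trans (Homeomorph.addLeft c)
  have hf : ∀ z, f z = c + α * z := fun z => rfl
  have hinj : InjOn f.symm N := f.symm.injective.injOn
  have hfin : (f.symm '' N).Finite := hN.image _
  let A : Finset ℂ := hfin.toFinset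
  have hmem : ∀ z, z ∈ (A : Set ℂ) ↔ f z ∈ N := by
    intro z
    simp only [A, Finite.coe_toFinset]
    constructor
    · rintro ⟨w, hw, rfl⟩
      rwa [Homeomorph.apply_symm_apply]
    · intro h
      exact ⟨f z, h, Homeomorph.symm_apply_apply _ _⟩
  have hA : (A : Set ℂ) ⊆ ball 0 1 := by
    intro z hz
    have h1 := hNb ((hmem z).1 hz)
    rw [hf, mem_ball, dist_eq_norm, add_sub_cancel_left, norm_mul, hαn] at h1
    rw [mem_ball_zero_iff]
    nlinarith
  have hcard : A.card = N.ncard := by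
    rw [← ncard_coe_finset, Finite.coe_toFinset, hinj.ncard_image]
  let B : Finset ℂ := Finset.univ.image fun k : Fin N.ncard => (stdPt N.ncard k : ℂ)
  have hBcoe : realPts (stdPt N.ncard) = (B : Set ℂ) := by simp [B, realPts]
  have hB : (B : Set ℂ) ⊆ ball 0 1 := by
    rw [← hBcoe]
    rintro _ ⟨k, rfl⟩
    rw [mem_ball_zero_iff, Complex.norm_real, Real.norm_of_nonneg (stdPt_pos _ k).le]
    linarith [stdPt_le _ k, gap_pos N.ncard]
  have hBcard : B.card = N.ncard := by
    rw [Finset.card_image_of_injective, Finset.card_univ, Fintype.card_fin]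
    exact Complex.ofReal_injective.comp (stdPt_strictMono _).injective
  obtain ⟨h1⟩ := discHomeo_of_eq (c := 0) (R := 1) (u := stdBase N.ncard) (u' := discBase B hB)
    hBcoe rfl
  obtain ⟨h2⟩ := nonempty_discHomeo_finset _ B A hB hA (hBcard.trans hcard.symm) rfl
  refine ⟨(h1.trans h2).trans ⟨f, fun t => ?_, fun z => ?_, hmem, fun a _ => ?_⟩⟩
  · rw [hf]
    simp only [discBase, α]
    linear_combination -(turn t * ((u : ℂ) - c)) * Complex.I_mul_I
  · rw [hf, mem_closedBall_zero_iff, mem_closedBall, dist_eq_norm, add_sub_cancel_left, norm_mul,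
      hαn]
    constructor
    · intro h; nlinarith
    · intro h; nlinarith
  · exact ⟨α, hα, 1, one_pos, fun z _ => by rw [hf, hf]; ring⟩

lemma IsGeometricBase.length_eq {n : ℕ} (hn : N.ncard = n)
    {δ : List (FundamentalGroup (Punctured N) u)} (h : IsGeometricBase c R u δ) :
    δ.length = n := by
  obtain ⟨⟨a, T, hb, -⟩, -⟩ := h
  have h := congrArg ncard hb.range_endpoint
  rw [← image_univ, ncard_image_of_injective _ hb.endpoint_injective, ncard_univ,
    Nat.card_eq_fintype_card, Fintype.card_fin, hn] at h
  exact h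

lemma exists_conj_of_isLoopAlong_of_eq {a a' : ℂ} (e : a' = a) (ha : a ∈ N) {T : Path (u : ℂ) a}
    {T' : Path (u : ℂ) a'} {δ δ' : FundamentalGroup (Punctured N) u} (h : IsLoopAlong T δ)
    (h' : IsLoopAlong T' δ') : ∃ g, δ = g * δ' * g⁻¹ := by
  subst e
  exact exists_conj_of_isLoopAlong ha h h'

lemma ncard_realPts (n : ℕ) : (realPts (stdPt n)).ncard = n := by
  rw [realPts, ← image_univ, ncard_image_of_injective, ncard_univ, Nat.card_eq_fintype_card,
    Fintype.card_fin]
  exact Complex.ofReal_injective.comp (stdPt_strictMono _).injective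

/-- Each entry is conjugate to the standard loop with the same end point, and both products are the
boundary circle. Through the isomorphism `freeToLoops` this is the situation of Artin's theorem in
the free group. -/
lemma hurwitzEquiv_stdGens {n : ℕ} {δ : List (FundamentalGroup (Punctured (realPts (stdPt n)))
    (stdBase n))} (h : IsGeometricBase 0 1 (stdBase n) δ) : HurwitzEquiv δ (stdGens n) := by
  have hlen := h.length_eq (ncard_realPts n)
  obtain ⟨⟨a, T, hb, hT⟩, ω, hω, hprod⟩ := h
  have hu := stdBase_mem_chart n
  have h0 := stripIdx_stdBase n
  have hp := stdPt_strictMono n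
  have hex : ∀ i : Fin δ.length, ∃ L : FreeGroup (Fin n) × Fin n,
      δ.get i = freeToLoops hu (conjOf L) := by
    intro i
    have hi : a i ∈ realPts (stdPt n) := by rw [← hb.range_endpoint]; exact ⟨i, rfl⟩
    obtain ⟨k, hk⟩ := id hi
    obtain ⟨g, hg⟩ := exists_conj_of_isLoopAlong_of_eq hk hi (hT i) (isLoopAlong_stdSegment n k)
    obtain ⟨w, rfl⟩ := freeToLoops_surjective hp hu h0 g
    refine ⟨(w, k), ?_⟩
    rw [hg, conjOf, map_mul, map_mul, map_inv, freeToLoops, FreeGroup.lift_apply_of]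
  choose L hL using hex
  let M : List (FreeGroup (Fin n) × Fin n) := List.ofFn L
  have hδ : δ = (M.map conjOf).map (freeToLoops hu) := by
    apply List.ext_get
    · simp [M]
    · intro i h1 h2
      rw [hL ⟨i, h1⟩]
      simp [M]
  let l : List (Fin n) := List.finRange n
  have hg : stdGens n = (l.map FreeGroup.of).map (freeToLoops hu) := by
    rw [stdGens, List.map_map, ← List.map_coe_finRange_eq_range, List.map_map]
    refine List.map_congr_left fun k _ => ?_
    rw [Function.comp_apply, Function.comp_apply, freeToLoops, FreeGroup.lift_apply_of]
  rw [hg, hδ]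
  refine HurwitzEquiv.map _ (hurwitzEquiv_of_prod_eq (by simp [l, M, hlen]) ?_)
  apply freeToLoops_injective hp hu h0
  rw [map_list_prod, map_list_prod, ← hδ, ← hg, hprod, stdGens_prod n hω]

lemma map_push_map_push {N' : Set ℂ} {c' : ℂ} {R' : ℝ} {u' : Punctured N'}
    (h : DiscHomeo c R u c' R' u') (δ : List (FundamentalGroup (Punctured N') u')) :
    (δ.map h.symm.push).map h.push = δ := by
  rw [List.map_map]
  conv_rhs => rw [← List.map_id δ]
  exact List.map_congr_left fun x _ => h.push_push_symm x

/-- Geometric bases exist. -/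
lemma exists_isGeometricBase (hN : N.Finite) (hNb : N ⊆ ball c R) (hR : 0 < R)
    (hu : (u : ℂ) ∈ sphere c R) : ∃ δ, IsGeometricBase c R u δ := by
  obtain ⟨h⟩ := nonempty_discHomeo hN hNb hR hu
  exact ⟨_, h.push_isGeometricBase (isGeometricBase_stdGens _)⟩

/-- Any two geometric bases are Hurwitz equivalent. -/
lemma IsGeometricBase.hurwitzEquiv (hN : N.Finite) (hNb : N ⊆ ball c R) (hR : 0 < R)
    (hu : (u : ℂ) ∈ sphere c R) {δ δ' : List (FundamentalGroup (Punctured N) u)}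
    (hδ : IsGeometricBase c R u δ) (hδ' : IsGeometricBase c R u δ') : HurwitzEquiv δ δ' := by
  obtain ⟨h⟩ := nonempty_discHomeo hN hNb hR hu
  have key : ∀ δ, IsGeometricBase c R u δ → HurwitzEquiv δ ((stdGens _).map h.push) := by
    intro δ hδ
    have := HurwitzEquiv.map h.push (hurwitzEquiv_stdGens (h.symm.push_isGeometricBase hδ))
    rwa [map_push_map_push] at this
  exact (key δ hδ).trans _ _ _ ((key δ' hδ').symm _ _)

/-- A tuple that is Hurwitz equivalent to a geometric base is a geometric base. -/
lemma IsGeometricBase.of_hurwitzEquiv (hN : N.Finite) (hNb : N ⊆ ball c R) (hR : 0 < R)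
    (hu : (u : ℂ) ∈ sphere c R) {δ δ' : List (FundamentalGroup (Punctured N) u)}
    (hδ : IsGeometricBase c R u δ) (h' : HurwitzEquiv δ δ') : IsGeometricBase c R u δ' := by
  obtain ⟨h⟩ := nonempty_discHomeo hN hNb hR hu
  have h1 := hurwitzEquiv_stdGens (h.symm.push_isGeometricBase hδ)
  obtain ⟨f, hf⟩ := exists_push_of_hurwitzEquiv
    ((h1.symm _ _).trans _ _ _ (HurwitzEquiv.map h.symm.push h'))
  have h2 := h.push_isGeometricBase (f.push_isGeometricBase (isGeometricBase_stdGens _))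
  rwa [← hf, map_push_map_push] at h2

end GeometricBases

/-! ### Configurations of roots -/

section RootConf

open Polynomial

/-- The configuration of the roots of a polynomial. -/
def rootConf {m : ℕ} (p : ℂ[X]) (h : p.roots.toFinset.card = m) : Conf m := ⟨p.roots.toFinset, h⟩

lemma card_roots_toFinset_of_encard {p : ℂ[X]} {m : ℕ} (h : {y | p.eval y = 0}.encard = m) :
    p.roots.toFinset.card = m := by
  have hp : p ≠ 0 := by
    rintro rfl
    have : {y : ℂ | (0 : ℂ[X]).eval y = 0} = univ := by ext; simp
    rw [this, encard_eq_top infinite_univ] at h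
    exact absurd h (by simp)
  have hr : {y | p.eval y = 0} = (p.roots.toFinset : Set ℂ) := by
    ext l; simp [hp, IsRoot]
  rw [hr, encard_coe_eq_coe_finsetCard, Nat.cast_inj] at h
  exact h

lemma mem_rootConf {m : ℕ} {p : ℂ[X]} (hp : p ≠ 0) (h : p.roots.toFinset.card = m) (y : ℂ) :
    y ∈ (rootConf p h).1 ↔ p.eval y = 0 := by
  simp [rootConf, hp, IsRoot]

/-- By Vieta the coordinates on `Conf m` are quotients of coefficients, up to sign; those of index
greater than `m` vanish. -/
lemma continuous_rootConf {m : ℕ} {T : Type} [TopologicalSpace T] {p : T → ℂ[X]}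
    (hd' : ∀ t, (p t).natDegree ≤ m) (h0 : ∀ t, (p t).coeff m ≠ 0)
    (hc : ∀ k, Continuous fun t => (p t).coeff k)
    (h : ∀ t, (p t).roots.toFinset.card = m) : Continuous fun t => rootConf (p t) (h t) := by
  rw [Conf.continuous_iff]
  intro k
  have hd : ∀ t, (p t).natDegree = m := fun t =>
    le_antisymm (hd' t) (le_natDegree_of_ne_zero (h0 t))
  by_cases hk : k ≤ m
  · have key : ∀ t, (rootConf (p t) (h t)).1.val.esymm k
        = (p t).coeff (m - k) / ((p t).coeff m * (-1) ^ k) := by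
      intro t
      have hle : (p t).roots.card ≤ m := (card_roots' _).trans (hd t).le
      have hroots : (p t).roots.card = (p t).natDegree := by
        rw [hd]
        exact le_antisymm hle ((h t).symm.le.trans (Multiset.toFinset_card_le _))
      have hnd : (p t).roots.Nodup := by
        rw [← Multiset.toFinset_card_eq_card_iff_nodup, h, hroots, hd]
      have hv : (rootConf (p t) (h t)).1.val = (p t).roots := by
        rw [rootConf, Multiset.toFinset_val, hnd.dedup]
      have hV := coeff_eq_esymm_roots_of_card hroots (k := m - k) (by rw [hd]; omega)
      rw [hv, eq_div_iff (mul_ne_zero (h0 t) (by simp)), hV, leadingCoeff, hd, Nat.sub_sub_self hk]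
      ring
    simp only [key]
    exact (hc _).div ((hc _).mul continuous_const) fun t => mul_ne_zero (h0 t) (by simp)
  · have key : ∀ t, (rootConf (p t) (h t)).1.val.esymm k = 0 := by
      intro t
      rw [Multiset.esymm, Multiset.powersetCard_eq_empty]
      · simp
      · have := (rootConf (p t) (h t)).2
        rw [Finset.card_val, this]
        omega
    simp only [key]
    exact continuous_const

end RootConf

/-! ### The full twist -/

section FullTwist

open scoped unitInterval

lemma esymm_map_mul (a : ℂ) (s : Multiset ℂ) (k : ℕ) :
    (s.map fun z => a * z).esymm k = a ^ k * s.esymm k := by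
  rw [Multiset.esymm, Multiset.esymm, Multiset.powersetCard_map, Multiset.map_map,
    ← Multiset.sum_map_mul_left]
  congr 1
  refine Multiset.map_congr rfl fun t ht => ?_
  rw [Multiset.mem_powersetCard] at ht
  rw [Function.comp_apply, Multiset.prod_map_mul, Multiset.map_const', Multiset.prod_replicate,
    ht.2, Multiset.map_id']

/-- The configuration `a K`. -/
def scaleConf {m : ℕ} (a : ℂ) (ha : a ≠ 0) (K : Conf m) : Conf m :=
  Conf.ofPoints K.1 K.2 (fun z => a * z) fun _ _ _ _ h => mul_left_cancel₀ ha h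

lemma continuous_scaleConf {m : ℕ} {T : Type} [TopologicalSpace T] {a : T → ℂ}
    (ha : ∀ t, a t ≠ 0) (hac : Continuous a) {K : T → Conf m} (hK : Continuous K) :
    Continuous fun t => scaleConf (a t) (ha t) (K t) := by
  rw [Conf.continuous_iff]
  intro k
  have h : ∀ t, (scaleConf (a t) (ha t) (K t)).1.val.esymm k = a t ^ k * (K t).1.val.esymm k := by
    intro t
    rw [← esymm_map_mul]
    congr 1
    exact Finset.image_val_of_injOn fun _ _ _ _ h => mul_left_cancel₀ (ha t) h
  simp only [h]
  exact (hac.pow k).mul (Conf.continuous_iff.1 hK k)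

lemma scaleConf_one {m : ℕ} (K : Conf m) {a : ℂ} (ha : a ≠ 0) (h : a = 1) :
    scaleConf a ha K = K := by
  subst h
  exact Conf.ofPoints_ext (by simp)

/-- The full twist does not depend on the base configuration. -/
lemma lasso_deltaSq {m : ℕ} {K K' : Conf m} (r : Path K K') :
    lasso (.mk r) (deltaSq K') = deltaSq K := by
  refine lasso_of_square (X := Conf m)
    (H := fun q : I × I => scaleConf (turn q.1) (turn_ne_zero _) (r q.2))
    (continuous_scaleConf _ (by fun_prop) (by fun_prop)) ?_ ?_ ?_ ?_
  · intro t
    simp only [Path.source]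
    rfl
  · intro t
    exact (scaleConf_one _ _ (by simp [turn_zero])).symm
  · intro t
    exact (scaleConf_one _ _ (by simp [turn_one])).symm
  · intro t
    simp only [Path.target]
    rfl

/-- Freely homotopic loops. -/
lemma exists_lasso_of_homotopy {X : Type*} [TopologicalSpace X] {H : I × I → X}
    (hH : Continuous H) (h01 : ∀ τ, H (0, τ) = H (1, τ)) {a b : X} {w : Path a a} {w' : Path b b}
    (hw : ∀ t, w t = H (t, 0)) (hw' : ∀ t, w' t = H (t, 1)) :
    ∃ r : Path a b, lasso (.mk r) (FundamentalGroup.fromPath (.mk w')) =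
      FundamentalGroup.fromPath (.mk w) := by
  let r : Path a b := ⟨⟨fun τ => H (0, τ), by fun_prop⟩, by
    change H (0, 0) = a; rw [← hw, w.source], by change H (0, 1) = b; rw [← hw', w'.source]⟩
  exact ⟨r, lasso_of_square hH hw (fun t => rfl) (fun t => h01 t) hw'⟩

end FullTwist

lemma Conf.ext_mem {m : ℕ} {K K' : Conf m} (h : ∀ y, y ∈ K.1 ↔ y ∈ K'.1) : K = K' :=
  Subtype.ext (Finset.ext h)

/-! ### The braid monodromy at infinity -/

section Infinity

open scoped unitInterval
open Polynomial

/-- The homogenization of `f (x, ·)`, with the homogenizing variable `s`. -/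
def homSlice (f : MvPolynomial (Fin 2) ℂ) (m : ℕ) (s x : ℂ) : ℂ[X] :=
  ∑ d ∈ f.support, C (f.coeff d * x ^ d 0 * s ^ (m - d 0 - d 1)) * X ^ d 1

variable {f : MvPolynomial (Fin 2) ℂ} {m : ℕ}

lemma coeff_homSlice (s x : ℂ) (k : ℕ) : (homSlice f m s x).coeff k =
    ∑ d ∈ f.support, f.coeff d * x ^ d 0 * s ^ (m - d 0 - d 1) * if k = d 1 then 1 else 0 := by
  rw [homSlice, finsetSum_coeff]
  refine Finset.sum_congr rfl fun d _ => ?_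
  rw [coeff_C_mul, coeff_X_pow]

lemma eval_homSlice (s x y : ℂ) : (homSlice f m s x).eval y =
    ∑ d ∈ f.support, f.coeff d * x ^ d 0 * s ^ (m - d 0 - d 1) * y ^ d 1 := by
  simp [homSlice, eval_finsetSum]

lemma natDegree_homSlice_le (hf : f.totalDegree ≤ m) (s x : ℂ) :
    (homSlice f m s x).natDegree ≤ m := by
  rw [natDegree_le_iff_coeff_eq_zero]
  intro k hk
  rw [coeff_homSlice]
  refine Finset.sum_eq_zero fun d hd => ?_
  have h := MvPolynomial.le_totalDegree hd
  rw [degree_fin_two] at h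
  rw [if_neg (by omega), mul_zero]

lemma coeff_homSlice_top (hf : f.totalDegree ≤ m) (s x : ℂ) :
    (homSlice f m s x).coeff m = f.coeff (Finsupp.single 1 m) := by
  rw [coeff_homSlice, Finset.sum_eq_single (Finsupp.single (1 : Fin 2) m)]
  · simp
  · intro d hd hne
    have h := MvPolynomial.le_totalDegree hd
    rw [degree_fin_two] at h
    rw [if_neg, mul_zero]
    intro hk
    apply hne
    ext i
    fin_cases i
    · simp; omega
    · simp [hk]
  · intro h
    rw [MvPolynomial.notMem_support_iff.1 h]
    simp

lemma eval_fin_two (g : MvPolynomial (Fin 2) ℂ) (x y : ℂ) : MvPolynomial.eval ![x, y] g =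
    ∑ d ∈ g.support, g.coeff d * x ^ d 0 * y ^ d 1 := by
  rw [MvPolynomial.eval_eq']
  refine Finset.sum_congr rfl fun d _ => ?_
  simp [Fin.prod_univ_two, mul_assoc]

/-- For `s ≠ 0` the zeros over `s * x` are therefore `s` times the fibre of the curve over `x`. -/
lemma eval_homSlice_mul (hf : f.totalDegree ≤ m) (s x y : ℂ) :
    (homSlice f m s (s * x)).eval (s * y) = s ^ m * MvPolynomial.eval ![x, y] f := by
  rw [eval_homSlice, eval_fin_two, Finset.mul_sum]
  refine Finset.sum_congr rfl fun d hd => ?_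
  have h := MvPolynomial.le_totalDegree hd
  rw [degree_fin_two] at h
  have e : s ^ m = s ^ d 0 * s ^ (m - d 0 - d 1) * s ^ d 1 := by
    rw [← pow_add, ← pow_add]; congr 1; omega
  rw [e, mul_pow, mul_pow]
  ring

/-- At `s = 0` only the leading form remains: the zeros over `x ≠ 0` are `x` times the slopes of the
points at infinity. -/
lemma eval_homSlice_zero (hf : f.totalDegree ≤ m) (x y : ℂ) : (homSlice f m 0 x).eval (x * y) =
    x ^ m * MvPolynomial.eval ![1, y] (MvPolynomial.homogeneousComponent m f) := by
  have h1 : (homSlice f m 0 x).eval (x * y) =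
      ∑ d ∈ f.support with d 0 + d 1 = m, x ^ m * (f.coeff d * y ^ d 1) := by
    rw [eval_homSlice, Finset.sum_filter]
    refine Finset.sum_congr rfl fun d hd => ?_
    have h := MvPolynomial.le_totalDegree hd
    rw [degree_fin_two] at h
    split_ifs with h2
    · rw [show m - d 0 - d 1 = 0 by omega, ← h2, mul_pow, pow_add]
      ring
    · rw [zero_pow (by omega)]
      ring
  rw [h1, MvPolynomial.homogeneousComponent_apply, map_sum, Finset.mul_sum]
  refine Finset.sum_congr ?_ fun d hd => ?_
  · ext d
    simp only [Finset.mem_filter, Finsupp.degree_eq_sum, Fin.sum_univ_two]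
  · rw [MvPolynomial.eval_monomial, Finsupp.prod_fintype _ _ (fun i => pow_zero _),
      Fin.prod_univ_two]
    simp

lemma encard_mul_left {a : ℂ} (ha : a ≠ 0) (s t : Set ℂ) (h : ∀ y, a * y ∈ s ↔ y ∈ t) :
    s.encard = t.encard := by
  have : s = (fun y => a * y) '' t := by
    ext z
    constructor
    · intro hz
      exact ⟨a⁻¹ * z, (h _).1 (by rwa [mul_inv_cancel_left₀ ha]), mul_inv_cancel_left₀ ha z⟩
    · rintro ⟨y, hy, rfl⟩
      exact (h y).2 hy
  rw [this, (mul_right_injective₀ ha).encard_image]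

variable {S : Set (ℂ × ℂ)}

/-- The boundary circle of a disc that contains the branch set is sent to the full twist. -/
lemma braidMonodromy_circle (hS : IsGenericCurve m S) {c : ℂ} {R : ℝ}
    (hN : branchSet m S ⊆ ball c R) (hR : 0 < R) {u : Punctured (branchSet m S)}
    (hu : (u : ℂ) ∈ sphere c R) {ω : Path u u} (hω : IsCircle c ω) :
    braidMonodromy hS u (FundamentalGroup.fromPath (.mk ω)) = deltaSq (fiberConf hS u) := by
  obtain ⟨-, f, hd, hf, hl⟩ := id hS
  have hmem : ∀ x y, (x, y) ∈ S ↔ MvPolynomial.eval ![x, y] f = 0 := by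
    intro x y
    rw [hf]
    rfl
  have hw : ∀ t : ℝ, turn t * ((u : ℂ) - c) ≠ 0 := fun t => by
    refine mul_ne_zero (turn_ne_zero _) fun h => ?_
    rw [mem_sphere, dist_eq_norm, h, norm_zero] at hu
    exact hR.ne hu
  have hfib : ∀ x ∉ branchSet m S, {y | MvPolynomial.eval ![x, y] f = 0}.encard = m := by
    intro x hx
    have := encard_fiber hS ⟨x, hx⟩
    rw [← this]
    congr 1
    ext y
    simp [fiber, hf]
  have hout : ∀ (s : I) (t : ℝ), (s : ℝ) ≠ 0 → c + turn t * ((u : ℂ) - c) / (s : ℝ) ∉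
      branchSet m S := by
    intro s t hs h
    have h1 := hN h
    have hs0 : 0 < (s : ℝ) := lt_of_le_of_ne s.2.1 (Ne.symm hs)
    rw [mem_ball, dist_eq_norm, add_sub_cancel_left, norm_div, norm_mul, norm_turn, one_mul,
      ← dist_eq_norm, mem_sphere.1 hu, Complex.norm_real, Real.norm_of_nonneg hs0.le,
      div_lt_iff₀ hs0] at h1
    nlinarith [s.2.2]
  -- With `s = 1 - q.2` these are the fibres over the circle of radius `R / s` about `c`, scaled by
  -- `s`. They start from the given circle, never meet the branch set because `R / s ≥ R`, and at `s
  -- = 0` become `turn q.1 * (u - c)` times the slopes at infinity, a rigid full rotation.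
  let p : I × I → ℂ[X] := fun q => homSlice f m ((1 - q.2 : ℝ) : ℂ)
    (((1 - q.2 : ℝ) : ℂ) * c + turn q.1 * ((u : ℂ) - c))
  have hcard : ∀ q, (p q).roots.toFinset.card = m := by
    intro q
    apply card_roots_toFinset_of_encard
    rcases eq_or_ne ((1 - q.2 : ℝ)) 0 with hs | hs
    · rw [← hl]
      apply encard_mul_left (hw q.1)
      intro y
      simp only [p, hs, mem_ofPred_eq, Complex.ofReal_zero, zero_mul, zero_add]
      rw [eval_homSlice_zero hd.le, mul_eq_zero, or_iff_right (pow_ne_zero _ (hw _))]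
    · have hs' : ((1 - q.2 : ℝ) : ℂ) ≠ 0 := by exact_mod_cast hs
      rw [← hfib _ (hout (unitInterval.symm q.2) q.1 (by simpa using hs))]
      apply encard_mul_left hs'
      intro y
      have e : ((1 - q.2 : ℝ) : ℂ) * c + turn q.1 * ((u : ℂ) - c) = ((1 - q.2 : ℝ) : ℂ) *
          (c + turn q.1 * ((u : ℂ) - c) / ((unitInterval.symm q.2 : I) : ℝ)) := by
        rw [unitInterval.coe_symm_eq]
        field_simp
      simp only [p, mem_ofPred_eq]
      rw [e, eval_homSlice_mul hd.le, mul_eq_zero, or_iff_right (pow_ne_zero _ hs')]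
  have hne : ∀ q, p q ≠ 0 := fun q h => by
    have h1 := coeff_homSlice_top (f := f) hd.le ((1 - q.2 : ℝ) : ℂ)
      (((1 - q.2 : ℝ) : ℂ) * c + turn q.1 * ((u : ℂ) - c))
    change (p q).coeff m = _ at h1
    rw [h, coeff_zero] at h1
    exact top_ne_zero hl h1.symm
  have hcont : Continuous fun q => rootConf (p q) (hcard q) := by
    refine continuous_rootConf (fun q => natDegree_homSlice_le hd.le _ _) (fun q => ?_) (fun k => ?_)
      hcard
    · rw [coeff_homSlice_top hd.le]
      exact top_ne_zero hl
    · simp only [coeff_homSlice]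
      fun_prop
  let K := rootConf (p (0, 1)) (hcard (0, 1))
  have h01 : ∀ τ : I, rootConf (p (0, τ)) (hcard (0, τ)) = rootConf (p (1, τ)) (hcard (1, τ)) := by
    intro τ
    apply Subtype.ext
    simp [rootConf, p, turn_zero, turn_one]
  have hstart : ∀ t, ω.map (continuous_fiberConf hS) t = rootConf (p (t, 0)) (hcard (t, 0)) := by
    intro t
    refine Conf.ext_mem fun y => ?_
    have hp0 : p (t, 0) = homSlice f m 1 (1 * (c + turn t * ((u : ℂ) - c))) := by simp [p]
    have h1 := eval_homSlice_mul (f := f) hd.le 1 (c + turn t * ((u : ℂ) - c)) y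
    rw [one_mul y, ← hp0, one_pow, one_mul] at h1
    rw [mem_rootConf (hne _), h1]
    have h2 : y ∈ (fiberConf hS (ω t)).1 ↔ y ∈ fiber S (ω t) := by simp [fiberConf]
    refine h2.trans ?_
    rw [hω t]
    exact hmem _ _
  have hend : ∀ t, rotation K t = rootConf (p (t, 1)) (hcard (t, 1)) := by
    intro t
    refine Conf.ext_mem fun y => ?_
    rw [mem_rootConf (hne _)]
    change y ∈ K.1.image (fun z => turn t * z) ↔ _
    have h0 : ∀ (s : I) (z : ℂ), (p (s, 1)).eval (turn s * ((u : ℂ) - c) * z) = 0 ↔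
        MvPolynomial.eval ![1, z] (MvPolynomial.homogeneousComponent m f) = 0 := by
      intro s z
      simp only [p, Icc.coe_one, sub_self, Complex.ofReal_zero, zero_mul, zero_add]
      rw [eval_homSlice_zero hd.le, mul_eq_zero, or_iff_right (pow_ne_zero _ (hw _))]
    rw [Finset.mem_image]
    have hw0 : (u : ℂ) - c ≠ 0 := by simpa [turn_zero] using hw 0
    constructor
    · rintro ⟨z, hz, rfl⟩
      rw [mem_rootConf (hne _)] at hz
      have e1 : z = turn (0 : I) * ((u : ℂ) - c) * (z / ((u : ℂ) - c)) := by
        simp [turn_zero]; field_simp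
      have e2 : turn t * z = turn t * ((u : ℂ) - c) * (z / ((u : ℂ) - c)) := by field_simp
      rw [e2, h0, ← h0 0, ← e1]
      exact hz
    · intro hy
      have e2 : y = turn t * ((u : ℂ) - c) * (y / (turn t * ((u : ℂ) - c))) := by
        have := turn_ne_zero t
        field_simp
      rw [e2, h0, ← h0 0] at hy
      refine ⟨_, (mem_rootConf (hne _) _ _).2 hy, ?_⟩
      have := turn_ne_zero t
      simp [turn_zero]
      field_simp
  obtain ⟨r, hr⟩ := exists_lasso_of_homotopy hcont h01 hstart hend
  rw [← lasso_deltaSq r]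
  exact hr.symm

end Infinity

/-! ### Free homotopy of loops -/

section FreeHomotopy

open scoped unitInterval

variable {X : Type*} [TopologicalSpace X] {a b c : X}

/-- The loop `w` is the transport of the loop `w'` along some path. -/
def FreelyHomotopic (w : Path a a) (w' : Path b b) : Prop :=
  ∃ r : Path a b, lasso (.mk r) (FundamentalGroup.fromPath (.mk w')) =
    FundamentalGroup.fromPath (.mk w)

lemma FreelyHomotopic.symm {w : Path a a} {w' : Path b b} (h : FreelyHomotopic w w') :
    FreelyHomotopic w' w := by
  obtain ⟨r, hr⟩ := h
  refine ⟨r.symm, ?_⟩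
  rw [← hr]
  exact lasso_symm_lasso (.mk r) _

lemma FreelyHomotopic.trans {w : Path a a} {w' : Path b b} {w'' : Path c c}
    (h : FreelyHomotopic w w') (h' : FreelyHomotopic w' w'') : FreelyHomotopic w w'' := by
  obtain ⟨r, hr⟩ := h
  obtain ⟨r', hr'⟩ := h'
  refine ⟨r.trans r', ?_⟩
  rw [← hr, ← hr']
  exact lasso_trans (.mk r) (.mk r') _

end FreeHomotopy

/-! ### Configurations with a distinguished pair -/

section Pair

open scoped unitInterval Topology
open Polynomial

lemma continuous_coeff_mul {T : Type} [TopologicalSpace T] {p q : T → ℂ[X]}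
    (hp : ∀ k, Continuous fun t => (p t).coeff k) (hq : ∀ k, Continuous fun t => (q t).coeff k)
    (k : ℕ) : Continuous fun t => (p t * q t).coeff k := by
  simp only [coeff_mul]
  exact continuous_finsetSum _ fun x _ => (hp _).mul (hq _)

lemma continuous_coeff_prod {T ι : Type} [TopologicalSpace T] (s : Finset ι) {p : ι → T → ℂ[X]}
    (hp : ∀ i k, Continuous fun t => (p i t).coeff k) (k : ℕ) :
    Continuous fun t => (∏ i ∈ s, p i t).coeff k := by
  classical
  induction s using Finset.induction_on generalizing k with
  | empty => simpa using continuous_const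
  | insert i s hi ih =>
    simp only [Finset.prod_insert hi]
    exact continuous_coeff_mul (hp i) ih k

lemma continuous_coeff_X_sub_C {T : Type} [TopologicalSpace T] {a : T → ℂ} (ha : Continuous a)
    (k : ℕ) : Continuous fun t => (X - C (a t)).coeff k := by
  simp only [coeff_sub, coeff_C]
  split_ifs <;> fun_prop

variable {k : ℕ}

/-- The monic polynomial with the zeros `c ± √Δ` and `q j`. -/
def pairPoly (c Δ : ℂ) (q : Fin k → ℂ) : ℂ[X] := ((X - C c) ^ 2 - C Δ) * ∏ j, (X - C (q j))

/-- The zeros of `pairPoly c Δ q` are distinct. -/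
def IsSplit (c Δ : ℂ) (q : Fin k → ℂ) : Prop :=
  Δ ≠ 0 ∧ Function.Injective q ∧ ∀ j, (q j - c) ^ 2 ≠ Δ

lemma eval_pairPoly (c Δ : ℂ) (q : Fin k → ℂ) (y : ℂ) :
    (pairPoly c Δ q).eval y = ((y - c) ^ 2 - Δ) * ∏ j, (y - q j) := by
  simp [pairPoly, eval_prod]

lemma monic_quad (c Δ : ℂ) : ((X - C c) ^ 2 - C Δ).Monic :=
  ((monic_X_sub_C c).pow 2).sub_of_left (by
    rw [degree_pow, degree_X_sub_C]
    exact degree_C_le.trans_lt (by norm_num))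

lemma natDegree_quad (c Δ : ℂ) : ((X - C c) ^ 2 - C Δ).natDegree = 2 := by
  rw [natDegree_sub_C, natDegree_pow, natDegree_X_sub_C]

lemma monic_pairPoly (c Δ : ℂ) (q : Fin k → ℂ) : (pairPoly c Δ q).Monic :=
  (monic_quad c Δ).mul (monic_prod_of_monic _ _ fun _ _ => monic_X_sub_C _)

lemma natDegree_pairPoly (c Δ : ℂ) (q : Fin k → ℂ) : (pairPoly c Δ q).natDegree = k + 2 := by
  rw [pairPoly, (monic_quad c Δ).natDegree_mul (monic_prod_of_monic _ _ fun j _ => monic_X_sub_C _),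
    natDegree_quad, natDegree_prod_of_monic _ _ fun _ _ => monic_X_sub_C _]
  simp [add_comm]

lemma card_pairPoly {c Δ : ℂ} {q : Fin k → ℂ} (h : IsSplit c Δ q) :
    (pairPoly c Δ q).roots.toFinset.card = k + 2 := by
  obtain ⟨s, hs⟩ := IsAlgClosed.exists_pow_nat_eq Δ two_pos
  have hs0 : s ≠ 0 := by
    rintro rfl
    exact h.1 (by rw [← hs]; simp)
  have e : (pairPoly c Δ q).roots.toFinset =
      insert (c + s) (insert (c - s) (Finset.univ.image q)) := by
    ext y
    simp only [Multiset.mem_toFinset, mem_roots (monic_pairPoly c Δ q).ne_zero, IsRoot,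
      eval_pairPoly, mul_eq_zero, Finset.prod_eq_zero_iff, Finset.mem_univ, true_and,
      Finset.mem_insert, Finset.mem_image]
    have h1 : (y - c) ^ 2 - s ^ 2 = 0 ↔ y = c + s ∨ y = c - s := by
      rw [sub_eq_zero, sq_eq_sq_iff_eq_or_eq_neg, sub_eq_iff_eq_add, sub_eq_iff_eq_add, add_comm s,
        neg_add_eq_sub]
    rw [← hs, h1, or_assoc]
    simp only [sub_eq_zero, eq_comm]
  have h2 : c - s ∉ Finset.univ.image q := by
    simp only [Finset.mem_image, Finset.mem_univ, true_and, not_exists]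
    intro j hj
    exact h.2.2 j (by rw [hj, ← hs]; ring)
  have h3 : c + s ∉ insert (c - s) (Finset.univ.image q) := by
    simp only [Finset.mem_insert, Finset.mem_image, Finset.mem_univ, true_and, not_or, not_exists]
    refine ⟨fun h => hs0 ?_, fun j hj => h.2.2 j (by rw [hj, ← hs]; ring)⟩
    have : 2 * s = 0 := by linear_combination h
    simpa using this
  rw [e, Finset.card_insert_of_notMem h3, Finset.card_insert_of_notMem h2,
    Finset.card_image_of_injective _ h.2.1, Finset.card_univ, Fintype.card_fin]

/-- The configuration of the points `c ± √Δ` and `q j`. -/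
def pairConf (c Δ : ℂ) (q : Fin k → ℂ) (h : IsSplit c Δ q) : Conf (k + 2) :=
  rootConf (pairPoly c Δ q) (card_pairPoly h)

lemma mem_pairConf {c Δ : ℂ} {q : Fin k → ℂ} (h : IsSplit c Δ q) (y : ℂ) :
    y ∈ (pairConf c Δ q h).1 ↔ (y - c) ^ 2 = Δ ∨ ∃ j, y = q j := by
  rw [pairConf, mem_rootConf (monic_pairPoly c Δ q).ne_zero, eval_pairPoly, mul_eq_zero,
    Finset.prod_eq_zero_iff]
  simp [sub_eq_zero]

lemma continuous_pairConf {T : Type} [TopologicalSpace T] {c Δ : T → ℂ} {q : T → Fin k → ℂ}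
    (hc : Continuous c) (hΔ : Continuous Δ) (hq : Continuous q)
    (h : ∀ t, IsSplit (c t) (Δ t) (q t)) :
    Continuous fun t => pairConf (c t) (Δ t) (q t) (h t) := by
  refine continuous_rootConf (fun t => (natDegree_pairPoly _ _ _).le) (fun t => ?_) (fun i => ?_) _
  · rw [← natDegree_pairPoly (c t) (Δ t) (q t), coeff_natDegree, (monic_pairPoly _ _ _)]
    exact one_ne_zero
  · refine continuous_coeff_mul (fun i => ?_) (fun i => continuous_coeff_prod _ (fun j i =>
      continuous_coeff_X_sub_C (by fun_prop) i) i) i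
    simp only [sq, coeff_sub, coeff_C]
    refine (continuous_coeff_mul (continuous_coeff_X_sub_C hc) (continuous_coeff_X_sub_C hc) i).sub
      ?_
    split_ifs <;> fun_prop

/-- The points `q j` are distinct, and the disc with centre `c` on whose boundary the points
`c ± √Δ` lie contains none of them. -/
def IsWide (c Δ : ℂ) (q : Fin k → ℂ) : Prop :=
  Δ ≠ 0 ∧ Function.Injective q ∧ ∀ j, ‖Δ‖ < ‖q j - c‖ ^ 2

lemma IsWide.isSplit {c Δ : ℂ} {q : Fin k → ℂ} (h : IsWide c Δ q) (t : ℝ) :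
    IsSplit c (turn t * Δ) q := by
  refine ⟨mul_ne_zero (turn_ne_zero _) h.1, h.2.1, fun j hj => ?_⟩
  have := congrArg norm hj
  rw [norm_pow, norm_mul, norm_turn, one_mul] at this
  exact (h.2.2 j).ne' this

lemma pairConf_congr {c Δ c' Δ' : ℂ} {q q' : Fin k → ℂ} {h : IsSplit c Δ q} {h' : IsSplit c' Δ' q'}
    (e1 : c = c') (e2 : Δ = Δ') (e3 : q = q') : pairConf c Δ q h = pairConf c' Δ' q' h' := by
  subst e1 e2 e3
  rfl

/-- The half turn of the pair of points `c ± √Δ`. -/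
def pairLoop {c Δ : ℂ} {q : Fin k → ℂ} (h : IsWide c Δ q) :
    Path (pairConf c (turn 0 * Δ) q (h.isSplit 0)) (pairConf c (turn 0 * Δ) q (h.isSplit 0)) where
  toFun t := pairConf c (turn t * Δ) q (h.isSplit t)
  continuous_toFun := continuous_pairConf (by fun_prop) (by fun_prop) (by fun_prop) _
  source' := rfl
  target' := pairConf_congr rfl (by simp [turn_zero, turn_one]) rfl

lemma freelyHomotopic_pairLoop {c Δ : I → ℂ} {q : I → Fin k → ℂ} (hc : Continuous c)
    (hΔ : Continuous Δ) (hq : Continuous q) (h : ∀ τ, IsWide (c τ) (Δ τ) (q τ)) :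
    FreelyHomotopic (pairLoop (h 0)) (pairLoop (h 1)) := by
  refine exists_lasso_of_homotopy (H := fun x : I × I => pairConf (c x.2) (turn x.1 * Δ x.2) (q x.2)
    ((h x.2).isSplit x.1)) (continuous_pairConf (by fun_prop) (by fun_prop) (by fun_prop) _)
    (fun τ => ?_) (fun t => rfl) fun t => rfl
  exact pairConf_congr rfl (by simp [turn_zero, turn_one]) rfl

lemma freelyHomotopic_pairLoop' {c Δ : I → ℂ} {q : I → Fin k → ℂ} (hc : Continuous c)
    (hΔ : Continuous Δ) (hq : Continuous q) (h : ∀ τ, IsWide (c τ) (Δ τ) (q τ))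
    {c₀ Δ₀ c₁ Δ₁ : ℂ} {q₀ q₁ : Fin k → ℂ} (h₀ : IsWide c₀ Δ₀ q₀) (h₁ : IsWide c₁ Δ₁ q₁)
    (e1 : c 0 = c₀) (e2 : Δ 0 = Δ₀) (e3 : q 0 = q₀) (e4 : c 1 = c₁) (e5 : Δ 1 = Δ₁)
    (e6 : q 1 = q₁) : FreelyHomotopic (pairLoop h₀) (pairLoop h₁) := by
  subst e1 e2 e3 e4 e5 e6
  exact freelyHomotopic_pairLoop hc hΔ hq h

/-- The modulus of `Δ` moves linearly to `η` while its argument moves to `0`; the modulus never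
exceeds `‖Δ‖`, so the pair stays apart from the points `q j`. -/
lemma freelyHomotopic_shrink {c Δ : ℂ} {q : Fin k → ℂ} (h : IsWide c Δ q) {η : ℝ} (hη : 0 < η)
    (hηΔ : η ≤ ‖Δ‖) (h' : IsWide c η q) : FreelyHomotopic (pairLoop h) (pairLoop h') := by
  have hn : ∀ τ : I, 0 < (1 - τ : ℝ) * ‖Δ‖ + τ * η := by
    intro τ
    have h1 := τ.2.1
    have h2 := τ.2.2
    nlinarith
  have hnorm : ∀ τ : I, ‖(((1 - τ : ℝ) * ‖Δ‖ + τ * η : ℝ) : ℂ) *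
      Complex.exp (((1 - τ : ℝ) * Complex.arg Δ : ℝ) * Complex.I)‖ =
      (1 - τ : ℝ) * ‖Δ‖ + τ * η := by
    intro τ
    rw [norm_mul, Complex.norm_exp_ofReal_mul_I, mul_one, Complex.norm_real,
      Real.norm_of_nonneg (hn τ).le]
  refine freelyHomotopic_pairLoop' (c := fun _ => c) (q := fun _ => q)
    (Δ := fun τ => (((1 - τ : ℝ) * ‖Δ‖ + τ * η : ℝ) : ℂ) *
      Complex.exp (((1 - τ : ℝ) * Complex.arg Δ : ℝ) * Complex.I)) (by fun_prop) (by fun_prop)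
    (by fun_prop) (fun τ => ⟨?_, h.2.1, fun j => ?_⟩) h h' rfl ?_ rfl rfl ?_ rfl
  · rw [← norm_pos_iff, hnorm]
    exact hn τ
  · rw [hnorm]
    refine lt_of_le_of_lt ?_ (h.2.2 j)
    have h1 := τ.2.1
    have h2 := τ.2.2
    nlinarith
  · simp
  · simp

/-- Any two tuples of distinct points of the complex line are joined by a path of such tuples. -/
lemma exists_path_injective {ι : Type} [Finite ι] {z w : ι → ℂ} (hz : Function.Injective z)
    (hw : Function.Injective w) : ∃ l : I → ℂ, Continuous l ∧ l 0 = 0 ∧ l 1 = 1 ∧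
      ∀ τ, Function.Injective fun i => (1 - l τ) * z i + l τ * w i := by
  -- Complex parameters at which two points of the interpolation collide. Each pair collides for at
  -- most one `l`, so the set is finite and can be avoided in the plane between `0` and `1`.
  let F : Set ℂ := ⋃ p : ι × ι, {l | p.1 ≠ p.2 ∧ (1 - l) * z p.1 + l * w p.1 =
    (1 - l) * z p.2 + l * w p.2}
  have hF : F.Finite := by
    refine finite_iUnion fun p => ?_
    refine Subsingleton.finite ?_
    rintro l ⟨hne, hl⟩ l' ⟨-, hl'⟩
    have h0 : z p.1 - z p.2 ≠ 0 := sub_ne_zero.2 (hz.ne hne)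
    have h1 : (z p.1 - z p.2) * (l - l') = 0 := by
      linear_combination l * hl' - l' * hl
    exact sub_eq_zero.1 ((mul_eq_zero.1 h1).resolve_left h0)
  have h0 : (0 : ℂ) ∈ Fᶜ := by
    simp only [F, mem_compl_iff, mem_iUnion, mem_ofPred_eq, not_exists, not_and]
    intro p hp h
    exact hp (hz (by simpa using h))
  have h1 : (1 : ℂ) ∈ Fᶜ := by
    simp only [F, mem_compl_iff, mem_iUnion, mem_ofPred_eq, not_exists, not_and]
    intro p hp h
    exact hp (hw (by simpa using h))
  obtain ⟨γ, hγ⟩ := (Set.Countable.isPathConnected_compl_of_one_lt_rank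
    (by rw [Complex.rank_real_complex]; norm_num) hF.countable).joinedIn 0 h0 1 h1
  refine ⟨γ, γ.continuous, γ.source, γ.target, fun τ i j hij => ?_⟩
  by_contra hne
  exact hγ τ (mem_iUnion.2 ⟨(i, j), hne, hij⟩)

lemma eventually_lt_of_continuous {f : I → ℝ} (hf : Continuous f) (hpos : ∀ τ, 0 < f τ) :
    ∀ᶠ η in 𝓝[>] (0 : ℝ), ∀ τ, η < f τ := by
  obtain ⟨τ₀, -, h0⟩ := isCompact_univ.exists_isMinOn (univ_nonempty (α := I)) hf.continuousOn
  filter_upwards [Ioo_mem_nhdsGT (hpos τ₀)] with η hη τ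
  exact hη.2.trans_le (h0 (mem_univ τ))

/-- Any two half turns of pairs are freely homotopic. -/
lemma freelyHomotopic_of_isWide {c Δ c' Δ' : ℂ} {q q' : Fin k → ℂ} (h : IsWide c Δ q)
    (h' : IsWide c' Δ' q') : FreelyHomotopic (pairLoop h) (pairLoop h') := by
  let z : Option (Fin k) → ℂ := fun o => o.elim c q
  let w : Option (Fin k) → ℂ := fun o => o.elim c' q'
  have hinj : ∀ {c Δ : ℂ} {q : Fin k → ℂ}, IsWide c Δ q →
      Function.Injective (fun o : Option (Fin k) => o.elim c q) := by
    intro c Δ q h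
    have hne : ∀ j, c ≠ q j := fun j hj => by
      have := h.2.2 j
      rw [hj, sub_self, norm_zero] at this
      nlinarith [norm_nonneg Δ]
    rintro (_ | i) (_ | j) hij
    · rfl
    · exact absurd hij (hne j)
    · exact absurd hij.symm (hne i)
    · rw [h.2.1 hij]
  obtain ⟨l, hl, hl0, hl1, hli⟩ := exists_path_injective (z := z) (w := w) (hinj h) (hinj h')
  let cc : I → ℂ := fun τ => (1 - l τ) * c + l τ * c'
  let qq : I → Fin k → ℂ := fun τ j => (1 - l τ) * q j + l τ * q' j
  have hpos : ∀ j τ, 0 < ‖qq τ j - cc τ‖ ^ 2 := by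
    intro j τ
    have h1 : qq τ j ≠ cc τ := fun hh => by
      have := hli τ (a₁ := some j) (a₂ := none) hh
      simp at this
    have := norm_pos_iff.2 (sub_ne_zero.2 h1)
    positivity
  -- By compactness one small `η` serves along the whole path: both pairs are shrunk to `η`, and the
  -- small pair is carried along.
  have hev : ∀ᶠ η in 𝓝[>] (0 : ℝ), (∀ j τ, η < ‖qq τ j - cc τ‖ ^ 2) ∧
      η < ‖Δ‖ ∧ η < ‖Δ'‖ ∧ 0 < η := by
    refine (Filter.eventually_all.2 fun j => eventually_lt_of_continuous (by fun_prop)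
      (hpos j)).and ?_
    filter_upwards [Ioo_mem_nhdsGT (norm_pos_iff.2 h.1), Ioo_mem_nhdsGT (norm_pos_iff.2 h'.1)]
      with η h1 h2
    exact ⟨h1.2, h2.2, h1.1⟩
  obtain ⟨η, hη, hη1, hη2, hη0⟩ := hev.exists
  have hw : ∀ τ, IsWide (cc τ) (η : ℂ) (qq τ) := by
    intro τ
    refine ⟨by exact_mod_cast hη0.ne', fun i j hij => ?_, fun j => ?_⟩
    · have := hli τ (a₁ := some i) (a₂ := some j) hij
      simpa using this
    · rw [Complex.norm_real, Real.norm_of_nonneg hη0.le]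
      exact hη j τ
  have hw0 : IsWide c (η : ℂ) q := by simpa [cc, qq, hl0] using hw 0
  have hw1 : IsWide c' (η : ℂ) q' := by simpa [cc, qq, hl1] using hw 1
  refine (freelyHomotopic_shrink h hη0 hη1.le hw0).trans (FreelyHomotopic.trans ?_
    (freelyHomotopic_shrink h' hη0 hη2.le hw1).symm)
  exact freelyHomotopic_pairLoop' (Δ := fun _ => (η : ℂ)) (c := cc) (q := qq) (by fun_prop)
    (by fun_prop) (by fun_prop) hw hw0 hw1 (by simp [cc, hl0]) rfl (by simp [qq, hl0])
    (by simp [cc, hl1]) rfl (by simp [qq, hl1])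

/-- The standard configuration: the pair `0, 1` is `1 / 2 ± √(1 / 4)`, the other points are `2, 3,
…`. -/
lemma isWide_std (k : ℕ) : IsWide (1 / 2) (1 / 4) fun j : Fin k => ((j : ℕ) : ℂ) + 2 := by
  refine ⟨by norm_num, fun i j hij => ?_, fun j => ?_⟩
  · have : ((i : ℕ) : ℂ) = ((j : ℕ) : ℂ) := by simpa using hij
    exact Fin.ext (by exact_mod_cast this)
  · have e : ((j : ℕ) : ℂ) + 2 - 1 / 2 = (((j : ℕ) + 3 / 2 : ℝ) : ℂ) := by push_cast; ring
    have h0 : (0 : ℝ) ≤ (j : ℕ) := Nat.cast_nonneg _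
    rw [e, Complex.norm_real, Real.norm_of_nonneg (by positivity)]
    norm_num
    nlinarith

lemma turn_half_sq (t : ℝ) : turn (t / 2) ^ 2 = turn t := by
  rw [sq, ← turn_add]
  congr 1
  ring

/-- A half turn of the pair is a full turn of its discriminant `Δ`, by `turn (t / 2) ^ 2 = turn t`.
-/
lemma halfTwist_apply (k : ℕ) (t : I) : halfTwist (k + 2) 0 (by omega) t =
    pairConf (1 / 2) (turn t * (1 / 4)) _ ((isWide_std k).isSplit t) := by
  refine Conf.ext_mem fun y => ?_
  rw [mem_pairConf]
  change y ∈ (Finset.range (k + 2)).image (swapMotion 0 t) ↔ _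
  have hsq := turn_half_sq t
  have e : (y - 1 / 2) ^ 2 = turn t * (1 / 4) ↔ y = swapMotion 0 t 0 ∨ y = swapMotion 0 t 1 := by
    have h1 : turn t * (1 / 4) = (turn (t / 2) / 2) ^ 2 := by rw [← hsq]; ring
    rw [h1, sq_eq_sq_iff_eq_or_eq_neg, or_comm]
    simp only [swapMotion, if_true, Nat.cast_zero, zero_add, one_ne_zero, if_false]
    constructor
    · rintro (h | h)
      · left; linear_combination h
      · right; linear_combination h
    · rintro (h | h)
      · left; linear_combination h
      · right; linear_combination h
  rw [e, Finset.mem_image]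
  constructor
  · rintro ⟨j, hj, rfl⟩
    rw [Finset.mem_range] at hj
    rcases j with _ | _ | j
    · exact Or.inl (Or.inl rfl)
    · exact Or.inl (Or.inr rfl)
    · refine Or.inr ⟨⟨j, by omega⟩, ?_⟩
      simp only [swapMotion]
      rw [if_neg (by omega), if_neg (by omega)]
      push_cast
      ring
  · rintro ((rfl | rfl) | ⟨j, rfl⟩)
    · exact ⟨0, by simp, rfl⟩
    · exact ⟨1, by simp, rfl⟩
    · refine ⟨j + 2, by simp, ?_⟩
      simp only [swapMotion]
      rw [if_neg (by omega), if_neg (by omega)]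
      push_cast
      ring

lemma freelyHomotopic_halfTwist {c Δ : ℂ} {q : Fin k → ℂ} (h : IsWide c Δ q) :
    FreelyHomotopic (pairLoop h) (halfTwist (k + 2) 0 (by omega)) := by
  refine (freelyHomotopic_of_isWide h (isWide_std k)).trans ?_
  refine exists_lasso_of_homotopy (H := fun x : I × I => pairConf (1 / 2) (turn x.1 * (1 / 4)) _
    ((isWide_std k).isSplit x.1)) (continuous_pairConf (by fun_prop) (by fun_prop) (by fun_prop) _)
    (fun τ => ?_) (fun t => rfl) (halfTwist_apply k)
  exact pairConf_congr rfl (by simp [turn_zero, turn_one]) rfl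

end Pair

/-! ### Positive braids -/

section Positive

variable {m : ℕ} {K K' : Conf m}

lemma IsFrameElement.lasso {b : Braid K'} (hb : IsFrameElement K' b)
    (q : Path.Homotopic.Quotient K K') : IsFrameElement K (lasso q b) := by
  induction q using Path.Homotopic.Quotient.ind with | mk r =>
  obtain ⟨γ, i, hi, rfl⟩ := hb
  refine ⟨r.trans γ, i, hi, ?_⟩
  rw [← lasso_mk, ← lasso_mk]
  exact (lasso_trans (.mk r) (.mk γ) _).symm

lemma IsPositive.lasso {b : Braid K'} (hb : IsPositive K' b)
    (q : Path.Homotopic.Quotient K K') : IsPositive K (lasso q b) := by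
  induction hb using Subsemigroup.closure_induction with
  | mem x hx =>
    obtain ⟨g, h, hh, rfl⟩ := hx
    refine Subsemigroup.subset_closure ⟨BraidMonodromy.lasso q g, _, hh.lasso q, ?_⟩
    have h2 := map_inv (lassoEquiv q) g
    change BraidMonodromy.lasso q g⁻¹ = (BraidMonodromy.lasso q g)⁻¹ at h2
    rw [lasso_mul, lasso_mul, h2]
  | mul x y _ _ hx hy =>
    rw [lasso_mul]
    exact Subsemigroup.mul_mem _ hx hy

lemma IsFrameElement.isPositive {b : Braid K} (hb : IsFrameElement K b) : IsPositive K b :=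
  Subsemigroup.subset_closure ⟨1, b, hb, by rw [one_mul, inv_one, mul_one]⟩

lemma isPositive_list_prod {l : List (Braid K)} (hl : l ≠ []) (h : ∀ b ∈ l, IsPositive K b) :
    IsPositive K l.prod := by
  induction l with
  | nil => exact absurd rfl hl
  | cons a l ih =>
    rw [List.prod_cons]
    rcases eq_or_ne l [] with rfl | hne
    · rw [List.prod_nil, mul_one]
      exact h a (by simp)
    · exact Subsemigroup.mul_mem _ (h a (by simp)) (ih hne fun b hb => h b (by simp [hb]))

lemma isPositive_of_freelyHomotopic {w : Path K K} {w' : Path K' K'} (h : FreelyHomotopic w w')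
    (hw' : IsPositive K' (FundamentalGroup.fromPath (.mk w'))) :
    IsPositive K (FundamentalGroup.fromPath (.mk w)) := by
  obtain ⟨r, hr⟩ := h
  rw [← hr]
  exact hw'.lasso _

lemma isPositive_of_freelyHomotopic_halfTwist {i : ℕ} {hi : i + 1 < m} {w : Path K K}
    (h : FreelyHomotopic w (halfTwist m i hi)) :
    IsPositive K (FundamentalGroup.fromPath (.mk w)) := by
  obtain ⟨r, hr⟩ := h
  rw [← hr]
  exact IsFrameElement.isPositive ⟨r, i, hi, rfl⟩

end Positive

/-! ### Simple zeros of the discriminant -/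

section Discriminant

open Polynomial

lemma derivative_det {n : Type} [Fintype n] [DecidableEq n] (A : Matrix n n ℂ[X]) :
    derivative A.det = ∑ j, (A.updateCol j fun i => derivative (A i j)).det := by
  have h0 : ∀ j, (A.updateCol j fun i => derivative (A i j)).det =
      ∑ σ : Equiv.Perm n, ((Equiv.Perm.sign σ : ℤ) : ℂ[X]) *
        ((∏ i ∈ Finset.univ.erase j, A (σ i) i) * derivative (A (σ j) j)) := by
    intro j
    rw [Matrix.det_apply']
    refine Finset.sum_congr rfl fun σ _ => ?_
    rw [← Finset.mul_prod_erase _ _ (Finset.mem_univ j), Matrix.updateCol_self,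
      mul_comm (derivative _)]
    congr 2
    refine Finset.prod_congr rfl fun i hi => ?_
    rw [Matrix.updateCol_ne (Finset.ne_of_mem_erase hi)]
  rw [Finset.sum_congr rfl fun j _ => h0 j, Finset.sum_comm, Matrix.det_apply', derivative_sum]
  refine Finset.sum_congr rfl fun σ _ => ?_
  rw [derivative_mul, derivative_intCast, zero_mul, zero_add, derivative_prod_finset,
    Finset.mul_sum]

/-- The summand `j` of the derivative differs from `A` only in column `j`, so a kernel vector at `b`
vanishing at `j` remains in its kernel. A kernel of dimension two provides such vectors. -/
lemma eval_derivative_det_eq_zero {n : Type} [Fintype n] [DecidableEq n] (A : Matrix n n ℂ[X])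
    (b : ℂ) (h : ∀ j, ∃ w : n → ℂ, w ≠ 0 ∧ w j = 0 ∧
      ((evalRingHom b).mapMatrix A).mulVec w = 0) : (derivative A.det).eval b = 0 := by
  rw [derivative_det, eval_finsetSum]
  refine Finset.sum_eq_zero fun j _ => ?_
  obtain ⟨w, hw, hj, h0⟩ := h j
  rw [← coe_evalRingHom, RingHom.map_det]
  refine Matrix.exists_mulVec_eq_zero_iff.1 ⟨w, hw, ?_⟩
  rw [← h0]
  funext i
  simp only [Matrix.mulVec, dotProduct]
  refine Finset.sum_congr rfl fun l _ => ?_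
  by_cases hl : l = j
  · subst hl
    rw [hj, mul_zero, mul_zero]
  · simp [Matrix.updateCol_ne hl]

/-- The fibre over `x` of a polynomial in two variables. -/
def spec (P : ℂ[X][X]) (x : ℂ) : ℂ[X] := P.map (evalRingHom x)

/-- The discriminant, as a polynomial in the first variable. -/
def discPoly (P : ℂ[X][X]) (m : ℕ) : ℂ[X] := resultant P (derivative P) m (m - 1)

variable {P : ℂ[X][X]} {m : ℕ}

lemma eval_discPoly (P : ℂ[X][X]) (m : ℕ) (x : ℂ) :
    (discPoly P m).eval x = resultant (spec P x) (derivative (spec P x)) m (m - 1) := by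
  rw [discPoly, spec, derivative_map, resultant_map_map, coe_evalRingHom]

lemma monic_spec (hP : P.Monic) (x : ℂ) : (spec P x).Monic := hP.map _

lemma natDegree_spec (hP : P.Monic) (x : ℂ) : (spec P x).natDegree = P.natDegree :=
  hP.natDegree_map _

lemma resultant_derivative {p : ℂ[X]} (hp : p.Monic) (hm : p.natDegree = m) :
    resultant p (derivative p) m (m - 1) = (p.roots.map (derivative p).eval).prod := by
  subst hm
  rw [resultant_eq_prod_eval _ _ _ (natDegree_derivative_le p) (IsAlgClosed.splits p),
    hp.leadingCoeff, one_pow, one_mul]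

lemma nodup_roots_iff {p : ℂ[X]} (hp : p ≠ 0) :
    p.roots.Nodup ↔ ∀ y ∈ p.roots, (derivative p).eval y ≠ 0 := by
  rw [Multiset.nodup_iff_count_le_one]
  constructor
  · intro h y hy h0
    have h1 := (one_lt_rootMultiplicity_iff_isRoot hp).2 ⟨(mem_roots hp).1 hy, h0⟩
    have h2 := h y
    rw [count_roots] at h2
    omega
  · intro h y
    rw [count_roots]
    by_contra hlt
    obtain ⟨h1, h2⟩ := (one_lt_rootMultiplicity_iff_isRoot hp).1 (not_le.1 hlt)
    exact h y ((mem_roots hp).2 h1) h2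

lemma resultant_derivative_ne_zero_iff {p : ℂ[X]} (hp : p.Monic) (hm : p.natDegree = m) :
    resultant p (derivative p) m (m - 1) ≠ 0 ↔ p.roots.toFinset.card = m := by
  have hcard : p.roots.card = m := by rw [← hm]; exact (IsAlgClosed.splits p).natDegree_eq_card_roots.symm
  rw [resultant_derivative hp hm, Ne, Multiset.prod_eq_zero_iff, Multiset.mem_map]
  have h1 : p.roots.toFinset.card = m ↔ p.roots.Nodup := by
    rw [← Multiset.toFinset_card_eq_card_iff_nodup, hcard]
  rw [h1, nodup_roots_iff hp.ne_zero]
  push Not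
  rfl

lemma eval_discPoly_ne_zero_iff (hP : P.Monic) (hm : P.natDegree = m) (x : ℂ) :
    (discPoly P m).eval x ≠ 0 ↔ (spec P x).roots.toFinset.card = m := by
  rw [eval_discPoly, resultant_derivative_ne_zero_iff (monic_spec hP x)
    ((natDegree_spec hP x).trans hm)]

/-- With `f = d * f₁` and `g = d * g₁`, the syzygies `(-f₁ * h, g₁ * h)` with `h` of degree at most
one form a plane in the kernel, and some nonzero element of a plane has vanishing coordinate `j`. -/
lemma exists_kernel_sylvester {f g d : ℂ[X]} {n : ℕ} (hf : f.natDegree ≤ m) (hg : g.natDegree ≤ n)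
    (hf0 : f ≠ 0) (hdf : d ∣ f) (hdg : d ∣ g) (hd : 2 ≤ d.natDegree) (j : Fin (m + n)) :
    ∃ w : Fin (m + n) → ℂ, w ≠ 0 ∧ w j = 0 ∧ (sylvester f g m n).mulVec w = 0 := by
  obtain ⟨f₁, rfl⟩ := hdf
  obtain ⟨g₁, rfl⟩ := hdg
  have hd0 : d ≠ 0 := left_ne_zero_of_mul hf0
  have hf10 : f₁ ≠ 0 := right_ne_zero_of_mul hf0
  have hdegf : f₁.natDegree + 2 ≤ m := by
    rw [natDegree_mul hd0 hf10] at hf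
    omega
  have hdegg : g₁ ≠ 0 → g₁.natDegree + 2 ≤ n := by
    intro h
    rw [natDegree_mul hd0 h] at hg
    omega
  have hmem : ∀ h : ℂ[X], h.natDegree ≤ 1 → -(f₁ * h) ∈ degreeLT ℂ m ∧ g₁ * h ∈ degreeLT ℂ n := by
    intro h hh
    rw [mem_degreeLT, mem_degreeLT, degree_neg]
    constructor
    · refine (degree_le_of_natDegree_le (n := m - 1) (natDegree_mul_le.trans (by omega))).trans_lt ?_
      exact_mod_cast (by omega : m - 1 < m)
    · rcases eq_or_ne g₁ 0 with h0 | h0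
      · rw [h0, zero_mul, degree_zero]
        exact WithBot.bot_lt_coe _
      · have := hdegg h0
        refine (degree_le_of_natDegree_le (n := n - 1) (natDegree_mul_le.trans (by omega))).trans_lt ?_
        exact_mod_cast (by omega : n - 1 < n)
  let v : ∀ h : ℂ[X], h.natDegree ≤ 1 → degreeLT ℂ m × degreeLT ℂ n := fun h hh =>
    (⟨_, (hmem h hh).1⟩, ⟨_, (hmem h hh).2⟩)
  let B := (((degreeLT.basis ℂ m).prod (degreeLT.basis ℂ n)).reindex finSumFinEquiv)
  have hker : ∀ h hh, (sylvester (d * f₁) (d * g₁) m n).mulVec (B.repr (v h hh)) = 0 := by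
    intro h hh
    rw [← toMatrix_sylvesterMap' _ _ hf hg, LinearMap.toMatrix_mulVec_repr]
    have : sylvesterMap (d * f₁) (d * g₁) hf hg (v h hh) = 0 := by
      apply Subtype.ext
      simp only [sylvesterMap, v, LinearMap.coe_mk, AddHom.coe_mk, ZeroMemClass.coe_zero]
      ring
    rw [this, map_zero]
    rfl
  let r : ℂ := B.repr (v X (natDegree_X_le)) j
  let r' : ℂ := B.repr (v 1 (by simp)) j
  have hlin : ∀ α β : ℂ, ∀ hh, v (C α * X + C β) hh = α • v X natDegree_X_le + β • v 1 (by simp) := by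
    intro α β hh
    refine Prod.ext (Subtype.ext ?_) (Subtype.ext ?_)
    · simp only [v, Prod.fst_add, Prod.smul_fst, Submodule.coe_add, Submodule.coe_smul, smul_eq_C_mul]
      ring
    · simp only [v, Prod.snd_add, Prod.smul_snd, Submodule.coe_add, Submodule.coe_smul, smul_eq_C_mul]
      ring
  obtain ⟨α, β, hαβ, h0⟩ : ∃ α β : ℂ, (α ≠ 0 ∨ β ≠ 0) ∧ α * r + β * r' = 0 := by
    rcases eq_or_ne r 0 with h | h
    · exact ⟨1, 0, Or.inl one_ne_zero, by rw [h]; ring⟩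
    · exact ⟨-r', r, Or.inr h, by ring⟩
  have hh : (C α * X + C β).natDegree ≤ 1 := natDegree_linear_le
  refine ⟨B.repr (v (C α * X + C β) hh), fun hz => ?_, ?_, hker _ hh⟩
  · have h1 : v (C α * X + C β) hh = 0 := by
      apply B.repr.injective
      rw [map_zero]
      exact DFunLike.coe_injective hz
    have h2 := congrArg (fun x : degreeLT ℂ m × degreeLT ℂ n => (x.1 : ℂ[X])) h1
    simp only [v, Prod.fst_zero, ZeroMemClass.coe_zero, neg_eq_zero, mul_eq_zero, hf10,
      false_or] at h2
    have h3 := congrArg (fun p => coeff p 1) h2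
    have h4 := congrArg (fun p => coeff p 0) h2
    simp at h3 h4
    rcases hαβ with h | h
    · exact h h3
    · exact h h4
  · rw [hlin α β hh, map_add, map_smul, map_smul]
    exact h0

/-- At a simple zero of the discriminant, the fibre and its derivative have no common factor of
degree two. -/
lemma natDegree_lt_two_of_simple (hP : P.Monic) (hm : P.natDegree = m) {b : ℂ}
    (hb : (derivative (discPoly P m)).eval b ≠ 0) {d : ℂ[X]} (h1 : d ∣ spec P b)
    (h2 : d ∣ derivative (spec P b)) : d.natDegree < 2 := by
  by_contra hd
  apply hb
  apply eval_derivative_det_eq_zero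
  intro j
  rw [← sylvester_map_map, ← derivative_map]
  refine exists_kernel_sylvester ((natDegree_spec hP b).trans hm).le ?_ (monic_spec hP b).ne_zero h1
    h2 (not_lt.1 hd) j
  refine (natDegree_derivative_le _).trans ?_
  exact Nat.sub_le_sub_right ((natDegree_spec hP b).trans hm).le 1

end Discriminant

/-! ### The fibres near a simple zero of the discriminant -/

section Local

open scoped unitInterval Topology
open Polynomial

lemma dvd_derivative_of_sq_dvd {p d : ℂ[X]} (h : d ^ 2 ∣ p) : d ∣ derivative p := by
  obtain ⟨q, rfl⟩ := h
  rw [sq, derivative_mul, derivative_mul]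
  exact ⟨derivative d * q + derivative d * q + d * derivative q, by ring⟩

lemma eq_quad {R : ℂ[X]} (hR : R.Monic) (hd : R.natDegree = 2) :
    ∃ c Δ : ℂ, R = (X - C c) ^ 2 - C Δ := by
  have h2 : R.coeff 2 = 1 := by rw [← hd]; exact hR
  refine ⟨-R.coeff 1 / 2, (R.coeff 1 / 2) ^ 2 - R.coeff 0, Polynomial.funext fun y => ?_⟩
  rw [eval_eq_sum_range, hd]
  simp only [Finset.sum_range_succ, Finset.range_zero, Finset.sum_empty, h2, eval_sub, eval_pow,
    eval_X, eval_C]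
  ring

lemma exists_pairPoly_of_dvd {k : ℕ} {p : ℂ[X]} (hp : p.Monic) (hd : p.natDegree = k + 2)
    {q : Fin k → ℂ} (hq : Function.Injective q) (hr : ∀ j, p.eval (q j) = 0) :
    ∃ c Δ : ℂ, p = pairPoly c Δ q := by
  have h1 : (∏ j, (X - C (q j))) ∣ p := by
    refine Finset.prod_dvd_of_coprime (fun i _ j _ hij => ?_) fun j _ => dvd_iff_isRoot.2 (hr j)
    exact isCoprime_X_sub_C_of_isUnit_sub (sub_ne_zero.2 (hq.ne hij)).isUnit
  obtain ⟨R, hR⟩ := h1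
  have hQ : (∏ j, (X - C (q j))).Monic := monic_prod_of_monic _ _ fun j _ => monic_X_sub_C _
  have hRm : R.Monic := hQ.of_mul_monic_left (hR ▸ hp)
  have hQd : (∏ j, (X - C (q j))).natDegree = k := by
    rw [natDegree_prod_of_monic _ _ fun _ _ => monic_X_sub_C _]
    simp
  have hRd : R.natDegree = 2 := by
    have := congrArg natDegree hR
    rw [hQ.natDegree_mul hRm, hd, hQd] at this
    omega
  obtain ⟨c, Δ, rfl⟩ := eq_quad hRm hRd
  exact ⟨c, Δ, by rw [hR, pairPoly, mul_comm]⟩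

/-- A polynomial with exactly one double root and otherwise simple roots. -/
lemma exists_double_root {k : ℕ} {p : ℂ[X]} (hp : p.Monic) (hd : p.natDegree = k + 2)
    (h0 : p.roots.toFinset.card ≠ k + 2)
    (h1 : ∀ d : ℂ[X], d ∣ p → d ∣ derivative p → d.natDegree < 2) :
    ∃ (c : ℂ) (q : Fin k → ℂ), Function.Injective q ∧ (∀ j, q j ≠ c) ∧ p = pairPoly c 0 q := by
  have hcard : p.roots.card = k + 2 := by
    rw [← hd]; exact (IsAlgClosed.splits p).natDegree_eq_card_roots.symm
  have hnd : ¬ p.roots.Nodup := fun h => h0 (by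
    rw [Multiset.toFinset_card_of_nodup h, hcard])
  obtain ⟨c, hc⟩ : ∃ c, 1 < p.roots.count c := by
    by_contra h
    push Not at h
    exact hnd (Multiset.nodup_iff_count_le_one.2 h)
  rw [count_roots] at hc
  have hdvd : (X - C c) ^ 2 ∣ p := (pow_dvd_pow _ hc).trans (pow_rootMultiplicity_dvd p c)
  obtain ⟨R, hR⟩ := hdvd
  have hcm : ((X - C c) ^ 2).Monic := (monic_X_sub_C c).pow 2
  have hRm : R.Monic := hcm.of_mul_monic_left (hR ▸ hp)
  have hRd : R.natDegree = k := by
    have := congrArg natDegree hR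
    rw [hcm.natDegree_mul hRm, hd, natDegree_pow, natDegree_X_sub_C] at this
    omega
  -- At a triple root, `(X - c) ^ 2` would divide both `p` and its derivative.
  have hRc : R.eval c ≠ 0 := by
    intro h
    obtain ⟨R', rfl⟩ := dvd_iff_isRoot.2 h
    have h2 : ((X - C c) ^ 2).natDegree < 2 := by
      refine h1 _ ⟨_, hR⟩ ?_
      rw [hR, show (X - C c) ^ 2 * ((X - C c) * R') = (X - C c) ^ 3 * R' by ring, derivative_mul,
        derivative_X_sub_C_pow]
      exact ⟨C ((3 : ℕ) : ℂ) * R' + (X - C c) * derivative R', by norm_num; ring⟩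
    rw [natDegree_pow, natDegree_X_sub_C] at h2
    omega
  -- For a second double root `z`, the product `(X - c) * (X - z)` would divide both.
  have hRn : R.roots.Nodup := by
    by_contra h
    obtain ⟨z, hz⟩ : ∃ z, 1 < R.roots.count z := by
      by_contra h'
      push Not at h'
      exact h (Multiset.nodup_iff_count_le_one.2 h')
    rw [count_roots] at hz
    obtain ⟨R', hR'⟩ := (pow_dvd_pow _ hz).trans (pow_rootMultiplicity_dvd R z)
    have e : p = ((X - C c) * (X - C z)) ^ 2 * R' := by rw [hR, hR']; ring
    have h2 := h1 ((X - C c) * (X - C z)) ⟨(X - C c) * (X - C z) * R', by rw [e]; ring⟩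
      (dvd_derivative_of_sq_dvd ⟨R', e⟩)
    rw [(monic_X_sub_C c).natDegree_mul (monic_X_sub_C z), natDegree_X_sub_C,
      natDegree_X_sub_C] at h2
    omega
  have hRcard : R.roots.toFinset.card = k := by
    rw [Multiset.toFinset_card_of_nodup hRn, ← hRd]
    exact (IsAlgClosed.splits R).natDegree_eq_card_roots.symm
  let e := (R.roots.toFinset.equivFinOfCardEq hRcard).symm
  have hroot : ∀ j, R.eval (e j : ℂ) = 0 := fun j => by
    have := (e j).2
    rw [Multiset.mem_toFinset, mem_roots hRm.ne_zero] at this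
    exact this
  refine ⟨c, fun j => e j, fun i j hij => e.injective (Subtype.ext hij), fun j hj => hRc ?_, ?_⟩
  · rw [← hj]; exact hroot j
  · rw [hR, pairPoly, C_0, sub_zero]
    congr 1
    have h1 : R = (R.roots.map fun a => X - C a).prod :=
      ((IsAlgClosed.splits R).eq_prod_roots_of_monic hRm)
    have h2 : R.roots = Finset.univ.val.map fun j => (e j : ℂ) := by
      have hv : R.roots.toFinset.val = R.roots := by rw [Multiset.toFinset_val, hRn.dedup]
      have : R.roots.toFinset = Finset.univ.image fun j => (e j : ℂ) := by
        ext z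
        simp only [Finset.mem_image, Finset.mem_univ, true_and]
        constructor
        · intro hz
          exact ⟨e.symm ⟨z, hz⟩, by simp⟩
        · rintro ⟨j, rfl⟩
          exact (e j).2
      exact hv.symm.trans ((congrArg Finset.val this).trans (Finset.image_val_of_injOn
        fun i _ j _ hij => e.injective (Subtype.ext hij)))
    conv_lhs => rw [h1, h2, Multiset.map_map]
    rfl

/-- Simple roots depend continuously on the parameter. -/
lemma exists_root_function (P : ℂ[X][X]) {b y : ℂ} (h0 : (spec P b).eval y = 0)
    (h1 : (derivative (spec P b)).eval y ≠ 0) :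
    ∃ ψ : ℂ → ℂ, ψ b = y ∧ (∃ s ∈ 𝓝 b, ContinuousOn ψ s) ∧
      ∀ᶠ x in 𝓝 b, (spec P x).eval (ψ x) = 0 := by
  let F : ℂ × ℂ → ℂ := fun z => (spec P z.1).eval z.2
  have hF : F = fun z => ∑ i ∈ Finset.range (P.natDegree + 1), (P.coeff i).eval z.1 * z.2 ^ i := by
    funext z
    have : (spec P z.1).natDegree < P.natDegree + 1 := by
      rw [Nat.lt_succ_iff]; exact natDegree_map_le
    simp only [F]
    rw [eval_eq_sum_range' this]
    simp [spec]
  have hFd : ContDiff ℂ 1 F := by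
    rw [hF]
    refine ContDiff.sum fun i _ => ContDiff.mul ?_ (contDiff_snd.pow i)
    simp only [eval_eq_sum_range]
    exact ContDiff.sum fun j _ => contDiff_const.mul (contDiff_fst.pow j)
  have hs := (hFd.contDiffAt (x := (b, y))).hasStrictFDerivAt one_ne_zero
  have hpart : (fderiv ℂ F (b, y)) ∘L .inr ℂ ℂ ℂ =
      ContinuousLinearMap.toSpanSingleton ℂ ((derivative (spec P b)).eval y) := by
    have e1 : HasFDerivAt (fun w : ℂ => F (b, w)) ((fderiv ℂ F (b, y)) ∘L .inr ℂ ℂ ℂ) y :=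
      hs.hasFDerivAt.comp y (hasFDerivAt_prodMk_right b y)
    have e2 : HasFDerivAt (fun w : ℂ => F (b, w))
      (ContinuousLinearMap.toSpanSingleton ℂ ((derivative (spec P b)).eval y)) y :=
      ((spec P b).hasDerivAt y).hasFDerivAt
    exact e1.unique e2
  have hinv : ((fderiv ℂ F (b, y)) ∘L .inr ℂ ℂ ℂ).IsInvertible := by
    rw [hpart]
    exact ⟨ContinuousLinearEquiv.unitsEquivAut ℂ (Units.mk0 _ h1), by ext; simp⟩
  refine ⟨hs.implicitFunctionOfProdDomain hinv, ?_, ?_, ?_⟩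
  · exact (hs.eventually_apply_eq_iff_implicitFunctionOfProdDomain hinv).self_of_nhds.1 rfl
  · obtain ⟨K, s, hsn, hL⟩ :=
      (hs.hasStrictFDerivAt_implicitFunctionOfProdDomain hinv).exists_lipschitzOnWith
    exact ⟨s, hsn, hL.continuousOn⟩
  · filter_upwards [hs.eventually_apply_implicitFunctionOfProdDomain hinv] with x hx
    exact hx.trans h0

end Local

/-! ### Normal form of the fibres near a simple zero of the discriminant -/

section Normal

open scoped unitInterval Topology
open Polynomial

variable {k : ℕ}

lemma eval_derivative_X_sub_C_mul (a : ℂ) (g : ℂ[X]) :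
    (derivative ((X - C a) * g)).eval a = g.eval a := by
  simp [derivative_mul]

/-- The nonvanishing cofactor of `Δ` in the discriminant of `pairPoly c Δ q`. -/
def discCofactor (c Δ : ℂ) (q : Fin k → ℂ) : ℂ :=
  -4 * (∏ j, ((q j - c) ^ 2 - Δ)) ^ 2 * ∏ j, ∏ i ∈ Finset.univ.erase j, (q j - q i)

/-- The resultant is the product of the derivative over the zeros. At `c ± s` with `s ^ 2 = Δ` the
derivative has the factors `2 * s` and `-(2 * s)`, which yield `-4 * Δ`. -/
lemma resultant_pairPoly (c Δ : ℂ) (q : Fin k → ℂ) :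
    resultant (pairPoly c Δ q) (derivative (pairPoly c Δ q)) (k + 2) (k + 1) =
      Δ * discCofactor c Δ q := by
  have h := resultant_derivative (monic_pairPoly c Δ q) (natDegree_pairPoly c Δ q)
  rw [show k + 2 - 1 = k + 1 by omega] at h
  rw [h]
  obtain ⟨s, rfl⟩ := IsAlgClosed.exists_pow_nat_eq Δ two_pos
  have e : pairPoly c (s ^ 2) q =
      (({c + s, c - s} + Finset.univ.val.map q).map fun a => X - C a).prod := by
    rw [Multiset.map_add, Multiset.prod_add, Multiset.map_map]
    simp only [Multiset.insert_eq_cons, Multiset.map_cons, Multiset.map_singleton,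
      Multiset.prod_cons, Multiset.prod_singleton]
    rw [pairPoly, Finset.prod]
    congr 1
    simp only [C_add, C_sub, C_pow]
    ring
  have hr : (pairPoly c (s ^ 2) q).roots = {c + s, c - s} + Finset.univ.val.map q := by
    rw [e, roots_multiset_prod_X_sub_C]
  have h1 : (derivative (pairPoly c (s ^ 2) q)).eval (c + s) = 2 * s * ∏ j, (c + s - q j) := by
    have : pairPoly c (s ^ 2) q = (X - C (c + s)) * ((X - C (c - s)) * ∏ j, (X - C (q j))) := by
      rw [pairPoly]
      simp only [C_add, C_sub, C_pow]
      ring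
    rw [this, eval_derivative_X_sub_C_mul]
    simp only [eval_mul, eval_prod, eval_sub, eval_X, eval_C]
    ring
  have h2 : (derivative (pairPoly c (s ^ 2) q)).eval (c - s) =
      -(2 * s) * ∏ j, (c - s - q j) := by
    have : pairPoly c (s ^ 2) q = (X - C (c - s)) * ((X - C (c + s)) * ∏ j, (X - C (q j))) := by
      rw [pairPoly]
      simp only [C_add, C_sub, C_pow]
      ring
    rw [this, eval_derivative_X_sub_C_mul]
    simp only [eval_mul, eval_prod, eval_sub, eval_X, eval_C]
    ring
  have h3 : ∀ j, (derivative (pairPoly c (s ^ 2) q)).eval (q j) =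
      ((q j - c) ^ 2 - s ^ 2) * ∏ i ∈ Finset.univ.erase j, (q j - q i) := by
    intro j
    have : pairPoly c (s ^ 2) q = (X - C (q j)) *
        (((X - C c) ^ 2 - C (s ^ 2)) * ∏ i ∈ Finset.univ.erase j, (X - C (q i))) := by
      rw [pairPoly, ← Finset.mul_prod_erase _ _ (Finset.mem_univ j)]
      ring
    rw [this, eval_derivative_X_sub_C_mul]
    simp only [eval_mul, eval_prod, eval_sub, eval_X, eval_C, eval_pow]
  rw [hr, Multiset.map_add, Multiset.prod_add, Multiset.map_map]
  simp only [Multiset.insert_eq_cons, Multiset.map_cons, Multiset.map_singleton,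
    Multiset.prod_cons, Multiset.prod_singleton, h1, h2]
  have h4 : (Multiset.map ((fun y => eval y (derivative (pairPoly c (s ^ 2) q))) ∘ q)
      Finset.univ.val).prod = (∏ j, ((q j - c) ^ 2 - s ^ 2)) *
        ∏ j, ∏ i ∈ Finset.univ.erase j, (q j - q i) := by
    rw [← Finset.prod_mul_distrib]
    exact Finset.prod_congr rfl fun j _ => h3 j
  have h5 : (∏ j, (c + s - q j)) * ∏ j, (c - s - q j) = ∏ j, ((q j - c) ^ 2 - s ^ 2) := by
    rw [← Finset.prod_mul_distrib]
    exact Finset.prod_congr rfl fun j _ => by ring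
  rw [discCofactor, show (fun x => eval x (derivative (pairPoly c (s ^ 2) q))) ∘ q =
    (fun y => eval y (derivative (pairPoly c (s ^ 2) q))) ∘ q from rfl, h4]
  linear_combination (-4 * s ^ 2 * (∏ j, ((q j - c) ^ 2 - s ^ 2)) *
        ∏ j, ∏ i ∈ Finset.univ.erase j, (q j - q i)) * h5

/-- The monic quadratic factor is determined by its values at two points. The formulas show that `c`
and `Δ` are continuous where the simple roots `q j` are. -/
lemma pairPoly_coordinates {c Δ : ℂ} {q : Fin k → ℂ} {y₁ y₂ e₁ e₂ : ℂ} (hy : y₁ ≠ y₂)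
    (h₁ : ∀ j, y₁ ≠ q j) (h₂ : ∀ j, y₂ ≠ q j)
    (he₁ : e₁ = (pairPoly c Δ q).eval y₁ / ∏ j, (y₁ - q j))
    (he₂ : e₂ = (pairPoly c Δ q).eval y₂ / ∏ j, (y₂ - q j)) :
    c = (y₁ + y₂ - (e₁ - e₂) / (y₁ - y₂)) / 2 ∧ Δ = (y₁ - c) ^ 2 - e₁ := by
  have p1 : ∏ j, (y₁ - q j) ≠ 0 := Finset.prod_ne_zero_iff.2 fun j _ => sub_ne_zero.2 (h₁ j)
  have p2 : ∏ j, (y₂ - q j) ≠ 0 := Finset.prod_ne_zero_iff.2 fun j _ => sub_ne_zero.2 (h₂ j)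
  rw [eval_pairPoly, mul_div_assoc, div_self p1, mul_one] at he₁
  rw [eval_pairPoly, mul_div_assoc, div_self p2, mul_one] at he₂
  have p3 := sub_ne_zero.2 hy
  constructor
  · have : (e₁ - e₂) / (y₁ - y₂) = y₁ + y₂ - 2 * c := by
      rw [div_eq_iff p3, he₁, he₂]
      ring
    rw [this]
    ring
  · rw [he₁]
    ring

lemma continuous_eval_spec (P : ℂ[X][X]) (y : ℂ) : Continuous fun x => (spec P x).eval y := by
  have h : ∀ x, (spec P x).eval y =
      ∑ i ∈ Finset.range (P.natDegree + 1), (P.coeff i).eval x * y ^ i := by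
    intro x
    have : (spec P x).natDegree < P.natDegree + 1 := by
      rw [Nat.lt_succ_iff]; exact natDegree_map_le
    rw [eval_eq_sum_range' this]
    simp [spec]
  simp only [h]
  exact continuous_finsetSum _ fun i _ => (P.coeff i).continuous.mul continuous_const

/-- Near a simple zero of the discriminant, two points of the fibre come together and the others
remain distinct. -/
lemma exists_local_pair {P : ℂ[X][X]} (hP : P.Monic) (hm : P.natDegree = k + 2) {b : ℂ}
    (hb : (discPoly P (k + 2)).eval b = 0)
    (hb' : (derivative (discPoly P (k + 2))).eval b ≠ 0) :
    ∃ (c Δ : ℂ → ℂ) (q : ℂ → Fin k → ℂ), Function.Injective (q b) ∧ (∀ j, q b j ≠ c b) ∧ Δ b = 0 ∧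
      ∀ᶠ x in 𝓝 b, ContinuousAt c x ∧ ContinuousAt Δ x ∧ ContinuousAt q x ∧
        spec P x = pairPoly (c x) (Δ x) (q x) := by
  obtain ⟨c₀, q₀, hq₀, hc₀, e₀⟩ := exists_double_root (monic_spec hP b)
    ((natDegree_spec hP b).trans hm)
    (fun h => (eval_discPoly_ne_zero_iff hP hm b).2 h hb)
    fun d h1 h2 => natDegree_lt_two_of_simple hP hm hb' h1 h2
  have hsimple : ∀ j, (derivative (spec P b)).eval (q₀ j) ≠ 0 := by
    intro j
    have : spec P b = (X - C (q₀ j)) *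
        (((X - C c₀) ^ 2 - C 0) * ∏ i ∈ Finset.univ.erase j, (X - C (q₀ i))) := by
      rw [e₀, pairPoly, ← Finset.mul_prod_erase _ _ (Finset.mem_univ j)]
      ring
    rw [this, eval_derivative_X_sub_C_mul]
    simp only [eval_mul, eval_prod, eval_sub, eval_X, eval_C, eval_pow, sub_zero]
    refine mul_ne_zero (pow_ne_zero _ (sub_ne_zero.2 (hc₀ j))) (Finset.prod_ne_zero_iff.2 ?_)
    intro i hi
    exact sub_ne_zero.2 (hq₀.ne (Finset.ne_of_mem_erase hi).symm)
  have hroot : ∀ j, (spec P b).eval (q₀ j) = 0 := by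
    intro j
    rw [e₀, eval_pairPoly, Finset.prod_eq_zero (Finset.mem_univ j) (sub_self _), mul_zero]
  choose ψ hψb hψc hψ using fun j => exists_root_function P (hroot j) (hsimple j)
  let q : ℂ → Fin k → ℂ := fun x j => ψ j x
  have hqb : q b = q₀ := funext hψb
  have hqc : ∀ᶠ x in 𝓝 b, ContinuousAt q x := by
    have : ∀ᶠ x in 𝓝 b, ∀ j, ContinuousAt (ψ j) x := by
      refine Filter.eventually_all.2 fun j => ?_
      obtain ⟨s, hs, hc⟩ := hψc j
      filter_upwards [eventually_mem_nhds_iff.2 hs] with x hx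
      exact hc.continuousAt hx
    filter_upwards [this] with x hx
    exact continuousAt_pi.2 hx
  have hqcb : ContinuousAt q b := hqc.self_of_nhds
  have hqj : ∀ j, ContinuousAt (fun x => q x j) b := fun j => continuousAt_pi.1 hqcb j
  have hqi : ∀ᶠ x in 𝓝 b, Function.Injective (q x) := by
    have : ∀ᶠ x in 𝓝 b, ∀ i j, i ≠ j → q x i ≠ q x j := by
      refine Filter.eventually_all.2 fun i => Filter.eventually_all.2 fun j => ?_
      by_cases hij : i = j
      · exact Filter.Eventually.of_forall fun x h => absurd hij h
      · filter_upwards [((hqj i).ne_iff_eventually_ne (hqj j)).1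
          (by rw [hqb]; exact hq₀.ne hij)] with x hx _
        exact hx
    filter_upwards [this] with x hx i j hij
    by_contra h
    exact hx i j h hij
  -- The quadratic factor is read off at `c₀` and at one further point which is not a root over `b`.
  obtain ⟨y₂, hy₂⟩ := Set.Infinite.exists_notMem_finite (s := (univ : Set ℂ)) infinite_univ
    ((finite_range q₀).insert c₀)
  have hne : ∀ y : ℂ, (∀ j, y ≠ q₀ j) → ∀ᶠ x in 𝓝 b, ∀ j, y ≠ q x j := by
    intro y hy
    refine Filter.eventually_all.2 fun j => ?_
    exact (continuousAt_const.ne_iff_eventually_ne (hqj j)).1 (by rw [hqb]; exact hy j)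
  have hn1 := hne c₀ fun j => (hc₀ j).symm
  have hn2 := hne y₂ fun j h => hy₂.2 (Or.inr ⟨j, h.symm⟩)
  have hy : c₀ ≠ y₂ := fun h => hy₂.2 (Or.inl h.symm)
  let e : ℂ → ℂ → ℂ := fun y x => (spec P x).eval y / ∏ j, (y - q x j)
  let c : ℂ → ℂ := fun x => (c₀ + y₂ - (e c₀ x - e y₂ x) / (c₀ - y₂)) / 2
  let Δ : ℂ → ℂ := fun x => (c₀ - c x) ^ 2 - e c₀ x
  have hec : ∀ y x, ContinuousAt q x → (∀ j, y ≠ q x j) → ContinuousAt (e y) x := by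
    intro y x hx hyx
    refine ContinuousAt.div (continuous_eval_spec P y).continuousAt ?_
      (Finset.prod_ne_zero_iff.2 fun j _ => sub_ne_zero.2 (hyx j))
    exact tendsto_finsetProd _ fun j _ => continuousAt_const.sub (continuousAt_pi.1 hx j)
  have hcoord : ∀ {x c' Δ'}, (∀ j, c₀ ≠ q x j) → (∀ j, y₂ ≠ q x j) →
      spec P x = pairPoly c' Δ' (q x) → c' = c x ∧ Δ' = Δ x := by
    intro x c' Δ' h1 h2 h
    obtain ⟨h3, h4⟩ := pairPoly_coordinates (c := c') (Δ := Δ') (q := q x) (e₁ := e c₀ x)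
      (e₂ := e y₂ x) hy h1 h2 (by rw [← h]) (by rw [← h])
    refine ⟨h3, ?_⟩
    rw [h4, h3]
  have hbb := hcoord hn1.self_of_nhds hn2.self_of_nhds (by rw [e₀, hqb])
  refine ⟨c, Δ, q, hqb ▸ hq₀, ?_, hbb.2.symm, ?_⟩
  · intro j
    rw [← hbb.1, hqb]
    exact hc₀ j
  · filter_upwards [hn1, hn2, hqc, hqi, Filter.eventually_all.2 hψ] with x h1 h2 h3 h4 h5
    have k1 := hec _ _ h3 h1
    have k2 := hec _ _ h3 h2
    have k3 : ContinuousAt c x := by fun_prop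
    refine ⟨k3, by fun_prop, h3, ?_⟩
    obtain ⟨c', Δ', h6⟩ := exists_pairPoly_of_dvd (monic_spec hP x)
      ((natDegree_spec hP x).trans hm) h4 h5
    obtain ⟨h7, h8⟩ := hcoord h1 h2 h6
    rw [← h7, ← h8]
    exact h6

/-- The discriminant of the fibre is `Δ` times a factor which does not vanish at `b`, so its simple
zero makes `Δ x = (x - b) * κ x` with `κ` continuous and nonzero. The last clause separates `x` from
`z` so that the coefficients can be frozen at `b` while `x` keeps running around `b`. -/
lemma exists_normal_form {P : ℂ[X][X]} (hP : P.Monic) (hm : P.natDegree = k + 2) {b : ℂ}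
    (hb : (discPoly P (k + 2)).eval b = 0)
    (hb' : (derivative (discPoly P (k + 2))).eval b ≠ 0) :
    ∃ r > 0, ∃ (c κ : ℂ → ℂ) (q : ℂ → Fin k → ℂ), ContinuousOn c (ball b r) ∧
      ContinuousOn κ (ball b r) ∧ ContinuousOn q (ball b r) ∧
      (∀ x ∈ ball b r, spec P x = pairPoly (c x) ((x - b) * κ x) (q x)) ∧
      ∀ x ∈ ball b r, ∀ z ∈ ball b r, x ≠ b → IsWide (c z) ((x - b) * κ z) (q z) := by
  obtain ⟨c, Δ, q, hqi, hqc, hΔb, hev⟩ := exists_local_pair hP hm hb hb'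
  obtain ⟨D₁, hD₁⟩ := dvd_iff_isRoot.2 hb
  have hD₁b : D₁.eval b ≠ 0 := by
    rwa [hD₁, eval_derivative_X_sub_C_mul] at hb'
  let E : ℂ → ℂ := fun x => discCofactor (c x) (Δ x) (q x)
  let κ : ℂ → ℂ := fun x => D₁.eval x / E x
  have hEc : ∀ x, ContinuousAt c x → ContinuousAt Δ x → ContinuousAt q x → ContinuousAt E x := by
    intro x h1 h2 h3
    have h4 : ∀ j, ContinuousAt (fun x => q x j) x := continuousAt_pi.1 h3
    refine (ContinuousAt.mul continuousAt_const (ContinuousAt.pow ?_ 2)).mul ?_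
    · exact tendsto_finsetProd _ fun j _ => (((h4 j).sub h1).pow 2).sub h2
    · exact tendsto_finsetProd _ fun j _ => tendsto_finsetProd _ fun i _ => (h4 j).sub (h4 i)
  have hEb : E b ≠ 0 := by
    simp only [E, discCofactor, hΔb, sub_zero]
    refine mul_ne_zero (mul_ne_zero (by norm_num) (pow_ne_zero _ ?_)) ?_
    · exact Finset.prod_ne_zero_iff.2 fun j _ => pow_ne_zero _ (sub_ne_zero.2 (hqc j))
    · exact Finset.prod_ne_zero_iff.2 fun j _ => Finset.prod_ne_zero_iff.2 fun i hi =>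
        sub_ne_zero.2 (hqi.ne (Finset.ne_of_mem_erase hi).symm)
  obtain ⟨cb, Δb, qb, -⟩ := hev.self_of_nhds
  have hqj : ∀ j, ContinuousAt (fun x => q x j) b := fun j => continuousAt_pi.1 qb j
  have hκc : ∀ x, ContinuousAt E x → E x ≠ 0 → ContinuousAt κ x := fun x h1 h2 =>
    (Polynomial.continuous D₁).continuousAt.div h1 h2
  have hEb' := hEc b cb Δb qb
  have hκb := hκc b hEb' hEb
  have hE0 : ∀ᶠ x in 𝓝 b, E x ≠ 0 := hEb'.eventually_ne hEb
  have hκ0 : ∀ᶠ x in 𝓝 b, κ x ≠ 0 := hκb.eventually_ne (div_ne_zero hD₁b hEb)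
  have hinj : ∀ᶠ x in 𝓝 b, Function.Injective (q x) := by
    filter_upwards [hE0] with x hx i j hij
    by_contra hne
    apply hx
    refine mul_eq_zero_of_right _ (Finset.prod_eq_zero (Finset.mem_univ i) ?_)
    exact Finset.prod_eq_zero (Finset.mem_erase.2 ⟨Ne.symm hne, Finset.mem_univ j⟩)
      (sub_eq_zero.2 hij)
  have hκE : ∀ x, κ x = D₁.eval x / E x := fun _ => rfl
  clear_value κ
  have hwide : ∀ᶠ x : ℂ × ℂ in 𝓝 (b, b), ∀ j, ‖(x.1 - b) * κ x.2‖ < ‖q x.2 j - c x.2‖ ^ 2 := by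
    refine Filter.eventually_all.2 fun j => ?_
    have s2 : Filter.Tendsto (fun x : ℂ × ℂ => x.2) (𝓝 (b, b)) (𝓝 b) := continuous_snd.tendsto (b, b)
    have a1 : ContinuousAt (fun x : ℂ × ℂ => ‖(x.1 - b) * κ x.2‖) (b, b) :=
      ((continuousAt_fst.sub continuousAt_const).mul (hκb.tendsto.comp s2)).norm
    have a3 : ContinuousAt (fun z => ‖q z j - c z‖ ^ 2) b := ((hqj j).sub cb).norm.pow 2
    have a2 : ContinuousAt (fun x : ℂ × ℂ => ‖q x.2 j - c x.2‖ ^ 2) (b, b) :=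
      a3.tendsto.comp s2
    refine a1.eventually_lt a2 ?_
    have := norm_pos_iff.2 (sub_ne_zero.2 (hqc j))
    simp only [sub_self, zero_mul, norm_zero]
    positivity
  obtain ⟨r₁, hr₁, h1⟩ := Metric.eventually_nhds_iff_ball.1 hwide
  obtain ⟨r₂, hr₂, h2⟩ := Metric.eventually_nhds_iff_ball.1
    (hev.and (hE0.and (hκ0.and hinj)))
  have hs1 : ball b (min r₁ r₂) ⊆ ball b r₁ := ball_subset_ball (min_le_left _ _)
  have hs2 : ball b (min r₁ r₂) ⊆ ball b r₂ := ball_subset_ball (min_le_right _ _)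
  refine ⟨min r₁ r₂, lt_min hr₁ hr₂, c, κ, q, ?_, ?_, ?_, ?_, ?_⟩
  · exact fun x hx => (h2 x (hs2 hx)).1.1.continuousWithinAt
  · intro x hx
    obtain ⟨⟨g1, g2, g3, -⟩, g4, -⟩ := h2 x (hs2 hx)
    exact (hκc x (hEc x g1 g2 g3) g4).continuousWithinAt
  · exact fun x hx => (h2 x (hs2 hx)).1.2.2.1.continuousWithinAt
  · intro x hx
    obtain ⟨⟨-, -, -, g1⟩, g2, -⟩ := h2 x (hs2 hx)
    have g3 := eval_discPoly P (k + 2) x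
    rw [g1, show k + 2 - 1 = k + 1 by omega, resultant_pairPoly, hD₁, eval_mul, eval_sub, eval_X,
      eval_C] at g3
    have g4 : (x - b) * κ x = Δ x := by
      rw [hκE, ← mul_div_assoc, g3]
      exact mul_div_cancel_right₀ _ g2
    rw [g4]
    exact g1
  · intro x hx z hz hxb
    obtain ⟨-, g2, g3, g4⟩ := h2 z (hs2 hz)
    refine ⟨mul_ne_zero (sub_ne_zero.2 hxb) g3, g4, ?_⟩
    refine h1 (x, z) ?_
    rw [← ball_prod_same]
    exact ⟨hs1 hx, hs1 hz⟩

/-- The fibres over a small circle around a simple zero of the discriminant form a positive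
braid. -/
lemma exists_isPositive_of_simple {P : ℂ[X][X]} (hP : P.Monic) (hm : P.natDegree = k + 2) {b : ℂ}
    (hb : (discPoly P (k + 2)).eval b = 0)
    (hb' : (derivative (discPoly P (k + 2))).eval b ≠ 0) :
    ∃ r > 0, ∀ v ∈ ball b r, v ≠ b → ∀ (K : Conf (k + 2)) (w : Path K K),
      (∀ t y, y ∈ (w t).1 ↔ (spec P (b + turn t * (v - b))).eval y = 0) →
      IsPositive K (FundamentalGroup.fromPath (.mk w)) := by
  obtain ⟨r, hr, c, κ, q, hc, hκ, hq, hform, hwide⟩ := exists_normal_form hP hm hb hb'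
  refine ⟨r, hr, fun v hv hvb K w hw => ?_⟩
  let x : ℝ → ℂ := fun t => b + turn t * (v - b)
  have hxb : ∀ t, x t - b = turn t * (v - b) := fun t => add_sub_cancel_left _ _
  -- The argument `z` of `c`, `κ` and `q` contracts to `b`, whereas the factor `x - b` keeps its
  -- full turn.
  let z : I × I → ℂ := fun a => b + (1 - (a.2 : ℝ) : ℝ) * (x a.1 - b)
  have hxm : ∀ t, x t ∈ ball b r := by
    intro t
    rw [mem_ball_iff_norm, hxb, norm_mul, norm_turn, one_mul]
    exact mem_ball_iff_norm.1 hv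
  have hzm : ∀ a, z a ∈ ball b r := by
    intro a
    have h1 := mem_ball_iff_norm.1 (hxm a.1)
    have h2 : 0 ≤ (1 - (a.2 : ℝ) : ℝ) := by linarith [a.2.2.2]
    have h3 : (1 - (a.2 : ℝ) : ℝ) ≤ 1 := by linarith [a.2.2.1]
    rw [mem_ball_iff_norm, add_sub_cancel_left, norm_mul, Complex.norm_real,
      Real.norm_of_nonneg h2]
    refine lt_of_le_of_lt ?_ h1
    exact mul_le_of_le_one_left (norm_nonneg _) h3
  have hx0 : ∀ t, x t ≠ b := by
    intro t h
    have := hxb t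
    rw [h, sub_self] at this
    exact mul_ne_zero (turn_ne_zero t) (sub_ne_zero.2 hvb) this.symm
  have hzc : Continuous z := by simp only [z, x]; fun_prop
  have hsplit : ∀ a : I × I, IsSplit (c (z a)) ((x a.1 - b) * κ (z a)) (q (z a)) := by
    intro a
    have := (hwide (x a.1) (hxm _) (z a) (hzm a) (hx0 _)).isSplit 0
    rwa [turn_zero, one_mul] at this
  have hb0 : b ∈ ball b r := mem_ball_self hr
  have hwb := hwide v hv b hb0 hvb
  have hfree : FreelyHomotopic w (pairLoop hwb) := by
    refine exists_lasso_of_homotopy (H := fun a : I × I => pairConf (c (z a))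
      ((x a.1 - b) * κ (z a)) (q (z a)) (hsplit a)) ?_ ?_ ?_ ?_
    · refine continuous_pairConf (hc.comp_continuous hzc hzm) ?_ (hq.comp_continuous hzc hzm) _
      refine Continuous.mul ?_ (hκ.comp_continuous hzc hzm)
      simp only [x]
      fun_prop
    · intro τ
      have e : z (0, τ) = z (1, τ) := by simp [z, x, turn_zero, turn_one]
      refine pairConf_congr ?_ ?_ ?_
      · rw [e]
      · simp only [e]
        simp [x, turn_zero, turn_one]
      · rw [e]
    · intro t
      refine Conf.ext_mem fun y => ?_
      have e : z (t, 0) = x t := by simp [z]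
      have hxt := hform (x t) (hxm t)
      rw [hw, pairConf, mem_rootConf (monic_pairPoly _ _ _).ne_zero]
      simp only [e]
      rw [← hxt]
    · intro t
      have e : z (t, 1) = b := by simp [z]
      refine pairConf_congr (h := hwb.isSplit t) ?_ ?_ ?_
      · rw [e]
      · simp only [e, hxb]
        ring
      · rw [e]
  exact isPositive_of_freelyHomotopic_halfTwist (hfree.trans (freelyHomotopic_halfTwist hwb))

end Normal

/-! ### Perturbing the discriminant to have simple zeros only -/

section Perturbation

open Polynomial

/-- Each nonzero term of the Leibniz expansion uses every row weight and every column weight once.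
-/
lemma natDegree_det_le {n : Type} [Fintype n] [DecidableEq n] (A : Matrix n n ℂ[X]) (a b : n → ℤ)
    (h : ∀ i j, A i j ≠ 0 → ((A i j).natDegree : ℤ) ≤ a i + b j) {N : ℕ}
    (hN : ∑ i, a i + ∑ j, b j = N) : A.det.natDegree ≤ N := by
  rw [Matrix.det_apply']
  refine natDegree_sum_le_of_forall_le _ _ fun σ _ => ?_
  by_cases h0 : ∃ j, A (σ j) j = 0
  · obtain ⟨j, hj⟩ := h0
    rw [Finset.prod_eq_zero (f := fun i => A (σ i) i) (Finset.mem_univ j) hj, mul_zero,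
      natDegree_zero]
    exact Nat.zero_le _
  push Not at h0
  refine (natDegree_mul_le).trans ?_
  rw [natDegree_intCast, zero_add]
  refine (natDegree_prod_le _ _).trans ?_
  have h1 : ((∑ j, (A (σ j) j).natDegree : ℕ) : ℤ) ≤ ∑ j, (a (σ j) + b j) := by
    rw [Nat.cast_sum]
    exact Finset.sum_le_sum fun j _ => h _ _ (h0 j)
  rw [Finset.sum_add_distrib, Equiv.sum_comp σ a, hN] at h1
  exact_mod_cast h1

/-- The coefficients of `P` are those of a polynomial of degree at most `w * m` for the weights `1`
and `w` of the two variables. -/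
def IsWeighted (w m : ℕ) (P : ℂ[X][X]) : Prop :=
  ∀ j, (P.coeff j).natDegree ≤ w * (m - j) ∧ (m < j → P.coeff j = 0)

variable {w m : ℕ} {P Q : ℂ[X][X]}

lemma IsWeighted.natDegree_le (h : IsWeighted w m P) {j : ℕ} (h0 : P.coeff j ≠ 0) :
    ((P.coeff j).natDegree : ℤ) ≤ w * (m - j) := by
  have h1 : j ≤ m := by
    by_contra hj
    exact h0 ((h j).2 (not_le.1 hj))
  have h2 := (h j).1
  rw [← Nat.cast_le (α := ℤ)] at h2
  push_cast [h1] at h2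
  exact h2

lemma sum_fin_mul_two (n : ℕ) : (∑ i : Fin n, ((i : ℕ) : ℤ)) * 2 = n * (n - 1) := by
  rw [Fin.sum_univ_eq_sum_range (fun i => (i : ℤ)) n]
  induction n with
  | zero => simp
  | succ n ih =>
    rw [Finset.sum_range_succ, add_mul, ih]
    push_cast
    ring

/-- The weights of the columns of the Sylvester matrix of `P` and its derivative. -/
def columnWeight (w n j : ℕ) : ℤ := if j < n + 1 then w * (n + j) else w * j

lemma sum_columnWeight (w n : ℕ) : ∑ i : Fin (n + 1 + n), -(w * (i : ℕ) : ℤ) +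
    ∑ j : Fin (n + 1 + n), columnWeight w n j = ((w * ((n + 1) * n) : ℕ) : ℤ) := by
  have hb : ∑ j : Fin (n + 1 + n), columnWeight w n j = ∑ j : Fin (n + 1), (w * (n + (j : ℕ)) : ℤ) +
      ∑ j : Fin n, (w * (((n + 1 : ℕ) : ℤ) + (j : ℕ)) : ℤ) := by
    rw [Fin.sum_univ_add]
    congr 1
    · refine Finset.sum_congr rfl fun j _ => ?_
      rw [Fin.val_castAdd, columnWeight, if_pos j.2]
    · refine Finset.sum_congr rfl fun j _ => ?_
      rw [Fin.val_natAdd, columnWeight, if_neg (not_lt.2 (Nat.le_add_right _ _)),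
        Nat.cast_add (n + 1)]
  rw [hb, Finset.sum_neg_distrib, ← Finset.mul_sum, ← Finset.mul_sum, ← Finset.mul_sum,
    Finset.sum_add_distrib, Finset.sum_add_distrib]
  have g1 := sum_fin_mul_two (n + 1 + n)
  have g2 := sum_fin_mul_two (n + 1)
  have g3 := sum_fin_mul_two n
  simp only [Finset.sum_const, Finset.card_univ, Fintype.card_fin, nsmul_eq_mul]
  generalize (∑ i : Fin (n + 1 + n), ((i : ℕ) : ℤ)) = s1 at *
  generalize (∑ i : Fin (n + 1), ((i : ℕ) : ℤ)) = s2 at *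
  generalize (∑ i : Fin n, ((i : ℕ) : ℤ)) = s3 at *
  push_cast at g1 g2 g3 ⊢
  apply mul_right_cancel₀ (two_ne_zero (α := ℤ))
  linear_combination (-w : ℤ) * g1 + w * g2 + w * g3

lemma IsWeighted.natDegree_sylvester_le {n : ℕ} (h : IsWeighted w (n + 1) P)
    (i j : Fin (n + 1 + n)) (h0 : sylvester P (derivative P) (n + 1) n i j ≠ 0) :
    ((sylvester P (derivative P) (n + 1) n i j).natDegree : ℤ) ≤
      -(w * (i : ℕ) : ℤ) + columnWeight w n j := by
  induction j using Fin.addCases with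
  | left j =>
    have e : sylvester P (derivative P) (n + 1) n i (Fin.castAdd n j) =
      if (i : ℕ) ∈ Icc (j : ℕ) (j + n) then (derivative P).coeff (i - j) else 0 := by
      simp [sylvester]
    rw [e] at h0 ⊢
    rw [columnWeight, Fin.val_castAdd, if_pos j.2]
    split_ifs at h0 ⊢ with hi
    · rw [coeff_derivative] at h0 ⊢
      have h1 := h.natDegree_le (left_ne_zero_of_mul h0)
      have h2 : (P.coeff ((i : ℕ) - j + 1) * ((((i : ℕ) - j : ℕ) : ℂ[X]) + 1)).natDegree ≤
          (P.coeff ((i : ℕ) - j + 1)).natDegree := by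
        refine natDegree_mul_le.trans ?_
        have : ((((i : ℕ) - j : ℕ) : ℂ[X]) + 1).natDegree = 0 := by
          rw [← Nat.cast_succ, natDegree_natCast]
        omega
      refine (Nat.cast_le.2 h2).trans (h1.trans ?_)
      have h3 := hi.1
      push_cast [Nat.cast_sub h3]
      exact le_of_eq (by ring)
    · exact absurd rfl h0
  | right j =>
    have e : sylvester P (derivative P) (n + 1) n i (Fin.natAdd (n + 1) j) =
      if (i : ℕ) ∈ Icc (j : ℕ) (j + (n + 1)) then P.coeff (i - j) else 0 := by
      simp [sylvester]
    rw [e] at h0 ⊢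
    rw [columnWeight, Fin.val_natAdd, if_neg (not_lt.2 (Nat.le_add_right _ _))]
    split_ifs at h0 ⊢ with hi
    · refine (h.natDegree_le h0).trans ?_
      have h3 := hi.1
      push_cast [Nat.cast_sub h3]
      exact le_of_eq (by ring)
    · exact absurd rfl h0

/-- The discriminant is weighted homogeneous of weight `m * (m - 1)` in units of `w`. The bound is
attained by `modelPoly`, so it serves as a common formal degree for all perturbations. -/
lemma IsWeighted.natDegree_discPoly_le (hm : 0 < m) (h : IsWeighted w m P) :
    (discPoly P m).natDegree ≤ w * (m * (m - 1)) := by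
  obtain ⟨n, rfl⟩ : ∃ n, m = n + 1 := ⟨m - 1, by omega⟩
  exact natDegree_det_le (sylvester P (derivative P) (n + 1) n) (fun i => -(w * (i : ℕ) : ℤ))
    (fun j => columnWeight w n j) h.natDegree_sylvester_le (sum_columnWeight w n)

/-- The polynomial `y ^ m - y + x ^ l`. -/
def modelPoly (m l : ℕ) : ℂ[X][X] := X ^ m - X + C (X ^ l)

lemma spec_modelPoly (m l : ℕ) (x : ℂ) : spec (modelPoly m l) x = X ^ m - X + C (x ^ l) := by
  simp [spec, modelPoly]

lemma monic_modelPoly (hm : 2 ≤ m) (l : ℕ) : (modelPoly m l).Monic := by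
  rw [modelPoly, sub_add]
  refine (monic_X_pow m).sub_of_left ?_
  rw [degree_X_pow]
  refine (degree_X_sub_C_le (X ^ l)).trans_lt ?_
  exact_mod_cast hm

lemma natDegree_modelPoly (hm : 2 ≤ m) (l : ℕ) : (modelPoly m l).natDegree = m := by
  rw [modelPoly, sub_add, natDegree_sub_eq_left_of_natDegree_lt, natDegree_X_pow]
  rw [natDegree_X_pow, natDegree_X_sub_C]
  omega

lemma isWeighted_modelPoly (hm : 2 ≤ m) (w : ℕ) : IsWeighted w m (modelPoly m (w * m)) := by
  intro j
  refine ⟨?_, fun hj => coeff_eq_zero_of_natDegree_lt (by rwa [natDegree_modelPoly hm])⟩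
  rw [modelPoly, coeff_add, coeff_sub, coeff_X_pow, coeff_X, coeff_C]
  rcases eq_or_ne j 0 with rfl | hj
  · rw [if_neg (by omega), if_neg (by omega), if_pos rfl]
    simp
  · rw [if_neg hj, add_zero]
    refine (natDegree_sub_le _ _).trans ?_
    split_ifs <;> simp

/-- A double root `η` must satisfy `m * η ^ (m - 1) = 1`, and the equation then gives `η * (1 - 1 /
m) = x ^ l`; the hypothesis on `x` says that these agree. -/
lemma eval_discPoly_modelPoly_eq_zero (hm : 2 ≤ m) {l : ℕ} {x : ℂ}
    (hx : x ^ (l * (m - 1)) = (1 - 1 / m) ^ (m - 1) / m) :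
    (discPoly (modelPoly m l) m).eval x = 0 := by
  have hm0 : (m : ℂ) ≠ 0 := by exact_mod_cast (by omega : m ≠ 0)
  have hm1 : (1 - 1 / m : ℂ) ≠ 0 := by
    rw [Ne, sub_eq_zero, eq_comm, div_eq_one_iff_eq hm0]
    exact_mod_cast (by omega : 1 ≠ m)
  set η : ℂ := x ^ l / (1 - 1 / m) with hη
  have h1 : η ^ (m - 1) = 1 / m := by
    rw [hη, div_pow, ← pow_mul, hx, div_div, mul_comm (m : ℂ), ← div_div,
      div_self (pow_ne_zero _ hm1)]
  have h2 : η * (1 - 1 / m) = x ^ l := div_mul_cancel₀ _ hm1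
  rw [eval_discPoly]
  by_contra hne
  have hmon := monic_spec (monic_modelPoly hm l) x
  have hdeg := (natDegree_spec (monic_modelPoly hm l) x).trans (natDegree_modelPoly hm l)
  rw [resultant_derivative hmon hdeg] at hne
  apply hne
  refine Multiset.prod_eq_zero (Multiset.mem_map.2 ⟨η, (mem_roots hmon.ne_zero).2 ?_, ?_⟩)
  · rw [IsRoot, spec_modelPoly]
    simp only [eval_add, eval_sub, eval_pow, eval_X, eval_C]
    rw [show m = (m - 1) + 1 by omega, pow_succ, h1]
    linear_combination -h2
  · rw [spec_modelPoly]
    simp only [derivative_add, derivative_sub, derivative_X_pow, derivative_X, derivative_C,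
      eval_add, eval_sub, eval_mul, eval_C, eval_pow, eval_X, eval_one, eval_zero, h1]
    rw [mul_one_div, div_self hm0]
    ring

lemma discPoly_modelPoly_ne_zero (hm : 2 ≤ m) {l : ℕ} (hl : l ≠ 0) :
    discPoly (modelPoly m l) m ≠ 0 := by
  intro h
  have h0 : (discPoly (modelPoly m l) m).eval 0 = 0 := by rw [h, eval_zero]
  have hmon := monic_spec (monic_modelPoly hm l) 0
  have hdeg := (natDegree_spec (monic_modelPoly hm l) 0).trans (natDegree_modelPoly hm l)
  rw [eval_discPoly, resultant_derivative hmon hdeg, Multiset.prod_eq_zero_iff,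
    Multiset.mem_map] at h0
  obtain ⟨y, hy, hy'⟩ := h0
  rw [mem_roots hmon.ne_zero, IsRoot, spec_modelPoly] at hy
  rw [spec_modelPoly] at hy'
  simp only [derivative_add, derivative_sub, derivative_X_pow, derivative_X, derivative_C,
    eval_sub, eval_mul, eval_C, eval_pow, eval_X, eval_one, add_zero] at hy'
  simp only [eval_add, eval_sub, eval_pow, eval_X, eval_C, zero_pow hl, add_zero] at hy
  have hpow : y ^ m = y ^ (m - 1) * y := by rw [← pow_succ]; congr 1; omega
  rw [hpow] at hy
  have hy0 : y ≠ 0 := by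
    rintro rfl
    rw [zero_pow (by omega)] at hy'
    simp at hy'
  have h1 : y ^ (m - 1) = 1 := by
    have : (y ^ (m - 1) - 1) * y = 0 := by linear_combination hy
    exact sub_eq_zero.1 ((mul_eq_zero.1 this).resolve_right hy0)
  rw [h1, mul_one, sub_eq_zero] at hy'
  have : m = 1 := by exact_mod_cast hy'
  omega

/-- The discriminant has degree at most `M` and vanishes at the `M` distinct roots of `X ^ M - κ`,
so it is a constant multiple of this separable polynomial. -/
lemma discPoly_modelPoly (hm : 2 ≤ m) (hw : 0 < w) :
    IsCoprime (discPoly (modelPoly m (w * m)) m) (derivative (discPoly (modelPoly m (w * m)) m)) ∧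
    (discPoly (modelPoly m (w * m)) m).natDegree = w * (m * (m - 1)) := by
  set D := discPoly (modelPoly m (w * m)) m with hD
  set M := w * (m * (m - 1)) with hM
  have hM0 : M ≠ 0 := by
    have : 0 < m * (m - 1) := Nat.mul_pos (by omega) (by omega)
    exact (Nat.mul_pos hw this).ne'
  have hD0 : D ≠ 0 := discPoly_modelPoly_ne_zero hm (Nat.mul_ne_zero hw.ne' (by omega))
  have hle : D.natDegree ≤ M := (isWeighted_modelPoly hm w).natDegree_discPoly_le (by omega)
  have hm0 : (m : ℂ) ≠ 0 := by exact_mod_cast (by omega : m ≠ 0)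
  have hm1 : (1 - 1 / m : ℂ) ≠ 0 := by
    rw [Ne, sub_eq_zero, eq_comm, div_eq_one_iff_eq hm0]
    exact_mod_cast (by omega : 1 ≠ m)
  set κ : ℂ := (1 - 1 / m) ^ (m - 1) / m with hκ
  have hκ0 : κ ≠ 0 := div_ne_zero (pow_ne_zero _ hm1) hm0
  have hsep : (X ^ M - C κ : ℂ[X]).Separable :=
    separable_X_pow_sub_C κ (by exact_mod_cast hM0) hκ0
  have hsub : (X ^ M - C κ : ℂ[X]).roots ≤ D.roots := by
    rw [Multiset.le_iff_subset (nodup_roots hsep)]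
    intro x hx
    rw [mem_roots (X_pow_sub_C_ne_zero (Nat.pos_of_ne_zero hM0) κ), IsRoot, eval_sub, eval_pow,
      eval_X, eval_C, sub_eq_zero] at hx
    rw [mem_roots hD0]
    refine eval_discPoly_modelPoly_eq_zero hm ?_
    rw [← hκ, ← hx, hM, mul_assoc]
  have hdvd : (X ^ M - C κ : ℂ[X]) ∣ D :=
    ((IsAlgClosed.splits (X ^ M - C κ : ℂ[X])).dvd_iff_roots_le_roots
      (X_pow_sub_C_ne_zero (Nat.pos_of_ne_zero hM0) κ) hD0).2 hsub
  obtain ⟨g, hg⟩ := hdvd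
  have hg0 : g ≠ 0 := right_ne_zero_of_mul (hg ▸ hD0)
  have hdeg : D.natDegree = M + g.natDegree := by
    rw [hg, natDegree_mul (X_pow_sub_C_ne_zero (Nat.pos_of_ne_zero hM0) κ) hg0,
      natDegree_X_pow_sub_C]
  have hgd : g.natDegree = 0 := by omega
  refine ⟨?_, by omega⟩
  rw [eq_C_of_natDegree_eq_zero hgd] at hg hg0
  have hu : IsUnit (C (g.coeff 0)) := isUnit_C.2 (C_ne_zero.1 hg0).isUnit
  rw [hg]
  exact hsep.mul_unit hu

lemma exists_isWeighted (hP : P.Monic) (hm : P.natDegree = m) :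
    ∃ w, 0 < w ∧ IsWeighted w m P := by
  refine ⟨(∑ j ∈ Finset.range m, (P.coeff j).natDegree) + 1, by omega, fun j => ⟨?_, fun hj =>
    coeff_eq_zero_of_natDegree_lt (by rwa [hm])⟩⟩
  rcases lt_trichotomy j m with hj | hj | hj
  · have h1 : (P.coeff j).natDegree ≤ ∑ j ∈ Finset.range m, (P.coeff j).natDegree :=
      Finset.single_le_sum (f := fun j => (P.coeff j).natDegree) (fun _ _ => Nat.zero_le _)
        (Finset.mem_range.2 hj)
    have h2 : 0 < m - j := by omega
    nlinarith
  · rw [hj, ← hm, hP.coeff_natDegree, natDegree_one]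
    exact Nat.zero_le _
  · rw [coeff_eq_zero_of_natDegree_lt (by rwa [hm]), natDegree_zero]
    exact Nat.zero_le _

lemma isWeighted_perturb (hP : IsWeighted w m P) (hQ : IsWeighted w m Q) (ε : ℂ) :
    IsWeighted w m (P + C (C ε) * Q) := by
  intro j
  rw [coeff_add, coeff_C_mul]
  refine ⟨(natDegree_add_le _ _).trans (max_le (hP j).1
    ((natDegree_C_mul_le _ _).trans (hQ j).1)), fun hj => ?_⟩
  rw [(hP j).2 hj, (hQ j).2 hj, mul_zero, add_zero]

/-- Every monic polynomial has small perturbations whose discriminant has simple zeros only. -/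
lemma exists_perturbation (hP : P.Monic) (hm : P.natDegree = m) (h2 : 2 ≤ m) :
    ∃ Q : ℂ[X][X], (∀ ε, (P + C (C ε) * Q).Monic ∧ (P + C (C ε) * Q).natDegree = m) ∧
      (Continuous fun z : ℂ × ℂ => (discPoly (P + C (C z.1) * Q) m).eval z.2) ∧
      {ε : ℂ | ∃ b, (discPoly (P + C (C ε) * Q) m).eval b = 0 ∧
        (derivative (discPoly (P + C (C ε) * Q) m)).eval b = 0}.Finite := by
  obtain ⟨w, hw, hPw⟩ := exists_isWeighted hP hm
  set Q₁ := modelPoly m (w * m) with hQ₁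
  have hQ1m := monic_modelPoly h2 (w * m)
  have hQ1d := natDegree_modelPoly h2 (w * m)
  set Q := Q₁ - P with hQ
  have hPd : P.degree = m := by rw [degree_eq_natDegree hP.ne_zero, hm]
  have hQd : Q.degree < P.degree := by
    have hd : Q₁.degree = P.degree := by
      rw [hPd, degree_eq_natDegree hQ1m.ne_zero, hQ1d]
    rw [← hd]
    exact degree_sub_lt_left hd hQ1m.ne_zero (by rw [hQ1m.leadingCoeff, hP.leadingCoeff])
  have hQd' : ∀ ε : ℂ, (C (C ε) * Q).degree < P.degree := fun ε =>
    ((degree_mul_le _ _).trans (add_le_add_left degree_C_le _)).trans_lt (by rwa [zero_add])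
  have hQw : IsWeighted w m Q := by
    intro j
    have h3 := isWeighted_modelPoly h2 w j
    rw [hQ, coeff_sub]
    refine ⟨(natDegree_sub_le _ _).trans (max_le h3.1 (hPw j).1), fun hj => ?_⟩
    rw [h3.2 hj, (hPw j).2 hj, sub_zero]
  refine ⟨Q, fun ε => ⟨hP.add_of_left (hQd' ε), ?_⟩, ?_⟩
  · rw [natDegree_add_eq_left_of_degree_lt (hQd' ε), hm]
  -- The pencil with `ε` as an indeterminate. Its discriminant `E` specializes to the discriminants
  -- of the members; the resultant `G` of `E` and its derivative is a polynomial in `ε`, nonzero at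
  -- `ε = 1`, where the member is the model.
  let F : ℂ[X][X][X] := P.map (mapRingHom C) + C (C X) * Q.map (mapRingHom C)
  have hF : ∀ ε, F.map (mapRingHom (evalRingHom ε)) = P + C (C ε) * Q := by
    intro ε
    have h4 : (mapRingHom (evalRingHom ε)).comp (mapRingHom (C : ℂ →+* ℂ[X])) = RingHom.id _ := by
      ext <;> simp
    simp only [F, Polynomial.map_add, Polynomial.map_mul, map_C, Polynomial.map_map, h4,
      Polynomial.map_id]
    simp
  let E : ℂ[X][X] := resultant F (derivative F) m (m - 1)
  have hE : ∀ ε, E.map (evalRingHom ε) = discPoly (P + C (C ε) * Q) m := by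
    intro ε
    rw [← hF, discPoly, derivative_map, resultant_map_map, coe_mapRingHom]
  constructor
  · have h : ∀ z : ℂ × ℂ, (discPoly (P + C (C z.1) * Q) m).eval z.2 =
        ∑ i ∈ Finset.range (E.natDegree + 1), (E.coeff i).eval z.1 * z.2 ^ i := by
      intro z
      rw [← hE, eval_eq_sum_range' (Nat.lt_succ_iff.2 natDegree_map_le)]
      simp
    simp only [h]
    exact continuous_finsetSum _ fun i _ =>
      ((E.coeff i).continuous.comp continuous_fst).mul (continuous_snd.pow i)
  set M := w * (m * (m - 1)) with hM
  have hM0 : M ≠ 0 := by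
    have : 0 < m * (m - 1) := Nat.mul_pos (by omega) (by omega)
    exact (Nat.mul_pos hw this).ne'
  let G : ℂ[X] := resultant E (derivative E) M (M - 1)
  have hG : ∀ ε, G.eval ε = resultant (discPoly (P + C (C ε) * Q) m)
      (derivative (discPoly (P + C (C ε) * Q) m)) M (M - 1) := by
    intro ε
    rw [← hE, derivative_map, resultant_map_map, coe_evalRingHom]
  have hG0 : G ≠ 0 := by
    intro h
    have h1 := hG 1
    rw [h, eval_zero, show P + C (C 1) * Q = Q₁ by rw [hQ]; simp] at h1
    obtain ⟨h3, h4⟩ := discPoly_modelPoly h2 hw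
    have h5 := resultant_ne_zero _ _ h3
    rw [natDegree_derivative, h4] at h5
    exact h5 h1.symm
  refine (finite_setOfPred_isRoot hG0).subset ?_
  rintro ε ⟨b, h3, h4⟩
  have hle : (discPoly (P + C (C ε) * Q) m).natDegree ≤ M :=
    (isWeighted_perturb hPw hQw ε).natDegree_discPoly_le (by omega)
  -- The resultant is a combination of the discriminant and its derivative, also when the degree
  -- drops below `M`; a common zero therefore forces `G.eval ε = 0`.
  obtain ⟨p, q, -, -, h5⟩ := exists_mul_add_mul_eq_C_resultant
    (discPoly (P + C (C ε) * Q) m) (derivative (discPoly (P + C (C ε) * Q) m)) hle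
    ((natDegree_derivative_le _).trans (Nat.sub_le_sub_right hle 1)) (Or.inl hM0)
  have h6 := congrArg (eval b) h5
  rw [eval_add, eval_mul, eval_mul, h3, h4, eval_C, ← hG] at h6
  change G.eval ε = 0
  rw [← h6]
  ring

end Perturbation

/-! ### Positivity of the monodromy around a branch point -/

section PositiveMonodromy

open scoped unitInterval Topology
open Polynomial

variable {m : ℕ}

/-- If a family of configurations is positive along small circles around `a`, it is positive along
every loop that goes once around `a`. -/
lemma IsLoopAlong.isPositive_map {N : Set ℂ} {u : Punctured N} {a : ℂ} (ha : a ∈ N)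
    {T : Path (u : ℂ) a} {δ : FundamentalGroup (Punctured N) u} (h : IsLoopAlong T δ)
    (Φ : C(Punctured N, Conf m)) {r : ℝ} (hr : 0 < r)
    (hpos : ∀ v : Punctured N, (v : ℂ) ∈ ball a r → ∀ ω : Path v v, IsCircle a ω →
      IsPositive (Φ v) (FundamentalGroup.fromPath (.mk (ω.map Φ.continuous)))) :
    IsPositive (Φ u) (FundamentalGroup.map Φ u δ) := by
  obtain ⟨s, ε, hε, hT, v, q, ω, hq, hω, rfl⟩ := h
  have hvε : (v : ℂ) ∈ ball a ε := by
    have h1 := hq 1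
    rw [q.target, mul_one] at h1
    rw [h1]
    exact hT s le_rfl
  have hε0 : 0 < ε := pos_of_mem_ball hvε
  have hE : ∀ z ∈ ball a ε \ {a}, z ∉ N := fun z hz hzN => hz.2 (hε ⟨hz.1, hzN⟩)
  have hva : (v : ℂ) ≠ a := fun h => v.2 (h ▸ ha)
  obtain ⟨z, hz1, hz2⟩ := (isPathConnected_puncturedBall a (lt_min hε0 hr)).nonempty
  have hzε : z ∈ ball a ε := ball_subset_ball (min_le_left _ _) hz1
  let v' : Punctured N := ⟨z, hE z ⟨hzε, hz2⟩⟩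
  obtain ⟨p, hp⟩ := exists_path_of_isPathConnected (isPathConnected_puncturedBall a hε0) hE
    (x := v) (y := v') ⟨hvε, hva⟩ ⟨hzε, hz2⟩
  have hω' := isCircle_circlePath a v' (rotate_notMem hε hzε v'.2)
  have h1 := lasso_circle hε hω hω' (r := p) fun t => (hp t).1
  rw [← lasso_mk, ← h1, map_lasso, map_lasso]
  exact ((hpos v' (ball_subset_ball (min_le_right _ _) hz1) _ hω').lasso _).lasso _

lemma continuous_rootConf_spec {T : Type} [TopologicalSpace T] {P : ℂ[X][X]} (hP : P.Monic)
    (hm : P.natDegree = m) {x : T → ℂ} (hx : Continuous x)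
    (h : ∀ t, (spec P (x t)).roots.toFinset.card = m) :
    Continuous fun t => rootConf (spec P (x t)) (h t) := by
  refine continuous_rootConf (fun t => ((natDegree_spec hP _).trans hm).le) (fun t => ?_)
    (fun k => ?_) h
  · rw [← hm, ← natDegree_spec hP (x t), (monic_spec hP _).coeff_natDegree]
    exact one_ne_zero
  · simp only [spec, coeff_map, coe_evalRingHom]
    exact (P.coeff k).continuous.comp hx

/-- The retraction of the plane to a closed disc along radii. -/
def toDisc (a : ℂ) (ρ : ℝ) (x : ℂ) : ℂ := a + (ρ / max ρ ‖x - a‖ : ℝ) * (x - a)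

lemma continuous_toDisc (a : ℂ) {ρ : ℝ} (hρ : 0 < ρ) : Continuous (toDisc a ρ) := by
  have h : ∀ x : ℂ, max ρ ‖x - a‖ ≠ 0 := fun x => (hρ.trans_le (le_max_left _ _)).ne'
  have h1 : Continuous fun x : ℂ => ρ / max ρ ‖x - a‖ :=
    continuous_const.div (by fun_prop) h
  unfold toDisc
  fun_prop

lemma toDisc_of_mem {a : ℂ} {ρ : ℝ} (hρ : 0 < ρ) {x : ℂ} (hx : x ∈ closedBall a ρ) :
    toDisc a ρ x = x := by
  rw [toDisc, max_eq_left (mem_closedBall_iff_norm.1 hx), div_self hρ.ne']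
  simp

lemma toDisc_of_notMem {a : ℂ} {ρ : ℝ} (hρ : 0 < ρ) {x : ℂ} (hx : x ∉ closedBall a ρ) :
    toDisc a ρ x ∈ sphere a ρ := by
  rw [mem_closedBall_iff_norm, not_le] at hx
  have h0 : 0 < ‖x - a‖ := hρ.trans hx
  rw [mem_sphere_iff_norm, toDisc, max_eq_right hx.le, add_sub_cancel_left, norm_mul,
    Complex.norm_real, Real.norm_of_nonneg (by positivity), div_mul_cancel₀ _ h0.ne']

/-- If the discriminant has only simple zeros in a disc and at least one, the fibres over its
boundary form a positive braid. -/
lemma isPositive_circle_of_simple {P : ℂ[X][X]} (hP : P.Monic) (hm : P.natDegree = m) (h2 : 2 ≤ m)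
    {a v : ℂ} {ρ : ℝ} (hρ : 0 < ρ) (hv : v ∈ sphere a ρ)
    (hsph : ∀ x ∈ sphere a ρ, (discPoly P m).eval x ≠ 0)
    (hzero : ∃ x ∈ ball a ρ, (discPoly P m).eval x = 0)
    (hsimple : ∀ b, (discPoly P m).eval b = 0 → (derivative (discPoly P m)).eval b ≠ 0)
    {K : Conf m} (w : Path K K)
    (hw : ∀ t y, y ∈ (w t).1 ↔ (spec P (a + turn t * (v - a))).eval y = 0) :
    IsPositive K (FundamentalGroup.fromPath (.mk w)) := by
  let N : Set ℂ := {x | x ∈ ball a ρ ∧ (discPoly P m).eval x = 0}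
  have hD : discPoly P m ≠ 0 := fun h => hsph v hv (by rw [h, eval_zero])
  have hN : N.Finite := (finite_setOfPred_isRoot hD).subset fun x hx => hx.2
  have hNb : N ⊆ ball a ρ := fun x hx => hx.1
  have hvN : v ∉ N := fun h => hsph v hv h.2
  let u : Punctured N := ⟨v, hvN⟩
  obtain ⟨δ, hδ⟩ := exists_isGeometricBase (u := u) hN hNb hρ hv
  have hlen := hδ.length_eq rfl
  -- A positive braid needs at least one factor; the zero inside the circle supplies it.
  have hne : δ ≠ [] := by
    rintro rfl
    obtain ⟨x, hx, hx0⟩ := hzero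
    have h0 := (ncard_eq_zero hN).1 hlen.symm
    exact (h0 ▸ (⟨hx, hx0⟩ : x ∈ N) : x ∈ (∅ : Set ℂ))
  obtain ⟨⟨b, T, hb, hloop⟩, ω, hω, hprod⟩ := hδ
  -- The discriminant may have zeros outside the disc, which are not in `N`. Composition with the
  -- retraction extends the fibres over the disc to all of `Punctured N`.
  have hret : ∀ x : Punctured N, (discPoly P m).eval (toDisc a ρ x) ≠ 0 := by
    intro x
    by_cases hx : (x : ℂ) ∈ closedBall a ρ
    · rw [toDisc_of_mem hρ hx]
      rcases (mem_closedBall.1 hx).lt_or_eq with h | h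
      · exact fun h0 => x.2 ⟨h, h0⟩
      · exact hsph _ h
    · exact hsph _ (toDisc_of_notMem hρ hx)
  have hcard : ∀ x : Punctured N, (spec P (toDisc a ρ x)).roots.toFinset.card = m := fun x =>
    (eval_discPoly_ne_zero_iff hP hm _).1 (hret x)
  let Φ : C(Punctured N, Conf m) := ⟨fun x => rootConf (spec P (toDisc a ρ x)) (hcard x),
    continuous_rootConf_spec hP hm ((continuous_toDisc a hρ).comp continuous_subtype_val) hcard⟩
  have hΦ : ∀ (x : Punctured N) (y : ℂ), (x : ℂ) ∈ closedBall a ρ →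
      (y ∈ (Φ x).1 ↔ (spec P x).eval y = 0) := by
    intro x y hx
    have h1 := mem_rootConf (monic_spec hP (toDisc a ρ x)).ne_zero (hcard x) y
    refine h1.trans ?_
    rw [toDisc_of_mem hρ hx]
  have hmain : IsPositive (Φ u) (FundamentalGroup.fromPath (.mk (ω.map Φ.continuous))) := by
    have h3 : FundamentalGroup.map Φ u δ.prod =
        FundamentalGroup.fromPath (.mk (ω.map Φ.continuous)) := by
      rw [hprod]
      rfl
    rw [← h3, map_list_prod]
    refine isPositive_list_prod (by simpa using hne) fun x hx => ?_
    obtain ⟨d, hd, rfl⟩ := List.mem_map.1 hx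
    obtain ⟨i, rfl⟩ := List.get_of_mem hd
    have hbi : b i ∈ N := hb.range_endpoint ▸ mem_range_self i
    obtain ⟨k, rfl⟩ : ∃ k, m = k + 2 := ⟨m - 2, by omega⟩
    obtain ⟨r, hr, hpos⟩ := exists_isPositive_of_simple hP hm hbi.2 (hsimple _ hbi.2)
    have hr' : 0 < ρ - dist (b i) a := sub_pos.2 hbi.1
    refine (hloop i).isPositive_map hbi Φ (lt_min hr hr') fun z hz ω' hω' => ?_
    have hz1 : (z : ℂ) ∈ ball (b i) r := ball_subset_ball (min_le_left _ _) hz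
    have hz2 : (z : ℂ) ∈ ball (b i) (ρ - dist (b i) a) := ball_subset_ball (min_le_right _ _) hz
    refine hpos z hz1 (fun h => z.2 (h ▸ hbi)) _ _ fun t y => ?_
    rw [← hω' t]
    refine hΦ (ω' t) y ?_
    rw [hω' t, mem_closedBall]
    have h4 := dist_triangle (b i + turn t * ((z : ℂ) - b i)) (b i) a
    rw [dist_rotate] at h4
    rw [mem_ball] at hz2
    linarith
  refine isPositive_of_freelyHomotopic ?_ hmain
  have hwt : ∀ t, w t = ω.map Φ.continuous t := by
    intro t
    refine Conf.ext_mem fun y => ?_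
    rw [hw]
    have h5 := hΦ (ω t) y (by
      rw [hω t, mem_closedBall, dist_rotate]
      exact (mem_sphere.1 hv).le)
    rw [hω t] at h5
    exact h5.symm
  refine exists_lasso_of_homotopy (H := fun z : I × I => w z.1) (by fun_prop) (fun τ => ?_)
    (fun t => rfl) (fun t => (hwt t).symm)
  rw [w.source, w.target]

/-- Without a zero, the maximum principle for `1 / p` would be violated at `a`. -/
lemma exists_zero_of_norm_lt {p : ℂ[X]} {a : ℂ} {ρ μ : ℝ} (hρ : 0 < ρ) (ha : ‖p.eval a‖ < μ)
    (hs : ∀ x ∈ sphere a ρ, μ < ‖p.eval x‖) : ∃ x ∈ ball a ρ, p.eval x = 0 := by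
  by_contra hne
  push Not at hne
  have hμ : 0 < μ := (norm_nonneg _).trans_lt ha
  have h0 : ∀ x ∈ closure (ball a ρ), p.eval x ≠ 0 := by
    intro x hx
    rw [closure_ball a hρ.ne', mem_closedBall] at hx
    rcases hx.lt_or_eq with h | h
    · exact hne x h
    · exact norm_pos_iff.1 (hμ.trans (hs x h))
  have hd : DiffContOnCl ℂ (fun x => p.eval x)⁻¹ (ball a ρ) :=
    p.differentiable.diffContOnCl.inv h0
  have h1 := Complex.norm_le_of_forall_mem_frontier_norm_le isBounded_ball hd (C := μ⁻¹) (z := a)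
    (fun z hz => by
      rw [frontier_ball a hρ.ne'] at hz
      rw [Pi.inv_apply, norm_inv]
      exact inv_anti₀ hμ (hs z hz).le) (subset_closure (mem_ball_self hρ))
  rw [Pi.inv_apply, norm_inv, inv_le_inv₀ (norm_pos_iff.2 (hne a (mem_ball_self hρ))) hμ] at h1
  linarith

/-- The fibres over a circle around an isolated zero of the discriminant form a positive braid. -/
lemma isPositive_circle {P : ℂ[X][X]} (hP : P.Monic) (hm : P.natDegree = m) (h2 : 2 ≤ m)
    {a v : ℂ} {ρ : ℝ} (hρ : 0 < ρ) (hv : v ∈ sphere a ρ) (ha : (discPoly P m).eval a = 0)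
    (hsph : ∀ x ∈ sphere a ρ, (discPoly P m).eval x ≠ 0) {K : Conf m} (w : Path K K)
    (hw : ∀ t y, y ∈ (w t).1 ↔ (spec P (a + turn t * (v - a))).eval y = 0) :
    IsPositive K (FundamentalGroup.fromPath (.mk w)) := by
  obtain ⟨Q, hQ, hcont, hfin⟩ := exists_perturbation hP hm h2
  have h0 : P + C (C 0) * Q = P := by simp
  obtain ⟨x₀, hx₀, hmin⟩ := (isCompact_sphere a ρ).exists_isMinOn ⟨v, hv⟩
    ((discPoly P m).continuous.norm.continuousOn)
  -- For small `ε` the discriminant stays above `μ` on the circle and below `μ` at `a`: no zero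
  -- reaches the circle, and at least one remains inside.
  set μ := ‖(discPoly P m).eval x₀‖ / 2 with hμ
  have hμ0 : 0 < μ := half_pos (norm_pos_iff.2 (hsph x₀ hx₀))
  have hμs : ∀ x ∈ sphere a ρ, μ < ‖(discPoly P m).eval x‖ := fun x hx =>
    (half_lt_self (norm_pos_iff.2 (hsph x₀ hx₀))).trans_le (hmin hx)
  have e1 : ∀ᶠ ε in 𝓝 (0 : ℂ), ∀ x ∈ sphere a ρ,
      μ < ‖(discPoly (P + C (C ε) * Q) m).eval x‖ := by
    refine (isCompact_sphere a ρ).eventually_forall_of_forall_eventually fun x hx => ?_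
    have h3 : ContinuousAt (fun z : ℂ × ℂ => ‖(discPoly (P + C (C z.1) * Q) m).eval z.2‖) (0, x) :=
      hcont.norm.continuousAt
    refine h3.eventually_const_lt ?_
    simp only [h0]
    exact hμs x hx
  have e2 : ∀ᶠ ε in 𝓝 (0 : ℂ), ‖(discPoly (P + C (C ε) * Q) m).eval a‖ < μ := by
    have h3 : ContinuousAt (fun ε : ℂ => ‖(discPoly (P + C (C ε) * Q) m).eval a‖) 0 :=
      (hcont.norm.comp (Continuous.prodMk_left a)).continuousAt
    refine h3.eventually_lt_const ?_
    simp only [h0, ha, norm_zero]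
    exact hμ0
  obtain ⟨r, hr, hball⟩ := Metric.eventually_nhds_iff_ball.1 (e1.and e2)
  obtain ⟨ε, hε, hεf⟩ := (infinite_of_mem_nhds (0 : ℂ) (ball_mem_nhds 0 hr)).exists_notMem_finite
    hfin
  simp only [mem_ofPred_eq, not_exists, not_and] at hεf
  have hτ : ∀ τ : I, (τ : ℝ) * ε ∈ ball (0 : ℂ) r := by
    intro τ
    rw [mem_ball_zero_iff] at hε ⊢
    rw [norm_mul, Complex.norm_real, Real.norm_of_nonneg τ.2.1]
    exact (mul_le_of_le_one_left (norm_nonneg _) τ.2.2).trans_lt hε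
  -- On the way from `0` to `ε` only the fibres over the circle matter, so intermediate parameters
  -- with multiple zeros of the discriminant do no harm.
  let p : I × I → ℂ[X] := fun z => spec (P + C (C ((z.2 : ℝ) * ε)) * Q) (a + turn z.1 * (v - a))
  have hcard : ∀ z, (p z).roots.toFinset.card = m := by
    intro z
    refine (eval_discPoly_ne_zero_iff (hQ _).1 (hQ _).2 _).1 (norm_pos_iff.1 (hμ0.trans ?_))
    refine (hball _ (hτ z.2)).1 _ ?_
    rw [mem_sphere, dist_rotate]
    exact hv
  have hpc : Continuous fun z => rootConf (p z) (hcard z) := by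
    refine continuous_rootConf (fun z => ((natDegree_spec (hQ _).1 _).trans (hQ _).2).le)
      (fun z => ?_) (fun k => ?_) hcard
    · have h3 := (natDegree_spec (hQ ((z.2 : ℝ) * ε)).1 (a + turn z.1 * (v - a))).trans (hQ _).2
      have h4 := (monic_spec (hQ ((z.2 : ℝ) * ε)).1 (a + turn z.1 * (v - a))).coeff_natDegree
      rw [h3] at h4
      rw [h4]
      exact one_ne_zero
    · simp only [spec, coeff_map, coe_evalRingHom, coeff_add, coeff_C_mul, eval_add, eval_mul,
        eval_C]
      have h5 : Continuous fun z : I × I => a + turn z.1 * (v - a) := by fun_prop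
      refine ((P.coeff k).continuous.comp h5).add (Continuous.mul (by fun_prop)
        ((Q.coeff k).continuous.comp h5))
  have h01 : ∀ τ : I, rootConf (p (0, τ)) (hcard (0, τ)) = rootConf (p (1, τ)) (hcard (1, τ)) := by
    intro τ
    apply Subtype.ext
    simp [rootConf, p, turn_zero, turn_one]
  let K' := rootConf (p (0, 1)) (hcard (0, 1))
  let w' : Path K' K' :=
    { toFun := fun t => rootConf (p (t, 1)) (hcard (t, 1))
      continuous_toFun := hpc.comp (by fun_prop)
      source' := rfl
      target' := (h01 1).symm }
  have hfree : FreelyHomotopic w w' := by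
    refine exists_lasso_of_homotopy hpc h01 (fun t => ?_) fun t => rfl
    refine Conf.ext_mem fun y => ?_
    rw [hw, mem_rootConf (monic_spec (hQ _).1 _).ne_zero]
    simp
  refine isPositive_of_freelyHomotopic hfree ?_
  obtain ⟨b1, b2⟩ := hball ε hε
  refine isPositive_circle_of_simple (hQ ε).1 (hQ ε).2 h2 hρ hv
    (fun x hx => norm_pos_iff.1 (hμ0.trans (b1 x hx))) (exists_zero_of_norm_lt hρ b2 b1) hεf w' ?_
  intro t y
  have h6 := mem_rootConf (monic_spec (hQ _).1 _).ne_zero (hcard (t, 1)) y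
  change y ∈ (rootConf (p (t, 1)) (hcard (t, 1))).1 ↔ _
  rw [h6]
  simp

end PositiveMonodromy

/-! ### The braid monodromy factorizations of a curve -/

section Curve

open scoped unitInterval Topology
open Polynomial

variable {m : ℕ} {S : Set (ℂ × ℂ)}

/-- The polynomial `f` as a polynomial in `y` whose coefficients are polynomials in `x`. -/
def nestedPoly (f : MvPolynomial (Fin 2) ℂ) : ℂ[X][X] :=
  ∑ d ∈ f.support, C (C (f.coeff d) * X ^ d 0) * X ^ d 1

lemma spec_nestedPoly (f : MvPolynomial (Fin 2) ℂ) (x : ℂ) :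
    spec (nestedPoly f) x = slice f x := by
  ext k
  rw [coeff_slice, spec, coeff_map, nestedPoly, finsetSum_coeff, map_sum]
  refine Finset.sum_congr rfl fun d _ => ?_
  rw [coeff_C_mul, coeff_X_pow]
  split_ifs <;> simp

lemma eval_coeff_nestedPoly (f : MvPolynomial (Fin 2) ℂ) (x : ℂ) (k : ℕ) :
    ((nestedPoly f).coeff k).eval x = (slice f x).coeff k := by
  rw [← spec_nestedPoly, spec, coeff_map, coe_evalRingHom]

/-- The coefficient of `y ^ m` is constant for reasons of degree, and nonzero by `top_ne_zero`, so
one may divide by it. -/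
lemma IsGenericCurve.exists_monic (hS : IsGenericCurve m S) : ∃ P : ℂ[X][X], P.Monic ∧
    P.natDegree = m ∧ ∀ x y, (x, y) ∈ S ↔ (spec P x).eval y = 0 := by
  obtain ⟨-, f, hd, hf, hl⟩ := hS
  have hl0 := top_ne_zero hl
  set l := f.coeff (Finsupp.single 1 m) with hldef
  have hcm : (C (C l⁻¹) * nestedPoly f).coeff m = 1 := by
    refine Polynomial.funext fun x => ?_
    rw [coeff_C_mul, eval_mul, eval_C, eval_coeff_nestedPoly, coeff_slice_top hd.le, ← hldef,
      inv_mul_cancel₀ hl0, eval_one]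
  have hle : (C (C l⁻¹) * nestedPoly f).natDegree ≤ m := by
    rw [natDegree_le_iff_coeff_eq_zero]
    intro k hk
    refine Polynomial.funext fun x => ?_
    rw [coeff_C_mul, eval_mul, eval_coeff_nestedPoly,
      coeff_eq_zero_of_natDegree_lt ((natDegree_slice_le hd.le x).trans_lt hk), mul_zero, eval_zero]
  refine ⟨C (C l⁻¹) * nestedPoly f, monic_of_natDegree_le_of_coeff_eq_one m hle hcm,
    natDegree_eq_of_le_of_coeff_ne_zero hle (by rw [hcm]; exact one_ne_zero), fun x y => ?_⟩
  have h1 : spec (C (C l⁻¹) * nestedPoly f) x = C l⁻¹ * slice f x := by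
    rw [← spec_nestedPoly]
    simp [spec]
  rw [h1, eval_mul, eval_C, mul_eq_zero, or_iff_right (inv_ne_zero hl0), eval_slice, hf]
  rfl

lemma mem_branchSet_iff {P : ℂ[X][X]} (hP : P.Monic) (hm : P.natDegree = m)
    (hPS : ∀ x y, (x, y) ∈ S ↔ (spec P x).eval y = 0) (x : ℂ) :
    x ∈ branchSet m S ↔ (discPoly P m).eval x = 0 := by
  have h1 : fiber S x = ((spec P x).roots.toFinset : Set ℂ) := by
    ext y
    rw [fiber, mem_ofPred_eq, hPS, Finset.mem_coe, Multiset.mem_toFinset,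
      mem_roots (monic_spec hP x).ne_zero, IsRoot]
  have h2 : (spec P x).roots.toFinset.card ≤ m :=
    (Multiset.toFinset_card_le _).trans ((card_roots' _).trans ((natDegree_spec hP x).trans hm).le)
  rw [← not_iff_not, ← Ne, eval_discPoly_ne_zero_iff hP hm, branchSet, mem_ofPred_eq, h1,
    encard_coe_eq_coe_finsetCard, Nat.cast_lt]
  omega

lemma two_le_of_mem_branchSet {P : ℂ[X][X]} (hP : P.Monic) (hm : P.natDegree = m) (h0 : 0 < m)
    {x : ℂ} (hx : (discPoly P m).eval x = 0) : 2 ≤ m := by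
  by_contra h
  obtain rfl : m = 1 := by omega
  refine (eval_discPoly_ne_zero_iff hP hm x).2 ?_ hx
  have h1 : (spec P x).roots.card = 1 := by
    rw [← (natDegree_spec hP x).trans hm]
    exact (IsAlgClosed.splits _).natDegree_eq_card_roots.symm
  obtain ⟨y, hy⟩ := Multiset.card_eq_one.1 h1
  rw [hy]
  simp

/-- The base point `u` witnesses that the discriminant does not vanish identically. -/
lemma finite_branchSet (hS : IsGenericCurve m S) (u : Punctured (branchSet m S)) :
    (branchSet m S).Finite := by
  obtain ⟨P, hP, hm, hPS⟩ := hS.exists_monic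
  have hD : discPoly P m ≠ 0 := fun h =>
    u.2 ((mem_branchSet_iff hP hm hPS u).2 (by rw [h, eval_zero]))
  exact (finite_setOfPred_isRoot hD).subset fun x hx => (mem_branchSet_iff hP hm hPS x).1 hx

lemma mem_fiberConf (hS : IsGenericCurve m S) (x : Punctured (branchSet m S)) (y : ℂ) :
    y ∈ (fiberConf hS x).1 ↔ ((x : ℂ), y) ∈ S := by
  have h2 : y ∈ (fiberConf hS x).1 ↔ y ∈ fiber S x := by simp [fiberConf]
  exact h2

/-- The braid monodromy of a loop around a branch point is positive. -/
lemma isPositive_braidMonodromy (hS : IsGenericCurve m S) {u : Punctured (branchSet m S)} {a : ℂ}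
    (ha : a ∈ branchSet m S) {T : Path (u : ℂ) a}
    {δ : FundamentalGroup (Punctured (branchSet m S)) u} (h : IsLoopAlong T δ) :
    IsPositive (fiberConf hS u) (braidMonodromy hS u δ) := by
  obtain ⟨P, hP, hm, hPS⟩ := hS.exists_monic
  have ha0 := (mem_branchSet_iff hP hm hPS a).1 ha
  have h2 := two_le_of_mem_branchSet hP hm hS.1 ha0
  have hiso : ∀ᶠ x in 𝓝 a, x ∉ branchSet m S \ {a} :=
    ((finite_branchSet hS u).subset sdiff_subset).isClosed.isOpen_compl.mem_nhds fun h => h.2 rfl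
  obtain ⟨r, hr, hball⟩ := Metric.eventually_nhds_iff_ball.1 hiso
  refine h.isPositive_map ha ⟨fiberConf hS, continuous_fiberConf hS⟩ hr fun v hv ω hω => ?_
  have hva : (v : ℂ) ≠ a := fun h => v.2 (h ▸ ha)
  refine isPositive_circle hP hm h2 (a := a) (v := v) (dist_pos.2 hva) rfl ha0 (fun x hx h0 => ?_) _
    fun t y => ?_
  · refine hball x ?_ ⟨(mem_branchSet_iff hP hm hPS x).2 h0, fun hxa => ?_⟩
    · rw [mem_ball, mem_sphere.1 hx]
      exact hv
    · rw [mem_singleton_iff.1 hxa, mem_sphere, dist_self] at hx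
      exact hva (dist_eq_zero.1 hx.symm)
  · rw [← hω t, ← hPS]
    exact mem_fiberConf hS (ω t) y

/-- There are no paths to choose, and the circle contracts to `u` along straight lines; so the disc
plays no role. -/
lemma isGeometricBase_iff_of_empty {N : Set ℂ} (hN : N = ∅) {c : ℂ} {R : ℝ} {u : Punctured N}
    {δ : List (FundamentalGroup (Punctured N) u)} : IsGeometricBase c R u δ ↔ δ = [] := by
  subst hN
  constructor
  · intro h
    have := h.length_eq (n := 0) (by rw [ncard_empty])
    exact List.eq_nil_of_length_eq_zero this
  · rintro rfl
    have hc : ∀ t : ℝ, c + turn t * ((u : ℂ) - c) ∉ (∅ : Set ℂ) :=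
      fun t => notMem_empty _
    refine ⟨⟨fun i => i.elim0, fun i => i.elim0, ⟨fun i => i.elim0, ?_, fun i => i.elim0,
      fun i => i.elim0, fun i => i.elim0, fun i => i.elim0⟩, fun i => i.elim0⟩,
      circlePath c u hc, isCircle_circlePath c u hc, ?_⟩
    · exact @range_eq_empty _ _ Fin.isEmpty _
    · obtain ⟨r, hr⟩ := exists_lasso_of_homotopy (X := Punctured ∅) (H := fun z : I × I =>
          (⟨u + (1 - (z.2 : ℝ) : ℝ) * ((circlePath c u hc z.1 : ℂ) - u), notMem_empty _⟩ :
            Punctured ∅)) (by fun_prop) (fun τ => by simp)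
        (w := circlePath c u hc) (w' := Path.refl u) (fun t => by ext; simp)
        (fun t => by ext; simp)
      rw [List.prod_nil, ← hr]
      exact (lasso_one _).symm

/-- The disc may be taken of positive radius. -/
lemma exists_disc {N : Set ℂ} {c : ℂ} {R : ℝ} (hN : N ⊆ ball c R) {u : Punctured N}
    (hu : (u : ℂ) ∈ sphere c R) : ∃ (c' : ℂ) (R' : ℝ), 0 < R' ∧ N ⊆ ball c' R' ∧
      (u : ℂ) ∈ sphere c' R' ∧ ∀ δ, IsGeometricBase c R u δ ↔ IsGeometricBase c' R' u δ := by
  rcases lt_or_ge 0 R with h | h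
  · exact ⟨c, R, h, hN, hu, fun δ => Iff.rfl⟩
  · have hN0 : N = ∅ := by
      rw [ball_eq_empty.2 h] at hN
      exact subset_empty_iff.1 hN
    refine ⟨u - 1, 1, one_pos, hN0.le.trans (empty_subset _), by simp, fun δ => ?_⟩
    rw [isGeometricBase_iff_of_empty hN0, isGeometricBase_iff_of_empty hN0]

end Curve

end
end BraidMonodromy

theorem mainTheorem3 (m : ℕ) (S : Set (ℂ × ℂ)) (hS : IsGenericCurve m S)
    (c : ℂ) (R : ℝ) (hN : branchSet m S ⊆ Metric.ball c R)
    (u : Punctured (branchSet m S)) (hu : (u : ℂ) ∈ Metric.sphere c R) :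
    ∃! C : Set (PositiveFactorization (fiberConf hS u)),
      C ∈ (PositiveFactorization.setoid (fiberConf hS u)).classes ∧
        braidMonodromyFactorizations hS c R u = Subtype.val '' C := by
  obtain ⟨c', R', hR', hN', hu', hiff⟩ := exists_disc hN hu
  have hfin := finite_branchSet hS u
  have hpf : ∀ δ, IsGeometricBase c' R' u δ → (δ.map (braidMonodromy hS u)).prod =
      deltaSq (fiberConf hS u) ∧ ∀ b ∈ δ.map (braidMonodromy hS u), IsPositive (fiberConf hS u) b := by
    rintro δ ⟨⟨a, T, hb, hloop⟩, ω, hω, hprod⟩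
    constructor
    · rw [← map_list_prod, hprod]
      exact braidMonodromy_circle hS hN' hR' hu' hω
    · intro b hb'
      obtain ⟨d, hd, rfl⟩ := List.mem_map.1 hb'
      obtain ⟨i, rfl⟩ := List.get_of_mem hd
      exact isPositive_braidMonodromy hS (hb.range_endpoint ▸ Set.mem_range_self i) (hloop i)
  obtain ⟨δ₀, hδ₀⟩ := exists_isGeometricBase hfin hN' hR' hu'
  let a₀ : PositiveFactorization (fiberConf hS u) := ⟨δ₀.map (braidMonodromy hS u), hpf δ₀ hδ₀⟩
  have hset : braidMonodromyFactorizations hS c R u =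
      Subtype.val '' {a | (PositiveFactorization.setoid (fiberConf hS u)) a a₀} := by
    ext b
    constructor
    · rintro ⟨δ, hδ, rfl⟩
      rw [hiff] at hδ
      exact ⟨⟨_, hpf δ hδ⟩, (hδ.hurwitzEquiv hfin hN' hR' hu' hδ₀).map _, rfl⟩
    · rintro ⟨b, hb, rfl⟩
      have hb' : HurwitzEquiv (δ₀.map (braidMonodromy hS u)) b.1 := Relation.EqvGen.symm _ _ hb
      -- The Hurwitz moves are lifted to the base `δ₀`, where they lead to another geometric base.
      obtain ⟨δ, hδ, hδ'⟩ := hb'.lift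
      exact ⟨δ, (hiff δ).2 (hδ₀.of_hurwitzEquiv hfin hN' hR' hu' hδ'), hδ⟩
  refine ⟨_, ⟨⟨a₀, rfl⟩, hset⟩, ?_⟩
  -- Uniqueness is formal: a set of positive factorizations is determined by its set of underlying
  -- tuples.
  rintro C ⟨-, hC⟩
  exact Set.image_injective.2 Subtype.val_injective (hC.symm.trans hset)
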